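/- For real-valued functions $f_0,f_1$ on $\mathbb R$, with derivatives understood in the weak sense, and $\langle x\rangle=(1+x^2)^{1/2}$, let $$L^{2,1}(\mathbb R)=\{u:\ \langle x\rangle u\in L^2(\mathbb R)\},\qquad H^{1,1}(\mathbb R)=\{u\in L^1_{loc}(\mathbb R):\ u,u'\in L^{2,1}(\mathbb R)\},$$ $$\mathcal I=\{(f_0,f_1):\ f_0,f_1\in L^1_{loc}(\mathbb R),\ \sin f_0,\ 1-\cos f_0,\ f_0',\ f_0'',\ f_1,\ f_1'\in L^{2,1}(\mathbb R)\}.$$ For $z\in\mathbb R\setminus\{0\}$ put $J(z)=\frac i4(z-z^{-1})\begin{pmatrix}1&0\\0&-1\end{pmatrix}$ and $$U(x,z)=\begin{pmatrix}\frac{i}{4z}(\cos f_0-1)&\frac{i}{4z}\sin f_0-\frac14(f_0'+f_1)\\[2pt] \frac{i}{4z}\sin f_0+\frac14(f_0'+f_1)&\frac{i}{4z}(1-\cos f_0)\end{pmatrix}.$$ **Proposition.** Let $(f_0,f_1)\in\mathcal I$. Then for every $z\in\mathbb R\setminus\{0\}$ the system $\Psi_x=(-J(z)+U(x,z))\Psi$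 has unique (absolutely continuous, $2\times2$ matrix-valued) solutions $\Psi^\pm(x,z)$ with $\lim_{x\to\pm\infty}\Psi^\pm(x,z)e^{xJ(z)}=I$, and there is a unique matrix $$S(z)=\begin{pmatrix}a(z)&\breve b(z)\\ b(z)&\breve a(z)\end{pmatrix}\quad\text{with}\quad \Psi^+(x,z)=\Psi^-(x,z)S(z)\ \text{ for all }x\in\mathbb R.$$ Assume moreover that $a(z)\neq0$ for all $z\in\mathbb R\setminus\{0\}$ (since $\breve a=\overline a$ on the real line, this also says $\breve a\ne0$ there). Then the reflection coefficient $r(z)=-b(z)/\breve a(z)$ satisfies 1. $r\in H^{1,1}(\mathbb R)$; 2. $\lim_{z\to0,\ z\in\mathbb R\setminus\{0\}} r(z)/z=0$. -/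

import Mathlib

open MeasureTheory Filter Topology
open scoped ContDiff

noncomputable section

namespace SineGordon

/-- `v` is the weak (distributional) derivative of `u` on the real line; both are locally
integrable. -/
def HasWeakDeriv {E : Type*} [NormedAddCommGroup E] [NormedSpace ℝ E] (u v : ℝ → E) : Prop :=
  LocallyIntegrable u volume ∧ LocallyIntegrable v volume ∧
    ∀ φ : ℝ → ℝ, ContDiff ℝ ∞ φ → HasCompactSupport φ →
      ∫ x, deriv φ x • u x = -∫ x, φ x • v x

/-- `u` has a locally integrable weak derivative. -/
def WeaklyDifferentiable {E : Type*} [NormedAddCommGroup E] [NormedSpace ℝ E] (u : ℝ → E) : Prop :=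
  ∃ v, HasWeakDeriv u v

open Classical in
/-- A representative of the weak derivative of `u` (unique up to a null set), and `0` if there is
none. -/
def weakDeriv {E : Type*} [NormedAddCommGroup E] [NormedSpace ℝ E] (u : ℝ → E) : ℝ → E :=
  if h : WeaklyDifferentiable u then h.choose else 0

/-- The weighted space `L^{2,1}(ℝ)`: `⟨x⟩ u ∈ L²` with `⟨x⟩ = (x² + 1)^{1/2}`. -/
def MemL21 {E : Type*} [NormedAddCommGroup E] [NormedSpace ℝ E] (u : ℝ → E) : Prop :=
  MemLp (fun x : ℝ => Real.sqrt (x ^ 2 + 1) • u x) 2 volume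

/-- The weighted Sobolev space `H^{1,1}(ℝ)`: `u` and `u'` lie in `L^{2,1}(ℝ)`. -/
def MemH11 {E : Type*} [NormedAddCommGroup E] [NormedSpace ℝ E] (u : ℝ → E) : Prop :=
  WeaklyDifferentiable u ∧ MemL21 u ∧ MemL21 (weakDeriv u)

/-- The space of initial data `(f₀, f₁)` (real valued) such that
`sin f₀, 1 - cos f₀, f₀', f₀'', f₁, f₁' ∈ L^{2,1}(ℝ)`. -/
def initialDataSpace : Set ((ℝ → ℝ) × (ℝ → ℝ)) :=
  {f | WeaklyDifferentiable f.1 ∧ WeaklyDifferentiable (weakDeriv f.1) ∧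
    WeaklyDifferentiable f.2 ∧
    MemL21 (fun x => Real.sin (f.1 x)) ∧ MemL21 (fun x => 1 - Real.cos (f.1 x)) ∧
    MemL21 (weakDeriv f.1) ∧ MemL21 (weakDeriv (weakDeriv f.1)) ∧
    MemL21 f.2 ∧ MemL21 (weakDeriv f.2)}

/-- `J(z) = (i/4) (z - 1/z) σ₃`. -/
def J (z : ℝ) : Matrix (Fin 2) (Fin 2) ℂ :=
  (Complex.I / 4 * ((z : ℂ) - (z : ℂ)⁻¹)) • !![1, 0; 0, -1]

/-- The matrix potential `U(x, z)` at time `0`, where `f = f₀`, `f_x = f₀'` and `f_t = f₁`. -/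
def U (f : (ℝ → ℝ) × (ℝ → ℝ)) (x z : ℝ) : Matrix (Fin 2) (Fin 2) ℂ :=
  let c : ℂ := (Real.cos (f.1 x) : ℝ)
  let s : ℂ := (Real.sin (f.1 x) : ℝ)
  let q : ℂ := (weakDeriv f.1 x + f.2 x : ℝ)
  !![Complex.I / (4 * z) * (c - 1), Complex.I / (4 * z) * s - 1 / 4 * q;
     Complex.I / (4 * z) * s + 1 / 4 * q, Complex.I / (4 * z) * (1 - c)]

/-- `Ψ` solves `Ψ_x = (-J(z) + U(x, z)) Ψ` on the real line, in the sense of absolutely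
continuous (Carathéodory) solutions: the potential is only defined almost everywhere. -/
def IsSolution (f : (ℝ → ℝ) × (ℝ → ℝ)) (z : ℝ) (Ψ : ℝ → Matrix (Fin 2) (Fin 2) ℂ) : Prop :=
  Continuous Ψ ∧ ∀ (x : ℝ) (i j : Fin 2),
    Ψ x i j = Ψ 0 i j + ∫ y in (0 : ℝ)..x, ((-J z + U f y z) * Ψ y) i j

/-- The Jost solution normalized at the end `l` of the line (`l = atTop` gives `Ψ⁺`, `l = atBot`
gives `Ψ⁻`): `Ψ(x) e^{x J(z)} → I` along `l`. -/
def IsJost (f : (ℝ → ℝ) × (ℝ → ℝ)) (z : ℝ) (l : Filter ℝ)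
    (Ψ : ℝ → Matrix (Fin 2) (Fin 2) ℂ) : Prop :=
  IsSolution f z Ψ ∧ Tendsto (fun x : ℝ => Ψ x * NormedSpace.exp ((x : ℂ) • J z)) l (𝓝 1)

/-- `S` is the scattering matrix at `z`: `Ψ⁺(x, z) = Ψ⁻(x, z) S` for all `x`. -/
def IsScatteringMatrix (f : (ℝ → ℝ) × (ℝ → ℝ)) (z : ℝ) (S : Matrix (Fin 2) (Fin 2) ℂ) : Prop :=
  ∃ Ψp Ψm : ℝ → Matrix (Fin 2) (Fin 2) ℂ, IsJost f z atTop Ψp ∧ IsJost f z atBot Ψm ∧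
    ∀ x, Ψp x = Ψm x * S

open Classical in
/-- The scattering matrix `S(z)`, with rows `(a, b̆)` and `(b, ă)`. Only the values at `z ≠ 0`
matter. -/
def scatteringMatrix (f : (ℝ → ℝ) × (ℝ → ℝ)) (z : ℝ) : Matrix (Fin 2) (Fin 2) ℂ :=
  if h : ∃ S, IsScatteringMatrix f z S then h.choose else 0

/-- The reflection coefficient `r(z) = -b(z) / ă(z)`. -/
def reflectionCoefficient (f : (ℝ → ℝ) × (ℝ → ℝ)) (z : ℝ) : ℂ :=
  -(scatteringMatrix f z 1 0) / scatteringMatrix f z 1 1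

end SineGordon

end

/-!
The Jost solutions are handled in the interaction picture, the uniform estimates are proved for
compactly supported coefficients on one half line of the variable `λ = (z - 1/z)/2`, and the
general case follows by truncation, by a gauge transformation and by a change of variables.

*Interaction picture.* For `z > 0` one has `1/z = √(λ² + 1) - λ`, called `eps λ`. The function
`Φ = e^{xJ} Ψ` satisfies `Φ' = W Φ` with `W` integrable in `x` and `su(2)`-valued, so the solution
equal to `I` at `+∞` exists (`exists_hasDerivAt_tendsto_atTop`), is `SU(2)`-valued and is
determined by its first column `(α, β)`, a `JostPair`. Its limit at `-∞` is the scattering matrix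
`[a, -b̄; b, ā]`, and `r = -b/ā`. Existence and uniqueness of the Jost solutions and of `S(z)`
follow (`scattering_of_hasScattering`). The scattering data depend on the coefficients in a
Lipschitz way for the `L¹` norm (`HasScattering.norm_sub_le`).

*Uniform estimates for `λ > 0`.* There `eps λ ≤ 1/(1 + λ)`, so the coefficients are bounded, and
`x` and `λ` interact only through the factor `e^{-iλx}`. Plancherel (`lintegral_sq_fourier_le`)
and an integration by parts show that `∫ k(x) e^{-iλx} G(λ, x) dx` is in `L²(dλ)` when `k ∈ L²`
and the amplitude `G` varies slowly in `x` (`UL2.oscillatory`); in this way `β(λ, x)` is in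
`L²(dλ)` uniformly in `x`. A factor `λ` costs a derivative of `k`, and the terms in which the two
oscillating factors cancel are averages of `β`, controlled by Minkowski's inequality
(`UL2.average`). Applied to `b` and to `∂S/∂λ = -S ∫ Φ* (∂W/∂λ) Φ dx`, these bounds show that
`(1 + λ) ρ` and `(1 + λ) ρ'` are bounded in `L²(0, ∞)`, for `ρ(λ) = r(z)`, by constants depending
only on the `H^{1,1}` norms of the coefficients and on a lower bound for `|a|` (`ul2_rho`). For
such a lower bound it is enough that `a` has no zero, since `λ b` is bounded and
`|a|² + |b|² = 1`. Cutting off the coefficients, the Lipschitz dependence gives pointwise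
convergence of `ρ`, and weak compactness of balls in `L²` carries the bounds over to the limit
(`Weighted.rho_mem`).

*The remaining half lines.* As `λ → -∞`, that is `z → 0`, `eps λ` is unbounded and the estimates
above fail. The rotation by `f₀/2` turns the system at `λ` into the complex conjugate of the
system at `-λ` for the data `(-f₀, f₁)` (`Profile.exists_scattering_neg`); at both ends of the
line `f₀` tends to a multiple of `2π`, so the rotation tends to `±I` there, and the ratio `ρ` is
only conjugated. Negative `z` are reduced to positive ones by `r(-z) = conj r(z)`.

*Return to `z`.* Because of `(1 + z²) λ'(z) = 2(1 + λ²)` for `z > 0`, the weighted Sobolev norms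
in `λ` control those in `z` (`LineSob.exists_comp_lam`). A function `ρ` in `H^{1,1}(dλ)` satisfies
`⟨λ⟩ ρ → 0` at `-∞` (`LineSob.tendsto_wt_mul`), which says that `r(z)/z → 0` at `z = 0`; in
particular the two halves of `r` fit together continuously at `0`. Weak derivatives are exchanged
for absolutely continuous representatives by the du Bois-Reymond lemma (`exists_ae_eq_const`,
`exists_profile`, `LineSob.memH11`).
-/

namespace SineGordon

noncomputable section

open Complex Set
open scoped ComplexConjugate ENNReal NNReal FourierTransform SchwartzMap InnerProductSpace

/-! ### Linear differential equations with a prescribed limit at `+∞` -/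

theorem hasDerivAt_integral_Ioi {E : Type*} [NormedAddCommGroup E] [NormedSpace ℝ E]
    [CompleteSpace E] {g : ℝ → E} (hg : Continuous g) (hi : Integrable g) (x : ℝ) :
    HasDerivAt (fun x => ∫ y in Ioi x, g y) (-g x) x := by
  have h1 : (fun x => ∫ y in Ioi x, g y) = fun x => (∫ y in Ioi 0, g y) - ∫ y in (0 : ℝ)..x, g y := by
    ext x
    rw [← intervalIntegral.integral_interval_add_Ioi' (hi.intervalIntegrable (a := 0) (b := x))
      hi.integrableOn]
    abel
  rw [h1]
  exact (hg.integral_hasStrictDerivAt 0 x).hasDerivAt.const_sub _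

/-- A linear differential equation with integrable coefficients has a solution with any prescribed
limit at `+∞`: the integral equation is a contraction for the norm weighted by
`exp (-2 ∫_x^∞ m)`. -/
theorem exists_hasDerivAt_tendsto_atTop {E : Type*} [NormedAddCommGroup E] [NormedSpace ℝ E]
    [CompleteSpace E] {A : ℝ → E →L[ℝ] E} (hA : Continuous A) {m : ℝ → ℝ} (hm : Continuous m)
    (hmi : Integrable m) (hAm : ∀ x, ‖A x‖ ≤ m x) (v₀ : E) :
    ∃ v : ℝ → E, (∀ x, HasDerivAt v (A x (v x)) x) ∧ Tendsto v atTop (𝓝 v₀) := by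
  have hm0 : ∀ x, 0 ≤ m x := fun x => (norm_nonneg _).trans (hAm x)
  set M : ℝ → ℝ := fun x => ∫ y in Ioi x, m y with hM
  have hMd : ∀ x, HasDerivAt M (-m x) x := hasDerivAt_integral_Ioi hm hmi
  have hMc : Continuous M := continuous_iff_continuousAt.2 fun x => (hMd x).continuousAt
  have hM0 : ∀ x, 0 ≤ M x := fun x => setIntegral_nonneg measurableSet_Ioi fun y _ => hm0 y
  set T := ∫ y, m y with hT
  have hMT : ∀ x, M x ≤ T := fun x =>
    setIntegral_le_integral hmi (Eventually.of_forall hm0)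
  set w : ℝ → ℝ := fun x => Real.exp (2 * M x) with hw
  have hwc : Continuous w := by fun_prop
  have hwT : ∀ x, w x ≤ Real.exp (2 * T) := fun x => Real.exp_le_exp.2 (by linarith [hMT x])
  have hw0 : ∀ x, 0 < w x := fun x => Real.exp_pos _
  have hw1 : ∀ x, 1 ≤ w x := fun x => Real.one_le_exp (by linarith [hM0 x])
  have hmw : Integrable fun x => m x * w x := by
    refine (hmi.mul_const (Real.exp (2 * T))).mono' (by fun_prop) (Eventually.of_forall fun x => ?_)
    rw [Real.norm_of_nonneg (mul_nonneg (hm0 x) (hw0 x).le)]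
    exact mul_le_mul_of_nonneg_left (hwT x) (hm0 x)
  have hmwI : ∀ x, ∫ y in Ioi x, m y * w y = (w x - 1) / 2 := by
    intro x
    have hd : ∀ y ∈ Ici x, HasDerivAt (fun y => -(w y / 2)) (m y * w y) y := by
      intro y _
      have := ((((hMd y).const_mul 2).exp).div_const 2).neg
      convert! this using 1
      simp only [hw]; ring
    have hl : Tendsto (fun y => -(w y / 2)) atTop (𝓝 (-(1 / 2))) := by
      have h0 : Tendsto M atTop (𝓝 0) := tendsto_integral_Ioi_zero tendsto_id
      have : Tendsto (fun y => -(Real.exp (2 * M y) / 2)) atTop (𝓝 (-(Real.exp (2 * 0) / 2))) :=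
        (((Real.continuous_exp.tendsto _).comp (h0.const_mul 2)).div_const 2).neg
      simpa using this
    rw [integral_Ioi_of_hasDerivAt_of_tendsto' hd hmw.integrableOn hl]
    ring
  -- the integrand attached to a bounded continuous function
  let g : BoundedContinuousFunction ℝ E → ℝ → E := fun θ y => A y (w y • θ y)
  have hgc : ∀ θ, Continuous (g θ) := fun θ => hA.clm_apply (hwc.smul θ.continuous)
  have hgb : ∀ (θ θ' : BoundedContinuousFunction ℝ E) y, ‖g θ y - g θ' y‖ ≤ m y * w y * dist θ θ' := by
    intro θ θ' y
    simp only [g]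
    rw [← map_sub, ← smul_sub]
    calc ‖A y (w y • (θ y - θ' y))‖ ≤ ‖A y‖ * ‖w y • (θ y - θ' y)‖ := (A y).le_opNorm _
      _ ≤ m y * (w y * dist θ θ') := by
        gcongr
        · exact hm0 y
        · exact hAm y
        · rw [norm_smul, Real.norm_of_nonneg (hw0 y).le, ← dist_eq_norm]
          exact mul_le_mul_of_nonneg_left (BoundedContinuousFunction.dist_coe_le_dist y) (hw0 y).le
      _ = _ := by ring
  have hg0 : ∀ y, g 0 y = 0 := fun y => by simp [g]
  have hgi : ∀ θ, Integrable (g θ) := fun θ =>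
    (hmw.mul_const (dist θ 0)).mono' (hgc θ).aestronglyMeasurable
      (Eventually.of_forall fun y => by simpa [hg0] using hgb θ 0 y)
  have hIc : ∀ θ, Continuous fun x => ∫ y in Ioi x, g θ y := fun θ =>
    continuous_iff_continuousAt.2 fun x => (hasDerivAt_integral_Ioi (hgc θ) (hgi θ) x).continuousAt
  have hIb : ∀ θ θ' x, ‖(∫ y in Ioi x, g θ y) - ∫ y in Ioi x, g θ' y‖ ≤ (w x - 1) / 2 * dist θ θ' := by
    intro θ θ' x
    rw [← integral_sub (hgi θ).integrableOn (hgi θ').integrableOn]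
    refine (norm_integral_le_integral_norm _).trans ?_
    calc ∫ y in Ioi x, ‖g θ y - g θ' y‖ ≤ ∫ y in Ioi x, m y * w y * dist θ θ' :=
          integral_mono (((hgi θ).sub (hgi θ')).norm.integrableOn)
            (hmw.mul_const _).integrableOn (hgb θ θ')
      _ = _ := by rw [integral_mul_const, hmwI]
  let F : BoundedContinuousFunction ℝ E → BoundedContinuousFunction ℝ E := fun θ =>
    BoundedContinuousFunction.ofNormedAddCommGroup
      (fun x => (w x)⁻¹ • (v₀ - ∫ y in Ioi x, g θ y))
      ((hwc.inv₀ fun x => (hw0 x).ne').smul (continuous_const.sub (hIc θ)))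
      (‖v₀‖ + dist θ 0) (fun x => by
        have h1 : ‖∫ y in Ioi x, g θ y‖ ≤ (w x - 1) / 2 * dist θ 0 := by
          simpa [hg0] using hIb θ 0 x
        rw [norm_smul, norm_inv, Real.norm_of_nonneg (hw0 x).le, inv_mul_le_iff₀ (hw0 x)]
        have h2 := norm_sub_le v₀ (∫ y in Ioi x, g θ y)
        nlinarith [norm_nonneg v₀, hw1 x, dist_nonneg (x := θ) (y := 0)])
  have hF : ContractingWith (1 / 2) F := by
    refine ⟨by rw [← NNReal.coe_lt_coe]; norm_num, LipschitzWith.of_dist_le_mul fun θ θ' => ?_⟩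
    rw [BoundedContinuousFunction.dist_le (by positivity)]
    intro x
    have hFx : ∀ θ, F θ x = (w x)⁻¹ • (v₀ - ∫ y in Ioi x, g θ y) := fun _ => rfl
    rw [dist_eq_norm, hFx, hFx, ← smul_sub, norm_smul, norm_inv, Real.norm_of_nonneg (hw0 x).le,
      inv_mul_le_iff₀ (hw0 x), sub_sub_sub_cancel_left, norm_sub_rev]
    refine (hIb θ θ' x).trans ?_
    push_cast
    nlinarith [hw1 x, dist_nonneg (x := θ) (y := θ')]
  let θ := hF.fixedPoint
  have hθ : ∀ x, w x • θ x = v₀ - ∫ y in Ioi x, g θ y := by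
    intro x
    have : F θ = θ := hF.fixedPoint_isFixedPt
    have h2 : θ x = (w x)⁻¹ • (v₀ - ∫ y in Ioi x, g θ y) := by
      conv_lhs => rw [← this]
      rfl
    rw [h2, smul_smul, mul_inv_cancel₀ (hw0 x).ne', one_smul]
  refine ⟨fun x => v₀ - ∫ y in Ioi x, g θ y, fun x => ?_, ?_⟩
  · have := (hasDerivAt_integral_Ioi (hgc θ) (hgi θ) x).const_sub v₀
    rw [neg_neg] at this
    simpa only [g, hθ x] using this
  · have : Tendsto (fun x => ∫ y in Ioi x, g θ y) atTop (𝓝 0) := tendsto_integral_Ioi_zero tendsto_id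
    simpa using this.const_sub v₀

/-! ### The `su(2)`-valued system and its scattering data -/

/-- `(α, β)` is the first column of the solution `[α, -β̄; β, ᾱ]`, equal to the identity at `+∞`, of
the `su(2)`-valued system with coefficient matrix `[iκ, -P̄; P, -iκ]`. -/
structure JostPair (κ : ℝ → ℝ) (P : ℝ → ℂ) (α β : ℝ → ℂ) : Prop where
  deriv_left : ∀ x, HasDerivAt α (I * κ x * α x - conj (P x) * β x) x
  deriv_right : ∀ x, HasDerivAt β (P x * α x - I * κ x * β x) x
  lim_left : Tendsto α atTop (𝓝 1)
  lim_right : Tendsto β atTop (𝓝 0)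

/-- Coefficients of the `su(2)`-valued system that are continuous and integrable. -/
structure Admissible (κ : ℝ → ℝ) (P : ℝ → ℂ) : Prop where
  cont_left : Continuous κ
  cont_right : Continuous P
  int_left : Integrable κ
  int_right : Integrable P

theorem Admissible.exists_jostPair {κ : ℝ → ℝ} {P : ℝ → ℂ} (h : Admissible κ P) :
    ∃ α β, JostPair κ P α β := by
  have h1 := h.cont_left
  have h2 := h.cont_right
  let fst := ContinuousLinearMap.fst ℝ ℂ ℂ
  let snd := ContinuousLinearMap.snd ℝ ℂ ℂ
  let A : ℝ → (ℂ × ℂ) →L[ℝ] (ℂ × ℂ) := fun x =>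
    (((I * κ x) • fst) - (conj (P x)) • snd).prod (P x • fst - (I * κ x) • snd)
  have hA : Continuous A := by
    have e : A = fun x => (ContinuousLinearMap.inl ℝ ℂ ℂ).comp
        (((I * κ x) • fst) - (conj (P x)) • snd) + (ContinuousLinearMap.inr ℝ ℂ ℂ).comp
        (P x • fst - (I * κ x) • snd) := by
      ext x v <;> simp [A]
    rw [e]
    have hcP : Continuous fun x => conj (P x) := continuous_conj.comp h2
    fun_prop
  obtain ⟨v, hv, hl⟩ := exists_hasDerivAt_tendsto_atTop hA (m := fun x => |κ x| + ‖P x‖)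
    (by fun_prop) (h.int_left.abs.add h.int_right.norm) (fun x => by
      refine ContinuousLinearMap.opNorm_le_bound _ (by positivity) fun v => ?_
      have e1 := norm_fst_le v
      have e2 := norm_snd_le v
      have p1 := abs_nonneg (κ x)
      have p2 := norm_nonneg (P x)
      change max ‖I * κ x * v.1 - conj (P x) * v.2‖ ‖P x * v.1 - I * κ x * v.2‖ ≤ _
      refine max_le ?_ ?_ <;> refine (norm_sub_le _ _).trans ?_ <;>
        simp only [norm_mul, norm_I, RCLike.norm_conj, norm_real, Real.norm_eq_abs, one_mul] <;>
        nlinarith) ((1 : ℂ), (0 : ℂ))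
  refine ⟨fun x => (v x).1, fun x => (v x).2, fun x => ?_, fun x => ?_, ?_, ?_⟩
  · exact ((ContinuousLinearMap.fst ℝ ℂ ℂ).hasFDerivAt.comp_hasDerivAt x (hv x))
  · exact ((ContinuousLinearMap.snd ℝ ℂ ℂ).hasFDerivAt.comp_hasDerivAt x (hv x))
  · exact (continuous_fst.tendsto _).comp hl
  · exact (continuous_snd.tendsto _).comp hl

theorem hasDerivAt_conj {u : ℝ → ℂ} {u' : ℂ} {x : ℝ} (h : HasDerivAt u u' x) :
    HasDerivAt (fun x => conj (u x)) (conj u') x :=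
  (conjCLE : ℂ →L[ℝ] ℂ).hasFDerivAt.comp_hasDerivAt x h

namespace JostPair

variable {κ κ₁ κ₂ : ℝ → ℝ} {P P₁ P₂ : ℝ → ℂ} {α β α₁ β₁ α₂ β₂ : ℝ → ℂ}

theorem continuous_left (h : JostPair κ P α β) : Continuous α :=
  continuous_iff_continuousAt.2 fun x => (h.deriv_left x).continuousAt

theorem continuous_right (h : JostPair κ P α β) : Continuous β :=
  continuous_iff_continuousAt.2 fun x => (h.deriv_right x).continuousAt

/-- Derivative of the first entry of `Φ₁* Φ₂`. -/
theorem hasDerivAt_cross_left (h₁ : JostPair κ₁ P₁ α₁ β₁) (h₂ : JostPair κ₂ P₂ α₂ β₂) (x : ℝ) :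
    HasDerivAt (fun x => conj (α₁ x) * α₂ x + conj (β₁ x) * β₂ x)
      (I * ((κ₂ x - κ₁ x : ℝ) : ℂ) * (conj (α₁ x) * α₂ x - conj (β₁ x) * β₂ x)
        + (P₂ x - P₁ x) * (conj (β₁ x) * α₂ x) - conj (P₂ x - P₁ x) * (conj (α₁ x) * β₂ x)) x := by
  have := ((hasDerivAt_conj (h₁.deriv_left x)).mul (h₂.deriv_left x)).add
    ((hasDerivAt_conj (h₁.deriv_right x)).mul (h₂.deriv_right x))
  convert! this using 1
  simp only [map_sub, map_mul, conj_I, conj_ofReal, conj_conj, ofReal_sub]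
  ring

/-- Derivative of the second entry of the first column of `Φ₁* Φ₂`. -/
theorem hasDerivAt_cross_right (h₁ : JostPair κ₁ P₁ α₁ β₁) (h₂ : JostPair κ₂ P₂ α₂ β₂) (x : ℝ) :
    HasDerivAt (fun x => α₁ x * β₂ x - β₁ x * α₂ x)
      (-(I * ((κ₂ x - κ₁ x : ℝ) : ℂ) * (α₁ x * β₂ x + β₁ x * α₂ x))
        + (P₂ x - P₁ x) * (α₁ x * α₂ x) + conj (P₂ x - P₁ x) * (β₁ x * β₂ x)) x := by
  have := ((h₁.deriv_left x).mul (h₂.deriv_right x)).sub ((h₁.deriv_right x).mul (h₂.deriv_left x))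
  convert! this using 1
  simp only [map_sub, ofReal_sub]
  ring

theorem tendsto_cross_left (h₁ : JostPair κ₁ P₁ α₁ β₁) (h₂ : JostPair κ₂ P₂ α₂ β₂) :
    Tendsto (fun x => conj (α₁ x) * α₂ x + conj (β₁ x) * β₂ x) atTop (𝓝 1) := by
  have hc := continuous_conj
  simpa using (((hc.tendsto _).comp h₁.lim_left).mul h₂.lim_left).add
    (((hc.tendsto _).comp h₁.lim_right).mul h₂.lim_right)

theorem tendsto_cross_right (h₁ : JostPair κ₁ P₁ α₁ β₁) (h₂ : JostPair κ₂ P₂ α₂ β₂) :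
    Tendsto (fun x => α₁ x * β₂ x - β₁ x * α₂ x) atTop (𝓝 0) := by
  simpa using (h₁.lim_left.mul h₂.lim_right).sub (h₁.lim_right.mul h₂.lim_left)

/-- The system is `su(2)`-valued, so its solution is unitary. -/
theorem conj_mul_add (h : JostPair κ P α β) (x : ℝ) :
    conj (α x) * α x + conj (β x) * β x = 1 := by
  have hd : ∀ x, HasDerivAt (fun x => conj (α x) * α x + conj (β x) * β x) 0 x := fun x => by
    simpa using h.hasDerivAt_cross_left h x
  have hc := is_const_of_deriv_eq_zero (fun x => (hd x).differentiableAt) fun x => (hd x).deriv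
  exact tendsto_nhds_unique (tendsto_const_nhds.congr fun y => hc x y) (h.tendsto_cross_left h)

theorem normSq_add (h : JostPair κ P α β) (x : ℝ) : ‖α x‖ ^ 2 + ‖β x‖ ^ 2 = 1 := by
  have := h.conj_mul_add x
  rw [conj_mul', conj_mul'] at this
  exact_mod_cast this

theorem norm_left_le (h : JostPair κ P α β) (x : ℝ) : ‖α x‖ ≤ 1 := by
  nlinarith [h.normSq_add x, norm_nonneg (α x), sq_nonneg ‖β x‖]

theorem norm_right_le (h : JostPair κ P α β) (x : ℝ) : ‖β x‖ ≤ 1 := by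
  nlinarith [h.normSq_add x, norm_nonneg (β x), sq_nonneg ‖α x‖]

/-- `Φ₂ = Φ₁ (Φ₁* Φ₂)`, first entry. -/
theorem left_eq (h₁ : JostPair κ₁ P₁ α₁ β₁) (x : ℝ) (a b : ℂ) :
    a = α₁ x * (conj (α₁ x) * a + conj (β₁ x) * b) - conj (β₁ x) * (α₁ x * b - β₁ x * a) := by
  linear_combination (-a) * h₁.conj_mul_add x

/-- `Φ₂ = Φ₁ (Φ₁* Φ₂)`, second entry. -/
theorem right_eq (h₁ : JostPair κ₁ P₁ α₁ β₁) (x : ℝ) (a b : ℂ) :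
    b = β₁ x * (conj (α₁ x) * a + conj (β₁ x) * b) + conj (α₁ x) * (α₁ x * b - β₁ x * a) := by
  linear_combination (-b) * h₁.conj_mul_add x

theorem norm_deriv_cross_left_le (h₁ : JostPair κ₁ P₁ α₁ β₁) (h₂ : JostPair κ₂ P₂ α₂ β₂) (x : ℝ) :
    ‖I * ((κ₂ x - κ₁ x : ℝ) : ℂ) * (conj (α₁ x) * α₂ x - conj (β₁ x) * β₂ x)
        + (P₂ x - P₁ x) * (conj (β₁ x) * α₂ x) - conj (P₂ x - P₁ x) * (conj (α₁ x) * β₂ x)‖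
      ≤ 2 * (|κ₂ x - κ₁ x| + ‖P₂ x - P₁ x‖) := by
  have b1 := h₁.norm_left_le x
  have b2 := h₁.norm_right_le x
  have b3 := h₂.norm_left_le x
  have b4 := h₂.norm_right_le x
  have e1 : ‖conj (α₁ x) * α₂ x - conj (β₁ x) * β₂ x‖ ≤ 2 := by
    refine (norm_sub_le _ _).trans ?_
    simp only [norm_mul, RCLike.norm_conj]
    nlinarith [norm_nonneg (α₁ x), norm_nonneg (α₂ x), norm_nonneg (β₁ x), norm_nonneg (β₂ x)]
  have e2 : ‖conj (β₁ x) * α₂ x‖ ≤ 1 := by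
    simp only [norm_mul, RCLike.norm_conj]
    nlinarith [norm_nonneg (α₁ x), norm_nonneg (α₂ x), norm_nonneg (β₁ x), norm_nonneg (β₂ x)]
  have e3 : ‖conj (α₁ x) * β₂ x‖ ≤ 1 := by
    simp only [norm_mul, RCLike.norm_conj]
    nlinarith [norm_nonneg (α₁ x), norm_nonneg (α₂ x), norm_nonneg (β₁ x), norm_nonneg (β₂ x)]
  refine (norm_sub_le _ _).trans ((add_le_add_left (norm_add_le _ _) _).trans ?_)
  rw [norm_mul, norm_mul (P₂ x - P₁ x), norm_mul (conj (P₂ x - P₁ x)), norm_mul I, norm_I,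
    norm_real, Real.norm_eq_abs, RCLike.norm_conj, one_mul]
  nlinarith [mul_le_mul_of_nonneg_left e1 (abs_nonneg (κ₂ x - κ₁ x)),
    mul_le_mul_of_nonneg_left e2 (norm_nonneg (P₂ x - P₁ x)),
    mul_le_mul_of_nonneg_left e3 (norm_nonneg (P₂ x - P₁ x))]

theorem norm_deriv_cross_right_le (h₁ : JostPair κ₁ P₁ α₁ β₁) (h₂ : JostPair κ₂ P₂ α₂ β₂)
    (x : ℝ) :
    ‖-(I * ((κ₂ x - κ₁ x : ℝ) : ℂ) * (α₁ x * β₂ x + β₁ x * α₂ x))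
        + (P₂ x - P₁ x) * (α₁ x * α₂ x) + conj (P₂ x - P₁ x) * (β₁ x * β₂ x)‖
      ≤ 2 * (|κ₂ x - κ₁ x| + ‖P₂ x - P₁ x‖) := by
  have b1 := h₁.norm_left_le x
  have b2 := h₁.norm_right_le x
  have b3 := h₂.norm_left_le x
  have b4 := h₂.norm_right_le x
  have e1 : ‖α₁ x * β₂ x + β₁ x * α₂ x‖ ≤ 2 := by
    refine (norm_add_le _ _).trans ?_
    simp only [norm_mul]
    nlinarith [norm_nonneg (α₁ x), norm_nonneg (α₂ x), norm_nonneg (β₁ x), norm_nonneg (β₂ x)]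
  have e2 : ‖α₁ x * α₂ x‖ ≤ 1 := by
    simp only [norm_mul]
    nlinarith [norm_nonneg (α₁ x), norm_nonneg (α₂ x), norm_nonneg (β₁ x), norm_nonneg (β₂ x)]
  have e3 : ‖β₁ x * β₂ x‖ ≤ 1 := by
    simp only [norm_mul]
    nlinarith [norm_nonneg (α₁ x), norm_nonneg (α₂ x), norm_nonneg (β₁ x), norm_nonneg (β₂ x)]
  refine (norm_add_le _ _).trans ((add_le_add_left (norm_add_le _ _) _).trans ?_)
  rw [norm_neg, norm_mul, norm_mul (P₂ x - P₁ x), norm_mul (conj (P₂ x - P₁ x)), norm_mul I, norm_I,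
    norm_real, Real.norm_eq_abs, RCLike.norm_conj, one_mul]
  nlinarith [mul_le_mul_of_nonneg_left e1 (abs_nonneg (κ₂ x - κ₁ x)),
    mul_le_mul_of_nonneg_left e2 (norm_nonneg (P₂ x - P₁ x)),
    mul_le_mul_of_nonneg_left e3 (norm_nonneg (P₂ x - P₁ x))]

/-- Fundamental theorem of calculus from `x` to `+∞` with an integrable bound on the derivative. -/
theorem norm_sub_le_of_hasDerivAt {u u' : ℝ → ℂ} {l : ℂ} {m : ℝ → ℝ}
    (hu : ∀ x, HasDerivAt u (u' x) x) (hu' : Continuous u') (hl : Tendsto u atTop (𝓝 l))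
    (hm : Integrable m) (hb : ∀ x, ‖u' x‖ ≤ m x) (x : ℝ) : ‖u x - l‖ ≤ ∫ y, m y := by
  have hi : Integrable u' := hm.mono' hu'.aestronglyMeasurable (Eventually.of_forall hb)
  have := integral_Ioi_of_hasDerivAt_of_tendsto' (fun y _ => hu y) (hi.integrableOn (s := Ioi x)) hl
  rw [norm_sub_rev, ← this]
  refine (norm_integral_le_integral_norm _).trans ?_
  exact (setIntegral_le_integral hi.norm (Eventually.of_forall fun y => norm_nonneg _)).trans
    (integral_mono hi.norm hm hb)

/-- Lipschitz dependence of the solution on the coefficients in the `L¹` norm. -/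
theorem norm_sub_le (c₁ : Admissible κ₁ P₁) (c₂ : Admissible κ₂ P₂)
    (h₁ : JostPair κ₁ P₁ α₁ β₁) (h₂ : JostPair κ₂ P₂ α₂ β₂) (x : ℝ) :
    ‖α₂ x - α₁ x‖ ≤ 4 * ∫ y, (|κ₂ y - κ₁ y| + ‖P₂ y - P₁ y‖) ∧
    ‖β₂ x - β₁ x‖ ≤ 4 * ∫ y, (|κ₂ y - κ₁ y| + ‖P₂ y - P₁ y‖) := by
  have k1 := c₁.cont_left
  have k2 := c₂.cont_left
  have p1 := c₁.cont_right
  have p2 := c₂.cont_right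
  have a1 := h₁.continuous_left
  have a2 := h₂.continuous_left
  have b1 := h₁.continuous_right
  have b2 := h₂.continuous_right
  have ca : Continuous fun x => conj (α₁ x) := continuous_conj.comp a1
  have cb : Continuous fun x => conj (β₁ x) := continuous_conj.comp b1
  have cp : Continuous fun x => conj (P₂ x - P₁ x) := continuous_conj.comp (p2.sub p1)
  have hm : Integrable fun y => 2 * (|κ₂ y - κ₁ y| + ‖P₂ y - P₁ y‖) :=
    ((c₂.int_left.sub c₁.int_left).abs.add (c₂.int_right.sub c₁.int_right).norm).const_mul 2
  have hu := norm_sub_le_of_hasDerivAt (h₁.hasDerivAt_cross_left h₂) (by fun_prop)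
    (h₁.tendsto_cross_left h₂) hm (h₁.norm_deriv_cross_left_le h₂) x
  have hw := norm_sub_le_of_hasDerivAt (h₁.hasDerivAt_cross_right h₂) (by fun_prop)
    (h₁.tendsto_cross_right h₂) hm (h₁.norm_deriv_cross_right_le h₂) x
  rw [integral_const_mul] at hu hw
  rw [sub_zero] at hw
  set u := conj (α₁ x) * α₂ x + conj (β₁ x) * β₂ x
  set w := α₁ x * β₂ x - β₁ x * α₂ x
  have n1 := h₁.norm_left_le x
  have n2 := h₁.norm_right_le x
  constructor
  · have : α₂ x - α₁ x = α₁ x * (u - 1) - conj (β₁ x) * w := by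
      linear_combination h₁.left_eq x (α₂ x) (β₂ x)
    rw [this]
    refine (_root_.norm_sub_le _ _).trans ?_
    rw [norm_mul, norm_mul, RCLike.norm_conj]
    nlinarith [norm_nonneg (u - 1), norm_nonneg w]
  · have : β₂ x - β₁ x = β₁ x * (u - 1) + conj (α₁ x) * w := by
      linear_combination h₁.right_eq x (α₂ x) (β₂ x)
    rw [this]
    refine (norm_add_le _ _).trans ?_
    rw [norm_mul, norm_mul, RCLike.norm_conj]
    nlinarith [norm_nonneg (u - 1), norm_nonneg w]

theorem norm_deriv_left_le (h : JostPair κ P α β) (x : ℝ) :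
    ‖I * κ x * α x - conj (P x) * β x‖ ≤ |κ x| + ‖P x‖ := by
  refine (_root_.norm_sub_le _ _).trans ?_
  simp only [norm_mul, norm_I, RCLike.norm_conj, norm_real, Real.norm_eq_abs, one_mul]
  nlinarith [h.norm_left_le x, h.norm_right_le x, abs_nonneg (κ x), norm_nonneg (P x)]

theorem norm_deriv_right_le (h : JostPair κ P α β) (x : ℝ) :
    ‖P x * α x - I * κ x * β x‖ ≤ |κ x| + ‖P x‖ := by
  refine (_root_.norm_sub_le _ _).trans ?_
  simp only [norm_mul, norm_I, norm_real, Real.norm_eq_abs, one_mul]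
  nlinarith [h.norm_left_le x, h.norm_right_le x, abs_nonneg (κ x), norm_nonneg (P x)]

theorem exists_tendsto_atBot (c : Admissible κ P) (h : JostPair κ P α β) :
    ∃ a b, Tendsto α atBot (𝓝 a) ∧ Tendsto β atBot (𝓝 b) := by
  have k1 := c.cont_left
  have p1 := c.cont_right
  have a1 := h.continuous_left
  have b1 := h.continuous_right
  have cp : Continuous fun x => conj (P x) := continuous_conj.comp p1
  have hm : Integrable fun x => |κ x| + ‖P x‖ := c.int_left.abs.add c.int_right.norm
  refine ⟨_, _, tendsto_limUnder_of_hasDerivAt_of_integrableOn_Iic (a := 0)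
      (fun x _ => h.deriv_left x) (Integrable.integrableOn ?_),
    tendsto_limUnder_of_hasDerivAt_of_integrableOn_Iic (a := 0)
      (fun x _ => h.deriv_right x) (Integrable.integrableOn ?_)⟩
  · exact hm.mono' (by fun_prop) (Eventually.of_forall h.norm_deriv_left_le)
  · exact hm.mono' (by fun_prop) (Eventually.of_forall h.norm_deriv_right_le)

end JostPair

/-- `a` and `b` are the limits at `-∞` of the solution normalized at `+∞`: the first column of the
scattering matrix of the system. -/
def HasScattering (κ : ℝ → ℝ) (P : ℝ → ℂ) (a b : ℂ) : Prop :=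
  ∃ α β, JostPair κ P α β ∧ Tendsto α atBot (𝓝 a) ∧ Tendsto β atBot (𝓝 b)

/-- Lipschitz dependence of the scattering data on the coefficients in the `L¹` norm. -/
theorem HasScattering.norm_sub_le {κ₁ κ₂ : ℝ → ℝ} {P₁ P₂ : ℝ → ℂ} {a₁ b₁ a₂ b₂ : ℂ}
    (c₁ : Admissible κ₁ P₁) (c₂ : Admissible κ₂ P₂)
    (h₁ : HasScattering κ₁ P₁ a₁ b₁) (h₂ : HasScattering κ₂ P₂ a₂ b₂) :
    ‖a₂ - a₁‖ ≤ 4 * ∫ y, (|κ₂ y - κ₁ y| + ‖P₂ y - P₁ y‖) ∧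
    ‖b₂ - b₁‖ ≤ 4 * ∫ y, (|κ₂ y - κ₁ y| + ‖P₂ y - P₁ y‖) := by
  obtain ⟨α₁, β₁, h₁, ha₁, hb₁⟩ := h₁
  obtain ⟨α₂, β₂, h₂, ha₂, hb₂⟩ := h₂
  exact ⟨le_of_tendsto (ha₂.sub ha₁).norm
      (Eventually.of_forall fun x => (JostPair.norm_sub_le c₁ c₂ h₁ h₂ x).1),
    le_of_tendsto (hb₂.sub hb₁).norm
      (Eventually.of_forall fun x => (JostPair.norm_sub_le c₁ c₂ h₁ h₂ x).2)⟩

theorem HasScattering.unique {κ : ℝ → ℝ} {P : ℝ → ℂ} {a₁ b₁ a₂ b₂ : ℂ} (c : Admissible κ P)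
    (h₁ : HasScattering κ P a₁ b₁) (h₂ : HasScattering κ P a₂ b₂) : a₁ = a₂ ∧ b₁ = b₂ := by
  have h := h₁.norm_sub_le c c h₂
  simp only [sub_self, abs_zero, norm_zero, add_zero, integral_zero, mul_zero] at h
  exact ⟨(sub_eq_zero.1 (norm_le_zero_iff.1 h.1)).symm, (sub_eq_zero.1 (norm_le_zero_iff.1 h.2)).symm⟩

theorem HasScattering.conj_mul_add {κ : ℝ → ℝ} {P : ℝ → ℂ} {a b : ℂ} (h : HasScattering κ P a b) :
    conj a * a + conj b * b = 1 := by
  obtain ⟨α, β, h, ha, hb⟩ := h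
  have hc := continuous_conj
  have := (((hc.tendsto _).comp ha).mul ha).add (((hc.tendsto _).comp hb).mul hb)
  exact tendsto_nhds_unique this (tendsto_const_nhds.congr fun x => (h.conj_mul_add x).symm)

theorem HasScattering.normSq_add {κ : ℝ → ℝ} {P : ℝ → ℂ} {a b : ℂ} (h : HasScattering κ P a b) :
    ‖a‖ ^ 2 + ‖b‖ ^ 2 = 1 := by
  have := h.conj_mul_add
  rw [conj_mul', conj_mul'] at this
  exact_mod_cast this

/-! ### Plancherel's inequality -/

/-- On `L¹ ∩ L²` the Fourier integral agrees with the Fourier transform of `L²`, because both pair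
in the same way with test functions. -/
theorem fourier_ae_eq_fourier_toLp {h : ℝ → ℂ} (h1 : Integrable h) (h2 : MemLp h 2) :
    (𝓕 h : ℝ → ℂ) =ᵐ[volume] (𝓕 (h2.toLp h) : Lp ℂ 2 (volume : Measure ℝ)) := by
  have hc : Continuous (𝓕 h : ℝ → ℂ) :=
    VectorFourier.fourierIntegral_continuous Real.continuous_fourierChar
      (by exact continuous_inner) h1
  refine ae_eq_of_integral_contDiff_smul_eq hc.locallyIntegrable
    ((Lp.memLp _).locallyIntegrable (by norm_num)) fun φ hφ hφc => ?_
  have g1 : HasCompactSupport (ofRealCLM ∘ φ) := hφc.comp_left rfl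
  have g2 : ContDiff ℝ ∞ (ofRealCLM ∘ φ) := by fun_prop
  let ψ : 𝓢(ℝ, ℂ) := g1.toSchwartzMap g2
  have e1 : ∫ x, φ x • (𝓕 (h2.toLp h) : Lp ℂ 2 (volume : Measure ℝ)) x
      = ∫ x, (𝓕 ψ) x • h x := by
    have := Lp.fourier_toTemperedDistribution_eq (h2.toLp h)
    have h3 := congrArg (fun T => T ψ) this
    simp only [TemperedDistribution.fourier_apply, Lp.toTemperedDistribution_apply] at h3
    have h4 : ∫ x, φ x • (𝓕 (h2.toLp h) : Lp ℂ 2 (volume : Measure ℝ)) x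
      = ∫ x, ψ x • (𝓕 (h2.toLp h) : Lp ℂ 2 (volume : Measure ℝ)) x := by
      congr 1
    rw [h4, ← h3]
    refine integral_congr_ae ?_
    filter_upwards [h2.coeFn_toLp] with x hx
    rw [hx]
  have e2 : ∫ x, φ x • (𝓕 h : ℝ → ℂ) x = ∫ x, (𝓕 ψ) x • h x := by
    have := VectorFourier.integral_fourierIntegral_smul_eq_flip (L := innerₗ ℝ) (μ := volume)
      (ν := volume) (f := h) (g := ψ) Real.continuous_fourierChar (by exact continuous_inner) h1
      ψ.integrable
    simp only [flip_innerₗ] at this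
    calc ∫ x, φ x • (𝓕 h : ℝ → ℂ) x = ∫ x, (𝓕 h : ℝ → ℂ) x • ψ x := by
          refine integral_congr_ae (Eventually.of_forall fun x => ?_)
          show (φ x : ℝ) • (𝓕 h : ℝ → ℂ) x = (𝓕 h : ℝ → ℂ) x • ((φ x : ℝ) : ℂ)
          rw [real_smul, smul_eq_mul, mul_comm]
      _ = ∫ x, h x • (𝓕 ψ) x := by
          rw [SchwartzMap.fourier_coe]
          exact this
      _ = _ := by simp only [smul_eq_mul, mul_comm]
  rw [e1, e2]

/-- Plancherel for the unnormalized Fourier integral. -/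
theorem lintegral_sq_fourier_le {h : ℝ → ℂ} (h1 : Integrable h) (h2 : MemLp h 2) :
    ∫⁻ l : ℝ, ‖∫ y, h y * exp (-(I * l * y))‖ₑ ^ 2
      ≤ ENNReal.ofReal (2 * Real.pi) * ∫⁻ y, ‖h y‖ₑ ^ 2 := by
  have e1 : ∀ l : ℝ, ∫ y, h y * exp (-(I * l * y)) = (𝓕 h : ℝ → ℂ) ((2 * Real.pi)⁻¹ * l) := by
    intro l
    rw [Real.fourier_real_eq_integral_exp_smul]
    congr 1
    ext y
    rw [smul_eq_mul, mul_comm]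
    congr 2
    push_cast
    have : (Real.pi : ℂ) ≠ 0 := by exact_mod_cast Real.pi_ne_zero
    field_simp
  have e2 : ∫⁻ l : ℝ, ‖(𝓕 h : ℝ → ℂ) l‖ₑ ^ 2 = ∫⁻ y, ‖h y‖ₑ ^ 2 := by
    have k1 : eLpNorm (𝓕 h : ℝ → ℂ) 2 = eLpNorm h 2 := by
      rw [eLpNorm_congr_ae (fourier_ae_eq_fourier_toLp h1 h2), ← Lp.enorm_def,
        ← eLpNorm_congr_ae h2.coeFn_toLp, ← Lp.enorm_def]
      have := Lp.norm_fourier_eq (h2.toLp h)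
      rw [enorm_eq_nnnorm, enorm_eq_nnnorm]
      congr 1
      exact NNReal.eq this
    have k2 : ∀ g : ℝ → ℂ, ∫⁻ l : ℝ, ‖g l‖ₑ ^ 2 = eLpNorm g 2 ^ 2 := by
      intro g
      have := eLpNorm_nnreal_pow_eq_lintegral (f := g) (μ := volume) (p := 2) (by norm_num)
      simpa using this.symm
    rw [k2, k2, k1]
  simp_rw [e1]
  have hc : Continuous (𝓕 h : ℝ → ℂ) :=
    VectorFourier.fourierIntegral_continuous Real.continuous_fourierChar
      (by exact continuous_inner) h1
  have hpi : (2 * Real.pi)⁻¹ ≠ 0 := by positivity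
  rw [← lintegral_map (f := fun l => ‖(𝓕 h : ℝ → ℂ) l‖ₑ ^ 2) (by fun_prop)
      (measurable_const_mul ((2 * Real.pi)⁻¹)), Real.map_volume_mul_left hpi, lintegral_smul_measure,
    e2, inv_inv, abs_of_pos (by positivity), smul_eq_mul]

/-! ### Families of functions of the spectral parameter bounded in `L²(0, ∞)` -/

/-- A family of measurable functions of `λ` that is bounded in `L²(0, ∞)`. -/
def UL2 {ι : Type*} (F : ι → ℝ → ℂ) : Prop :=
  (∀ i, Measurable (F i)) ∧ ∃ K : ℝ≥0, ∀ i, ∫⁻ l in Ioi (0 : ℝ), ‖F i l‖ₑ ^ 2 ≤ K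

/-- A family of measurable functions of `λ` that is uniformly bounded on `(0, ∞)`. -/
def UBdd {ι : Type*} (F : ι → ℝ → ℂ) : Prop :=
  (∀ i, Measurable (F i)) ∧ ∃ K : ℝ≥0, ∀ i, ∀ l, 0 < l → ‖F i l‖ ≤ K

section

variable {ι : Type*} {F G : ι → ℝ → ℂ}

theorem UL2.mono (hF : UL2 F) (hG : ∀ i, Measurable (G i)) (c : ℝ≥0)
    (h : ∀ i, ∀ l, 0 < l → ‖G i l‖ ≤ c * ‖F i l‖) : UL2 G := by
  obtain ⟨m, K, hK⟩ := hF
  refine ⟨hG, c ^ 2 * K, fun i => ?_⟩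
  calc ∫⁻ l in Ioi (0 : ℝ), ‖G i l‖ₑ ^ 2 ≤ ∫⁻ l in Ioi (0 : ℝ), (c : ℝ≥0∞) ^ 2 * ‖F i l‖ₑ ^ 2 := by
        refine setLIntegral_mono' measurableSet_Ioi fun l hl => ?_
        rw [← mul_pow]
        gcongr
        have : ‖G i l‖₊ ≤ c * ‖F i l‖₊ := h i l hl
        rw [enorm_eq_nnnorm, enorm_eq_nnnorm]
        exact_mod_cast this
    _ = (c : ℝ≥0∞) ^ 2 * ∫⁻ l in Ioi (0 : ℝ), ‖F i l‖ₑ ^ 2 := by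
        rw [lintegral_const_mul' _ _ (by simp)]
    _ ≤ _ := by
        push_cast
        gcongr
        exact hK i

theorem UL2.add (hF : UL2 F) (hG : UL2 G) : UL2 fun i l => F i l + G i l := by
  obtain ⟨m, K, hK⟩ := hF
  obtain ⟨n, L, hL⟩ := hG
  refine ⟨fun i => (m i).add (n i), 2 * (K + L), fun i => ?_⟩
  calc ∫⁻ l in Ioi (0 : ℝ), ‖F i l + G i l‖ₑ ^ 2
      ≤ ∫⁻ l in Ioi (0 : ℝ), 2 * (‖F i l‖ₑ ^ 2 + ‖G i l‖ₑ ^ 2) := by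
        refine lintegral_mono fun l => ?_
        have h1 : ‖F i l + G i l‖₊ ^ 2 ≤ 2 * (‖F i l‖₊ ^ 2 + ‖G i l‖₊ ^ 2) := by
          rw [← NNReal.coe_le_coe]
          push_cast
          have := norm_add_le (F i l) (G i l)
          nlinarith [norm_nonneg (F i l + G i l), sq_nonneg (‖F i l‖ - ‖G i l‖)]
        simp only [enorm_eq_nnnorm]
        exact_mod_cast h1
    _ = 2 * ((∫⁻ l in Ioi (0 : ℝ), ‖F i l‖ₑ ^ 2) + ∫⁻ l in Ioi (0 : ℝ), ‖G i l‖ₑ ^ 2) := by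
        rw [lintegral_const_mul' _ _ (by simp), lintegral_add_left ((m i).enorm.pow_const 2)]
    _ ≤ _ := by
        push_cast
        gcongr
        · exact hK i
        · exact hL i

theorem UBdd.mul_UL2 (hF : UBdd F) (hG : UL2 G) : UL2 fun i l => F i l * G i l := by
  obtain ⟨m, K, hK⟩ := hF
  refine hG.mono (fun i => (m i).mul (hG.1 i)) K fun i l hl => ?_
  rw [norm_mul]
  exact mul_le_mul_of_nonneg_right (hK i l hl) (norm_nonneg _)

theorem UL2.conj (hF : UL2 F) : UL2 fun i l => conj (F i l) :=
  hF.mono (fun i => continuous_conj.measurable.comp (hF.1 i)) 1 fun i l _ => by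
    simp

theorem UL2.const_mul (hF : UL2 F) (c : ℂ) : UL2 fun i l => c * F i l :=
  hF.mono (fun i => (hF.1 i).const_mul c) ‖c‖₊ fun i l _ => by simp

theorem UL2.neg (hF : UL2 F) : UL2 fun i l => -F i l := by
  simpa using hF.const_mul (-1)

theorem UL2.sub (hF : UL2 F) (hG : UL2 G) : UL2 fun i l => F i l - G i l := by
  simpa [sub_eq_add_neg] using hF.add hG.neg

theorem UL2.comp {κ : Type*} (hF : UL2 F) (e : κ → ι) : UL2 fun i => F (e i) :=
  ⟨fun _ => hF.1 _, hF.2.imp fun _ h _ => h _⟩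

theorem UBdd.mul (hF : UBdd F) (hG : UBdd G) : UBdd fun i l => F i l * G i l := by
  obtain ⟨m, K, hK⟩ := hF
  obtain ⟨n, L, hL⟩ := hG
  refine ⟨fun i => (m i).mul (n i), K * L, fun i l hl => ?_⟩
  rw [norm_mul]
  push_cast
  gcongr
  · exact hK i l hl
  · exact hL i l hl

theorem UBdd.add (hF : UBdd F) (hG : UBdd G) : UBdd fun i l => F i l + G i l := by
  obtain ⟨m, K, hK⟩ := hF
  obtain ⟨n, L, hL⟩ := hG
  refine ⟨fun i => (m i).add (n i), K + L, fun i l hl => ?_⟩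
  push_cast
  exact (norm_add_le _ _).trans (add_le_add (hK i l hl) (hL i l hl))

theorem UBdd.conj (hF : UBdd F) : UBdd fun i l => conj (F i l) :=
  ⟨fun i => continuous_conj.measurable.comp (hF.1 i), hF.2.imp fun _ h i l hl => by
    simpa using h i l hl⟩

theorem UBdd.neg (hF : UBdd F) : UBdd fun i l => -F i l :=
  ⟨fun i => (hF.1 i).neg, hF.2.imp fun _ h i l hl => by simpa using h i l hl⟩

end

/-- Minkowski's integral inequality for `L²` in the form used here: an average, with weight `w`, of
functions with bounded `L²` norm. -/
theorem lintegral_sq_lintegral_mul_le {μ ν : Measure ℝ} [SFinite μ] [SFinite ν] {w : ℝ → ℝ≥0∞}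
    (hw : Measurable w) {T : ℝ → ℝ → ℝ≥0∞} (hT : Measurable (Function.uncurry T)) {K : ℝ≥0∞}
    (hK : ∀ x, ∫⁻ l, T l x ^ 2 ∂ν ≤ K) :
    ∫⁻ l, (∫⁻ x, w x * T l x ∂μ) ^ 2 ∂ν ≤ (∫⁻ x, w x ∂μ) ^ 2 * K := by
  have hTl : ∀ l, Measurable (T l) := fun l => hT.comp measurable_prodMk_left
  have h1 : ∀ l, (∫⁻ x, w x * T l x ∂μ) ^ 2 ≤ (∫⁻ x, w x ∂μ) * ∫⁻ x, w x * T l x ^ 2 ∂μ := by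
    intro l
    have := ENNReal.lintegral_mul_norm_pow_le (μ := μ) (f := w) (g := fun x => w x * T l x ^ 2)
      hw.aemeasurable (hw.mul ((hTl l).pow_const 2)).aemeasurable
      (p := 1 / 2) (q := 1 / 2) (by norm_num) (by norm_num) (by norm_num)
    have e : ∀ x, w x ^ (1 / 2 : ℝ) * (w x * T l x ^ 2) ^ (1 / 2 : ℝ) = w x * T l x := by
      intro x
      rw [← ENNReal.mul_rpow_of_nonneg _ _ (by norm_num), ← mul_assoc, ← sq, ← mul_pow,
        ← ENNReal.rpow_natCast, ← ENNReal.rpow_mul]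
      norm_num
    simp_rw [e] at this
    calc (∫⁻ x, w x * T l x ∂μ) ^ 2
        ≤ ((∫⁻ x, w x ∂μ) ^ (1 / 2 : ℝ) * (∫⁻ x, w x * T l x ^ 2 ∂μ) ^ (1 / 2 : ℝ)) ^ 2 := by gcongr
      _ = _ := by
        rw [← ENNReal.mul_rpow_of_nonneg _ _ (by norm_num), ← ENNReal.rpow_natCast,
          ← ENNReal.rpow_mul]
        norm_num
  calc ∫⁻ l, (∫⁻ x, w x * T l x ∂μ) ^ 2 ∂ν
      ≤ ∫⁻ l, (∫⁻ x, w x ∂μ) * ∫⁻ x, w x * T l x ^ 2 ∂μ ∂ν := lintegral_mono h1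
    _ = (∫⁻ x, w x ∂μ) * ∫⁻ l, ∫⁻ x, w x * T l x ^ 2 ∂μ ∂ν := by
        rw [lintegral_const_mul]
        exact Measurable.lintegral_prod_right' (f := fun p : ℝ × ℝ => w p.2 * T p.1 p.2 ^ 2)
          ((hw.comp measurable_snd).mul (hT.pow_const 2))
    _ = (∫⁻ x, w x ∂μ) * ∫⁻ x, w x * ∫⁻ l, T l x ^ 2 ∂ν ∂μ := by
        rw [lintegral_lintegral_swap]
        · congr 1
          refine lintegral_congr fun x => ?_
          rw [lintegral_const_mul]
          exact (hT.comp measurable_prodMk_right).pow_const 2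
        · exact ((hw.comp measurable_snd).mul (hT.pow_const 2)).aemeasurable
    _ ≤ (∫⁻ x, w x ∂μ) * ∫⁻ x, w x * K ∂μ := by gcongr with x; exact hK x
    _ = _ := by rw [lintegral_mul_const _ hw]; ring

/-- An average, with weights bounded in `L¹`, of functions of `λ` bounded in `L²(0, ∞)`. -/
theorem UL2.average {ι : Type*} {a b : ι → ℝ} {w : ι → ℝ → ℂ} (hw : ∀ i, Measurable (w i))
    {M : ℝ≥0} (hM : ∀ i, ∫⁻ x, ‖w i x‖ₑ ≤ M) {T : ι → ℝ → ℝ → ℂ}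
    (hT : ∀ i, Measurable (Function.uncurry (T i))) {K : ℝ≥0}
    (hK : ∀ i x, ∫⁻ l in Ioi (0 : ℝ), ‖T i l x‖ₑ ^ 2 ≤ K) :
    UL2 fun i l => ∫ x in Ioc (a i) (b i), w i x * T i l x := by
  refine ⟨fun i => ?_, M ^ 2 * K, fun i => ?_⟩
  · have : StronglyMeasurable (Function.uncurry fun l x => w i x * T i l x) :=
      (((hw i).comp measurable_snd).mul (hT i)).stronglyMeasurable
    exact this.integral_prod_right.measurable
  · calc ∫⁻ l in Ioi (0 : ℝ), ‖∫ x in Ioc (a i) (b i), w i x * T i l x‖ₑ ^ 2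
        ≤ ∫⁻ l in Ioi (0 : ℝ), (∫⁻ x, ‖w i x‖ₑ * ‖T i l x‖ₑ) ^ 2 := by
          refine lintegral_mono fun l => ?_
          gcongr
          refine (enorm_integral_le_lintegral_enorm _).trans ?_
          simp_rw [enorm_mul]
          exact setLIntegral_le_lintegral _ _
      _ ≤ (∫⁻ x, ‖w i x‖ₑ) ^ 2 * K :=
          lintegral_sq_lintegral_mul_le (hw i).enorm
            (T := fun l x => ‖T i l x‖ₑ) (hT i).enorm (hK i)
      _ ≤ _ := by
          push_cast
          gcongr
          exact hM i

/-- Integration by parts when only one factor is continuously differentiable; the other is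
the primitive of `u`. -/
theorem integral_mul_eq_sub_integral_primitive_mul {a b : ℝ} {u v v' : ℝ → ℂ}
    (hu : IntegrableOn u (Ioc a b)) (hv : ∀ x, HasDerivAt v (v' x) x) (hv' : Continuous v') :
    ∫ y in Ioc a b, u y * v y = (∫ y in Ioc a b, u y) * v b
      - ∫ t in Ioc a b, (∫ y in Ioc a b, if y ≤ t then u y else 0) * v' t := by
  have hvc : Continuous v := continuous_iff_continuousAt.2 fun x => (hv x).continuousAt
  have hvi : IntegrableOn v' (Ioc a b) := hv'.integrableOn_Ioc
  have huv : IntegrableOn (fun y => u y * v y) (Ioc a b) := by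
    have : IntegrableOn (fun y => u y * v y) (Icc a b) :=
      ((integrableOn_Icc_iff_integrableOn_Ioc (by simp)).2 hu).mul_continuousOn hvc.continuousOn isCompact_Icc
    exact this.mono_set Ioc_subset_Icc_self
  have h1 : ∀ y ∈ Ioc a b, (∫ t in Ioc a b, if y ≤ t then v' t else 0) = v b - v y := by
    intro y hy
    have : (∫ t in Ioc a b, if y ≤ t then v' t else 0) = ∫ t in Ioc a b, (Ici y).indicator v' t := by
      congr 1
    rw [this, setIntegral_indicator measurableSet_Ici]
    have hs : (Ioc a b ∩ Ici y : Set ℝ) = Icc y b := by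
      ext t
      simp only [mem_inter_iff, mem_Ioc, mem_Ici, mem_Icc]
      constructor
      · rintro ⟨⟨_, h⟩, h'⟩; exact ⟨h', h⟩
      · rintro ⟨h, h'⟩; exact ⟨⟨hy.1.trans_le h, h'⟩, h⟩
    rw [hs, integral_Icc_eq_integral_Ioc, ← intervalIntegral.integral_of_le hy.2,
      intervalIntegral.integral_eq_sub_of_hasDerivAt (fun x _ => hv x)
        (hv'.intervalIntegrable _ _)]
  have h2 : ∫ t in Ioc a b, (∫ y in Ioc a b, if y ≤ t then u y else 0) * v' t
      = ∫ y in Ioc a b, u y * (v b - v y) := by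
    calc _ = ∫ t in Ioc a b, ∫ y in Ioc a b, (if y ≤ t then u y * v' t else 0) := by
          congr 1; ext t
          rw [← integral_mul_const]
          congr 1; ext y
          split_ifs <;> simp
      _ = ∫ y in Ioc a b, ∫ t in Ioc a b, (if y ≤ t then u y * v' t else 0) := by
          rw [integral_integral_swap]
          have h3 : Integrable (fun p : ℝ × ℝ => v' p.1 * u p.2)
            ((volume.restrict (Ioc a b)).prod (volume.restrict (Ioc a b))) := hvi.mul_prod hu
          have h4 := h3.indicator (s := {p : ℝ × ℝ | p.2 ≤ p.1})
            (measurableSet_le measurable_snd measurable_fst)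
          refine h4.congr (Eventually.of_forall fun p => ?_)
          simp only [indicator, mem_ofPred_eq, Function.uncurry]
          split_ifs <;> ring
      _ = _ := by
          refine setIntegral_congr_fun measurableSet_Ioc fun y hy => ?_
          rw [← h1 y hy, ← integral_const_mul]
          congr 1; ext t
          split_ifs <;> simp
  rw [h2]
  simp_rw [mul_sub]
  rw [integral_sub (hu.mul_const _) huv, integral_mul_const]
  ring

/-- An oscillatory integral `∫ h(y) e^{-iλy} G(λ,y) dy` is in `L²` as a function of `λ` when `h` is in
`L²` and the amplitude `G` varies slowly in `y`, uniformly in `λ`. -/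
theorem UL2.oscillatory {ι : Type*} {a b : ι → ℝ} {h : ι → ℝ → ℂ}
    (hm : ∀ i, Measurable (h i)) {K : ℝ≥0} (hK : ∀ i, ∫⁻ x, ‖h i x‖ₑ ^ 2 ≤ K)
    {G G' : ι → ℝ → ℝ → ℂ} (hG : ∀ i l x, HasDerivAt (G i l) (G' i l x) x)
    (hGm : ∀ i, Measurable (Function.uncurry (G i))) (hG'c : ∀ i l, Continuous (G' i l))
    {c : ℝ≥0} (hc : ∀ i l x, 0 < l → ‖G i l x‖ ≤ c)
    {m : ι → ℝ → ℝ} (hmm : ∀ i, Measurable (m i)) {M : ℝ≥0} (hM : ∀ i, ∫⁻ x, ‖m i x‖ₑ ≤ M)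
    (hGm' : ∀ i l x, 0 < l → ‖G' i l x‖ ≤ m i x) :
    UL2 fun i l => ∫ y in Ioc (a i) (b i), h i y * exp (-(I * l * y)) * G i l y := by
  have hexp : Measurable fun p : ℝ × ℝ => exp (-(I * p.1 * p.2)) := by
    have : Continuous fun p : ℝ × ℝ => exp (-(I * p.1 * p.2)) := by fun_prop
    exact this.measurable
  -- the truncated Fourier integrals of `h`
  let H : ι → ℝ → ℝ → ℂ := fun i l t =>
    ∫ y in Ioc (a i) (b i), if y ≤ t then h i y * exp (-(I * l * y)) else 0
  have hHm : ∀ i, Measurable (Function.uncurry (H i)) := by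
    intro i
    have : StronglyMeasurable (Function.uncurry fun (p : ℝ × ℝ) (y : ℝ) =>
        if y ≤ p.2 then h i y * exp (-(I * p.1 * y)) else 0) := by
      refine Measurable.stronglyMeasurable (Measurable.ite ?_ ?_ measurable_const)
      · exact measurableSet_le measurable_snd (measurable_snd.comp measurable_fst)
      · exact ((hm i).comp measurable_snd).mul
          (hexp.comp ((measurable_fst.comp measurable_fst).prodMk measurable_snd))
    exact this.integral_prod_right.measurable
  have hmem : ∀ i, MemLp (h i) 2 := fun i => by
    refine ⟨(hm i).aestronglyMeasurable, ?_⟩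
    have := eLpNorm_nnreal_pow_eq_lintegral (f := h i) (μ := volume) (p := 2) (by norm_num)
    have h2 : eLpNorm (h i) 2 volume ^ 2 = ∫⁻ x, ‖h i x‖ₑ ^ 2 := by simpa using this
    have h3 : eLpNorm (h i) 2 volume ^ 2 < ⊤ := h2 ▸ (hK i).trans_lt ENNReal.coe_lt_top
    exact (ENNReal.pow_lt_top_iff.1 h3).resolve_right (by norm_num)
  have hHK : ∀ i t, ∫⁻ l in Ioi (0 : ℝ), ‖H i l t‖ₑ ^ 2 ≤ ENNReal.ofReal (2 * Real.pi) * K := by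
    intro i t
    let g : ℝ → ℂ := (Ioc (a i) (b i) ∩ Iic t).indicator (h i)
    have hgs : MeasurableSet (Ioc (a i) (b i) ∩ Iic t) := measurableSet_Ioc.inter measurableSet_Iic
    have hg2 : MemLp g 2 := (hmem i).indicator hgs
    have hg1 : Integrable g := by
      rw [integrable_indicator_iff hgs]
      have hf : IsFiniteMeasure (volume.restrict (Ioc (a i) (b i) ∩ Iic t)) :=
        ⟨by
          rw [Measure.restrict_apply_univ]
          exact (measure_mono inter_subset_left).trans_lt measure_Ioc_lt_top⟩
      exact ((hmem i).restrict _).integrable (by norm_num)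
    have e : ∀ l : ℝ, H i l t = ∫ y, g y * exp (-(I * l * y)) := by
      intro l
      simp only [H]
      rw [← integral_indicator measurableSet_Ioc]
      congr 1; ext y
      simp only [g, indicator, mem_inter_iff, mem_Iic]
      by_cases h1 : y ∈ Ioc (a i) (b i) <;> by_cases h2 : y ≤ t <;> simp [h1, h2]
    calc ∫⁻ l in Ioi (0 : ℝ), ‖H i l t‖ₑ ^ 2 ≤ ∫⁻ l : ℝ, ‖∫ y, g y * exp (-(I * l * y))‖ₑ ^ 2 := by
          simp_rw [e]
          exact setLIntegral_le_lintegral _ _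
      _ ≤ _ := lintegral_sq_fourier_le hg1 hg2
      _ ≤ _ := by
          gcongr
          refine (lintegral_mono fun y => ?_).trans (hK i)
          gcongr
          simp only [g]
          exact enorm_indicator_le_enorm_self _ _
  obtain ⟨K', hK'⟩ : ∃ K' : ℝ≥0, ENNReal.ofReal (2 * Real.pi) * K = K' :=
    ⟨(2 * Real.pi).toNNReal * K, by push_cast; rfl⟩
  simp_rw [hK'] at hHK
  have hint : ∀ i l, IntegrableOn (fun y => h i y * exp (-(I * (l : ℝ) * y))) (Ioc (a i) (b i)) := by
    intro i l
    have h1 : IntegrableOn (h i) (Icc (a i) (b i)) :=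
      ((hmem i).restrict _).integrable (by norm_num)
    exact (h1.mul_continuousOn (by fun_prop : Continuous fun y : ℝ => exp (-(I * l * y))).continuousOn
      isCompact_Icc).mono_set Ioc_subset_Icc_self
  have hF : ∀ i l, ∫ y in Ioc (a i) (b i), h i y * exp (-(I * (l : ℝ) * y)) * G i l y
      = G i l (b i) * H i l (b i) - ∫ t in Ioc (a i) (b i), H i l t * G' i l t := by
    intro i l
    rw [integral_mul_eq_sub_integral_primitive_mul (hint i l) (hG i l) (hG'c i l)]
    congr 1
    rw [mul_comm]
    congr 1
    refine setIntegral_congr_fun measurableSet_Ioc fun y hy => ?_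
    simp [hy.2]
  have hFm : ∀ i, Measurable fun l : ℝ =>
      ∫ y in Ioc (a i) (b i), h i y * exp (-(I * l * y)) * G i l y := by
    intro i
    have : StronglyMeasurable (Function.uncurry fun (l : ℝ) y =>
        h i y * exp (-(I * l * y)) * G i l y) :=
      ((((hm i).comp measurable_snd).mul hexp).mul (hGm i)).stronglyMeasurable
    exact this.integral_prod_right.measurable
  have hA : UL2 fun i l => G i l (b i) * H i l (b i) := by
    refine UBdd.mul_UL2 ⟨fun i => (hGm i).comp measurable_prodMk_right, c, fun i l hl => hc i l _ hl⟩
      ⟨fun i => (hHm i).comp measurable_prodMk_right, K', fun i => hHK i _⟩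
  have hB : UL2 fun i l => ∫ t in Ioc (a i) (b i), H i l t * G' i l t := by
    refine ⟨fun i => ?_, M ^ 2 * K', fun i => ?_⟩
    · have := (hA.1 i).sub (hFm i)
      convert! this using 1
      ext l
      simp [hF i l]
    · calc ∫⁻ l in Ioi (0 : ℝ), ‖∫ t in Ioc (a i) (b i), H i l t * G' i l t‖ₑ ^ 2
          ≤ ∫⁻ l in Ioi (0 : ℝ), (∫⁻ x, ‖m i x‖ₑ * ‖H i l x‖ₑ) ^ 2 := by
            refine setLIntegral_mono' measurableSet_Ioi fun l hl => ?_
            gcongr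
            refine (enorm_integral_le_lintegral_enorm _).trans
              ((setLIntegral_le_lintegral _ _).trans (lintegral_mono fun x => ?_))
            rw [enorm_mul, mul_comm]
            gcongr
            exact enorm_le_iff_norm_le.2 ((hGm' i l x hl).trans (le_abs_self _))
        _ ≤ (∫⁻ x, ‖m i x‖ₑ) ^ 2 * K' :=
            lintegral_sq_lintegral_mul_le (hmm i).enorm
              (T := fun l x => ‖H i l x‖ₑ) (hHm i).enorm (hHK i)
        _ ≤ _ := by
            push_cast
            gcongr
            exact hM i
  simp_rw [hF]
  exact hA.sub hB

/-! ### The spectral parameter -/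

/-- The value of `1 / z` in terms of `λ = (z - 1 / z) / 2`, for `z > 0`. -/
def eps (l : ℝ) : ℝ := √(l ^ 2 + 1) - l

/-- The derivative of `eps`. -/
def deps (l : ℝ) : ℝ := l / √(l ^ 2 + 1) - 1

theorem eps_pos (l : ℝ) : 0 < eps l := by
  have h1 := Real.sq_sqrt (by positivity : (0 : ℝ) ≤ l ^ 2 + 1)
  have h2 := Real.sqrt_nonneg (l ^ 2 + 1)
  unfold eps
  by_contra! h
  nlinarith

theorem eps_mul_eps_neg (l : ℝ) : eps l * eps (-l) = 1 := by
  have h1 := Real.sq_sqrt (by positivity : (0 : ℝ) ≤ l ^ 2 + 1)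
  unfold eps
  rw [neg_sq]
  linarith

theorem eps_mul_one_add_le {l : ℝ} (hl : 0 ≤ l) : eps l * (1 + l) ≤ 1 := by
  have h1 := Real.sq_sqrt (by positivity : (0 : ℝ) ≤ l ^ 2 + 1)
  have h2 : 1 ≤ √(l ^ 2 + 1) := by
    rw [Real.one_le_sqrt]; nlinarith
  unfold eps
  nlinarith

theorem eps_le_one {l : ℝ} (hl : 0 ≤ l) : eps l ≤ 1 := by
  nlinarith [eps_mul_one_add_le hl, eps_pos l]

theorem hasDerivAt_eps (l : ℝ) : HasDerivAt eps (deps l) l := by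
  have h : HasDerivAt (fun l : ℝ => l ^ 2 + 1) (2 * l) l := by
    simpa using (hasDerivAt_pow 2 l).add_const 1
  have := (h.sqrt (by positivity)).sub (hasDerivAt_id l)
  convert! this using 1
  unfold deps
  have : √(l ^ 2 + 1) ≠ 0 := by positivity
  field_simp

theorem continuous_eps : Continuous eps := by unfold eps; fun_prop

theorem continuous_deps : Continuous deps := by
  unfold deps
  have : ∀ l : ℝ, √(l ^ 2 + 1) ≠ 0 := fun l => by positivity
  fun_prop (disch := simp_all)

theorem abs_deps_mul_le {l : ℝ} (hl : 0 ≤ l) : |deps l| * (1 + l) ≤ 2 * eps l := by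
  have h1 := Real.sq_sqrt (by positivity : (0 : ℝ) ≤ l ^ 2 + 1)
  have h2 : 0 < √(l ^ 2 + 1) := by positivity
  have h3 : deps l = -(eps l / √(l ^ 2 + 1)) := by
    unfold deps eps; field_simp; ring
  have h4 : 1 + l ≤ 2 * √(l ^ 2 + 1) := by
    by_contra! h
    nlinarith [sq_nonneg (l - 1)]
  rw [h3, abs_neg, abs_of_nonneg (div_nonneg (eps_pos l).le h2.le), div_mul_eq_mul_div,
    div_le_iff₀ h2]
  nlinarith [eps_pos l]

theorem abs_deps_le {l : ℝ} (hl : 0 ≤ l) : |deps l| ≤ 2 * eps l := by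
  nlinarith [abs_deps_mul_le hl, abs_nonneg (deps l)]

/-! ### Potentials and their scattering data -/

/-- The coefficients of the system: `c` stands for `cos f₀ - 1`, `s` for `sin f₀` and `q` for
`f₀' + f₁`. -/
structure Potential where
  c : ℝ → ℝ
  s : ℝ → ℝ
  q : ℝ → ℝ

namespace Potential

/-- The diagonal coefficient at the spectral parameter `λ`. -/
def kap (D : Potential) (l x : ℝ) : ℝ := eps l * D.c x / 4

/-- The off-diagonal coefficient at the spectral parameter `λ`, without the oscillating factor. -/
def amp (D : Potential) (l x : ℝ) : ℂ := (I * eps l * D.s x + D.q x) / 4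

/-- The off-diagonal coefficient at the spectral parameter `λ`. -/
def off (D : Potential) (l x : ℝ) : ℂ := exp (-(I * l * x)) * D.amp l x

/-- The coefficients are continuous and integrable. -/
structure Regular (D : Potential) : Prop where
  cont_c : Continuous D.c
  cont_s : Continuous D.s
  cont_q : Continuous D.q
  int_c : Integrable D.c
  int_s : Integrable D.s
  int_q : Integrable D.q

theorem norm_exp_I (l x : ℝ) : ‖exp (-(I * l * x))‖ = 1 := by
  have : -(I * (l : ℂ) * x) = ((-(l * x) : ℝ) : ℂ) * I := by push_cast; ring
  rw [this, norm_exp_ofReal_mul_I]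

theorem Regular.admissible {D : Potential} (h : D.Regular) (l : ℝ) :
    Admissible (D.kap l) (D.off l) := by
  have h1 := h.cont_c
  have h2 := h.cont_s
  have h3 := h.cont_q
  have hc : Continuous (D.off l) := by unfold off amp; fun_prop
  refine ⟨by unfold kap; fun_prop, hc, (h.int_c.const_mul _).div_const _, ?_⟩
  have : Integrable (D.amp l) :=
    ((h.int_s.ofReal.const_mul (I * eps l)).add h.int_q.ofReal).div_const 4
  refine this.norm.mono' hc.aestronglyMeasurable (Eventually.of_forall fun x => ?_)
  rw [off, norm_mul, norm_exp_I, one_mul]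

open Classical in
/-- The first component of the solution normalized at `+∞`, and `0` if there is none. -/
def al (D : Potential) (l : ℝ) : ℝ → ℂ :=
  if h : ∃ α β, JostPair (D.kap l) (D.off l) α β then h.choose else 0

open Classical in
/-- The second component of the solution normalized at `+∞`, and `0` if there is none. -/
def be (D : Potential) (l : ℝ) : ℝ → ℂ :=
  if h : ∃ α β, JostPair (D.kap l) (D.off l) α β then h.choose_spec.choose else 0

/-- The limit of `D.al l` at `-∞`: the scattering coefficient `a`. -/
def a (D : Potential) (l : ℝ) : ℂ := limUnder atBot (D.al l)

/-- The limit of `D.be l` at `-∞`: the scattering coefficient `b`. -/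
def b (D : Potential) (l : ℝ) : ℂ := limUnder atBot (D.be l)

section

variable {D : Potential}

theorem Regular.jost (h : D.Regular) (l : ℝ) : JostPair (D.kap l) (D.off l) (D.al l) (D.be l) := by
  have hex := (h.admissible l).exists_jostPair
  unfold al be
  rw [dif_pos hex, dif_pos hex]
  exact hex.choose_spec.choose_spec

theorem Regular.tendsto (h : D.Regular) (l : ℝ) :
    Tendsto (D.al l) atBot (𝓝 (D.a l)) ∧ Tendsto (D.be l) atBot (𝓝 (D.b l)) := by
  obtain ⟨a, b, ha, hb⟩ := (h.jost l).exists_tendsto_atBot (h.admissible l)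
  exact ⟨tendsto_nhds_limUnder ⟨a, ha⟩, tendsto_nhds_limUnder ⟨b, hb⟩⟩

theorem Regular.hasScattering (h : D.Regular) (l : ℝ) :
    HasScattering (D.kap l) (D.off l) (D.a l) (D.b l) :=
  ⟨_, _, h.jost l, (h.tendsto l).1, (h.tendsto l).2⟩

end

/-- All three coefficients vanish outside `(-N, N)`. -/
structure SupportedIn (D : Potential) (N : ℝ) : Prop where
  c_eq_zero : ∀ x, N ≤ |x| → D.c x = 0
  s_eq_zero : ∀ x, N ≤ |x| → D.s x = 0
  q_eq_zero : ∀ x, N ≤ |x| → D.q x = 0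

section

variable {D : Potential} {N : ℝ}

theorem SupportedIn.kap_eq_zero (hs : D.SupportedIn N) (l : ℝ) {x : ℝ} (hx : N ≤ |x|) :
    D.kap l x = 0 := by
  simp [kap, hs.c_eq_zero x hx]

theorem SupportedIn.off_eq_zero (hs : D.SupportedIn N) (l : ℝ) {x : ℝ} (hx : N ≤ |x|) :
    D.off l x = 0 := by
  simp [off, amp, hs.s_eq_zero x hx, hs.q_eq_zero x hx]

theorem integral_Ioi_eq_of_support {E : Type*} [NormedAddCommGroup E] [NormedSpace ℝ E]
    {g : ℝ → E} (hg : ∀ x, N ≤ |x| → g x = 0) (x : ℝ) :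
    ∫ y in Ioi x, g y = ∫ y in Ioc x N, g y := by
  refine setIntegral_eq_of_subset_of_forall_sdiff_eq_zero measurableSet_Ioi Ioc_subset_Ioi_self
    fun y hy => hg y ?_
  have : ¬ y ≤ N := fun h => hy.2 ⟨hy.1, h⟩
  exact (not_le.1 this).le.trans (le_abs_self y)

theorem integral_eq_of_support {E : Type*} [NormedAddCommGroup E] [NormedSpace ℝ E]
    {g : ℝ → E} (hg : ∀ x, N ≤ |x| → g x = 0) : ∫ y, g y = ∫ y in Ioc (-N) N, g y := by
  refine (setIntegral_eq_integral_of_forall_compl_eq_zero fun y hy => hg y ?_).symm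
  rw [mem_Ioc, not_and_or, not_lt, not_le] at hy
  rcases hy with h | h
  · exact (le_neg.2 h).trans (neg_le_abs y)
  · exact h.le.trans (le_abs_self y)

theorem integrable_of_support {E : Type*} [NormedAddCommGroup E]
    {g : ℝ → E} (hc : Continuous g) (hg : ∀ x, N ≤ |x| → g x = 0) : Integrable g := by
  refine hc.integrable_of_hasCompactSupport (HasCompactSupport.intro (K := Icc (-N) N) isCompact_Icc
    fun x hx => hg x ?_)
  by_contra! h
  exact hx (abs_le.1 h.le)

/-- Fundamental theorem of calculus for a function with a limit at `+∞` whose derivative vanishes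
outside `(-N, N)`. -/
theorem eq_sub_integral_of_support {u u' : ℝ → ℂ} {c : ℂ} (hu : ∀ x, HasDerivAt u (u' x) x)
    (hc : Continuous u') (hl : Tendsto u atTop (𝓝 c)) (hg : ∀ x, N ≤ |x| → u' x = 0) (x : ℝ) :
    u x = c - ∫ y in Ioc x N, u' y := by
  have := integral_Ioi_of_hasDerivAt_of_tendsto' (fun y (_ : y ∈ Ici x) => hu y)
    (integrable_of_support hc hg).integrableOn hl
  rw [← integral_Ioi_eq_of_support hg, this]
  ring

/-- A function whose derivative vanishes outside `(-N, N)` takes its limit at `-∞` in `-N`. -/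
theorem eq_of_tendsto_atBot_of_support {u u' : ℝ → ℂ} {c : ℂ}
    (hu : ∀ x, HasDerivAt u (u' x) x)
    (hl : Tendsto u atBot (𝓝 c)) (hg : ∀ x, N ≤ |x| → u' x = 0) : u (-N) = c := by
  refine tendsto_nhds_unique (tendsto_const_nhds.congr' ?_) hl
  filter_upwards [eventually_le_atBot (-N)] with x hx
  have h0 : ∀ y ∈ uIcc x (-N), HasDerivAt u 0 y := by
    intro y hy
    rw [uIcc_of_le hx] at hy
    have : N ≤ |y| := (le_neg.1 hy.2 |>.trans (neg_le_abs y))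
    simpa [hg y this] using hu y
  have := intervalIntegral.integral_eq_sub_of_hasDerivAt h0 (by simp)
  rw [intervalIntegral.integral_zero] at this
  exact sub_eq_zero.1 this.symm

theorem Regular.continuous_kap (h : D.Regular) : Continuous (Function.uncurry D.kap) := by
  have h1 := h.cont_c
  have := continuous_eps
  unfold kap Function.uncurry
  fun_prop

theorem Regular.continuous_amp (h : D.Regular) : Continuous (Function.uncurry D.amp) := by
  have h2 := h.cont_s
  have h3 := h.cont_q
  have := continuous_eps
  unfold amp Function.uncurry
  fun_prop

theorem Regular.continuous_off (h : D.Regular) : Continuous (Function.uncurry D.off) := by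
  have := h.continuous_amp
  have h2 : Continuous fun p : ℝ × ℝ => exp (-(I * p.1 * p.2)) := by fun_prop
  exact h2.mul this

theorem SupportedIn.tendsto_integral_sub (hs : D.SupportedIn N) (h : D.Regular) (hN : 0 ≤ N)
    (l : ℝ) :
    Tendsto (fun l' => 4 * ∫ y, (|D.kap l' y - D.kap l y| + ‖D.off l' y - D.off l y‖)) (𝓝 l)
      (𝓝 0) := by
  have e : ∀ l', ∫ y, (|D.kap l' y - D.kap l y| + ‖D.off l' y - D.off l y‖)
      = ∫ y in (-N)..N, (|D.kap l' y - D.kap l y| + ‖D.off l' y - D.off l y‖) := by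
    intro l'
    rw [intervalIntegral.integral_of_le (by linarith), integral_eq_of_support (N := N)]
    intro x hx
    simp [hs.kap_eq_zero _ hx, hs.off_eq_zero _ hx]
  simp_rw [e]
  have hc : Continuous fun l' => 4 * ∫ y in (-N)..N,
      (|D.kap l' y - D.kap l y| + ‖D.off l' y - D.off l y‖) := by
    have h1 := h.continuous_kap
    have h2 := h.continuous_off
    refine continuous_const.mul
      (intervalIntegral.continuous_parametric_intervalIntegral_of_continuous' ?_ _ _)
    have h3 : Continuous fun p : ℝ × ℝ => D.kap l p.2 := h1.comp (continuous_const.prodMk continuous_snd)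
    have h4 : Continuous fun p : ℝ × ℝ => D.off l p.2 := h2.comp (continuous_const.prodMk continuous_snd)
    exact (h1.sub h3).abs.add (h2.sub h4).norm
  simpa using hc.tendsto l

/-- A function continuous in `x` for fixed `λ`, and continuous in `λ` uniformly in `x`, is jointly
continuous. -/
theorem continuous_uncurry_of_norm_sub_le {u : ℝ → ℝ → ℂ} (hu : ∀ l, Continuous (u l))
    {δ : ℝ → ℝ → ℝ} (hδ : ∀ l, Tendsto (δ l) (𝓝 l) (𝓝 0))
    (hb : ∀ l l' x, ‖u l' x - u l x‖ ≤ δ l l') : Continuous (Function.uncurry u) := by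
  refine continuous_iff_continuousAt.2 fun ⟨l, x⟩ => ?_
  have h1 : Tendsto (fun p : ℝ × ℝ => u p.1 p.2 - u l p.2) (𝓝 (l, x)) (𝓝 0) :=
    squeeze_zero_norm (fun p => hb l p.1 p.2)
      ((hδ l).comp (continuous_fst.tendsto (l, x)))
  have h2 : Tendsto (fun p : ℝ × ℝ => u l p.2) (𝓝 (l, x)) (𝓝 (u l x)) :=
    ((hu l).comp continuous_snd).tendsto (l, x)
  have := h1.add h2
  simp only [sub_add_cancel, zero_add] at this
  exact this

theorem SupportedIn.continuous_al (hs : D.SupportedIn N) (h : D.Regular) (hN : 0 ≤ N) :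
    Continuous (Function.uncurry D.al) :=
  continuous_uncurry_of_norm_sub_le (fun l => (h.jost l).continuous_left)
    (hs.tendsto_integral_sub h hN) fun l l' x =>
      (JostPair.norm_sub_le (h.admissible l) (h.admissible l') (h.jost l) (h.jost l') x).1

theorem SupportedIn.continuous_be (hs : D.SupportedIn N) (h : D.Regular) (hN : 0 ≤ N) :
    Continuous (Function.uncurry D.be) :=
  continuous_uncurry_of_norm_sub_le (fun l => (h.jost l).continuous_right)
    (hs.tendsto_integral_sub h hN) fun l l' x =>
      (JostPair.norm_sub_le (h.admissible l) (h.admissible l') (h.jost l) (h.jost l') x).2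

theorem SupportedIn.al_neg (hs : D.SupportedIn N) (h : D.Regular) (l : ℝ) :
    D.al l (-N) = D.a l :=
  eq_of_tendsto_atBot_of_support (h.jost l).deriv_left (h.tendsto l).1 fun x hx => by
    simp [hs.kap_eq_zero _ hx, hs.off_eq_zero _ hx]

theorem SupportedIn.be_neg (hs : D.SupportedIn N) (h : D.Regular) (l : ℝ) :
    D.be l (-N) = D.b l :=
  eq_of_tendsto_atBot_of_support (h.jost l).deriv_right (h.tendsto l).2 fun x hx => by
    simp [hs.kap_eq_zero _ hx, hs.off_eq_zero _ hx]

/-! ### Dependence of the scattering data on the spectral parameter -/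

/-- The derivative of `D.kap` with respect to `λ`. -/
def dkap (D : Potential) (l x : ℝ) : ℝ := deps l * D.c x / 4

/-- The derivative of `D.off` with respect to `λ`. -/
def doff (D : Potential) (l x : ℝ) : ℂ :=
  exp (-(I * l * x)) * (-(I * x) * D.amp l x + I * deps l * D.s x / 4)

/-- With `Φ` the solution normalized at `+∞` and `W` the coefficient matrix, the `(1, 1)` entry of
`∫ Φ* (∂W/∂λ) Φ`. -/
def d11 (D : Potential) (N l : ℝ) : ℂ :=
  ∫ x in Ioc (-N) N, (I * D.dkap l x * (conj (D.al l x) * D.al l x - conj (D.be l x) * D.be l x)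
    + D.doff l x * (conj (D.be l x) * D.al l x) - conj (D.doff l x) * (conj (D.al l x) * D.be l x))

/-- With `Φ` the solution normalized at `+∞` and `W` the coefficient matrix, the `(2, 1)` entry of
`∫ Φ* (∂W/∂λ) Φ`. -/
def d21 (D : Potential) (N l : ℝ) : ℂ :=
  ∫ x in Ioc (-N) N, (-(I * D.dkap l x * (D.al l x * D.be l x + D.be l x * D.al l x))
    + D.doff l x * (D.al l x * D.al l x) + conj (D.doff l x) * (D.be l x * D.be l x))

theorem continuous_dslope_eps (l : ℝ) : Continuous (dslope eps l) := by
  rw [← continuousOn_univ, continuousOn_dslope univ_mem]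
  exact ⟨continuous_eps.continuousOn, (hasDerivAt_eps l).differentiableAt⟩

theorem eps_sub_eps (l μ : ℝ) : eps μ - eps l = (μ - l) * dslope eps l μ := by
  rw [← smul_eq_mul, sub_smul_dslope]

/-- The function `t ↦ (e^{-it} - 1) / t`, extended continuously to `0`. -/
def expSlope : ℝ → ℂ := dslope (fun t : ℝ => exp (-(I * t))) 0

theorem hasDerivAt_exp_neg_I (t : ℝ) :
    HasDerivAt (fun t : ℝ => exp (-(I * t))) (exp (-(I * t)) * -I) t := by
  have : HasDerivAt (fun t : ℝ => -(I * (t : ℂ))) (-I) t := by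
    convert! ((hasDerivAt_id (t : ℝ)).ofReal_comp.const_mul I).neg using 1
    simp
  exact this.cexp

theorem continuous_expSlope : Continuous expSlope := by
  rw [← continuousOn_univ, expSlope, continuousOn_dslope univ_mem]
  exact ⟨Continuous.continuousOn (by fun_prop), (hasDerivAt_exp_neg_I 0).differentiableAt⟩

theorem exp_sub_one_eq (t : ℝ) : exp (-(I * t)) - 1 = t * expSlope t := by
  have := sub_smul_dslope (fun t : ℝ => exp (-(I * t))) 0 t
  simp only [sub_zero, real_smul, ofReal_zero, mul_zero, neg_zero, exp_zero] at this
  exact this.symm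

theorem expSlope_zero : expSlope 0 = -I := by
  rw [expSlope, dslope_same, (hasDerivAt_exp_neg_I 0).deriv]
  simp

/-- The difference quotient of `D.off` in `λ`, in a form that is continuous on the diagonal `μ = l`,
where it equals `D.doff`. -/
def qoff (D : Potential) (l μ x : ℝ) : ℂ :=
  exp (-(I * l * x)) * (x * expSlope ((μ - l) * x) * D.amp μ x + I * dslope eps l μ * D.s x / 4)

theorem kap_sub_kap (D : Potential) (l μ x : ℝ) :
    D.kap μ x - D.kap l x = (μ - l) * (dslope eps l μ * D.c x / 4) := by
  unfold kap
  linear_combination (D.c x / 4) * eps_sub_eps l μ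

theorem off_sub_off (D : Potential) (l μ x : ℝ) :
    D.off μ x - D.off l x = (μ - l) * D.qoff l μ x := by
  have e1 : exp (-(I * μ * x)) = exp (-(I * l * x)) * exp (-(I * ((μ - l) * x : ℝ))) := by
    rw [← Complex.exp_add]; congr 1; push_cast; ring
  have e2 := exp_sub_one_eq ((μ - l) * x)
  have e3 : (eps μ : ℂ) - eps l = (μ - l) * dslope eps l μ := by exact_mod_cast eps_sub_eps l μ
  unfold off qoff
  rw [e1, sub_eq_iff_eq_add.1 e2]
  unfold amp
  push_cast
  linear_combination exp (-(I * l * x)) * I * D.s x / 4 * e3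

theorem qoff_self (D : Potential) (l x : ℝ) : D.qoff l l x = D.doff l x := by
  simp only [qoff, doff, sub_self, zero_mul, expSlope_zero, dslope_same, (hasDerivAt_eps l).deriv]
  ring

theorem Regular.continuous_qoff (h : D.Regular) (l : ℝ) :
    Continuous (Function.uncurry (D.qoff l)) := by
  have h1 := h.continuous_amp
  have h2 := continuous_expSlope
  have h3 := continuous_dslope_eps l
  have h4 := h.cont_s
  have e1 : Continuous fun p : ℝ × ℝ => D.amp p.1 p.2 := h1
  unfold qoff Function.uncurry
  fun_prop

theorem hasDerivAt_of_eq_add_mul {f g : ℝ → ℂ} {l : ℝ} (hg : ContinuousAt g l)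
    (h : ∀ μ : ℝ, f μ = f l + (μ - l) * g μ) : HasDerivAt f (g l) l := by
  rw [hasDerivAt_iff_tendsto_slope]
  refine (hg.tendsto.mono_left nhdsWithin_le_nhds).congr' ?_
  filter_upwards [self_mem_nhdsWithin] with μ hμ
  have : (μ : ℂ) - l ≠ 0 := by exact_mod_cast sub_ne_zero.2 hμ
  rw [slope_def_module, h μ, add_sub_cancel_left, real_smul]
  push_cast
  field_simp

/-- The derivatives of the scattering data: `∂S/∂λ = -S ∫ Φ* (∂W/∂λ) Φ`. -/
theorem SupportedIn.hasDerivAt_a_b (hs : D.SupportedIn N) (h : D.Regular) (hN : 0 ≤ N) (l : ℝ) :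
    HasDerivAt D.a (-(D.a l * D.d11 N l - conj (D.b l) * D.d21 N l)) l ∧
    HasDerivAt D.b (-(D.b l * D.d11 N l + conj (D.a l) * D.d21 N l)) l := by
  have cal := hs.continuous_al h hN
  have cbe := hs.continuous_be h hN
  have cq := h.continuous_qoff l
  have cs := continuous_dslope_eps l
  have cc := h.cont_c
  have cal1 : Continuous fun p : ℝ × ℝ => D.al p.1 p.2 := cal
  have cbe1 : Continuous fun p : ℝ × ℝ => D.be p.1 p.2 := cbe
  have cq1 : Continuous fun p : ℝ × ℝ => D.qoff l p.1 p.2 := cq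
  have cal2 : Continuous fun x : ℝ => D.al l x := (h.jost l).continuous_left
  have cbe2 : Continuous fun x : ℝ => D.be l x := (h.jost l).continuous_right
  let g1 : ℝ → ℝ → ℂ := fun μ x =>
    I * ((dslope eps l μ * D.c x / 4 : ℝ) : ℂ) * (conj (D.al l x) * D.al μ x - conj (D.be l x) * D.be μ x)
      + D.qoff l μ x * (conj (D.be l x) * D.al μ x)
      - conj (D.qoff l μ x) * (conj (D.al l x) * D.be μ x)
  let g2 : ℝ → ℝ → ℂ := fun μ x =>
    -(I * ((dslope eps l μ * D.c x / 4 : ℝ) : ℂ) * (D.al l x * D.be μ x + D.be l x * D.al μ x))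
      + D.qoff l μ x * (D.al l x * D.al μ x) + conj (D.qoff l μ x) * (D.be l x * D.be μ x)
  have hg1 : Continuous (Function.uncurry g1) := by
    have k1 : Continuous fun p : ℝ × ℝ => conj (D.al l p.2) :=
      continuous_conj.comp (cal2.comp continuous_snd)
    have k2 : Continuous fun p : ℝ × ℝ => conj (D.be l p.2) :=
      continuous_conj.comp (cbe2.comp continuous_snd)
    have k3 : Continuous fun p : ℝ × ℝ => conj (D.qoff l p.1 p.2) := continuous_conj.comp cq1
    simp only [g1]
    fun_prop
  have hg2 : Continuous (Function.uncurry g2) := by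
    have k3 : Continuous fun p : ℝ × ℝ => conj (D.qoff l p.1 p.2) := continuous_conj.comp cq1
    simp only [g2]
    fun_prop
  have hgc : ∀ μ : ℝ, Continuous fun x => ((μ : ℂ) - l) * g1 μ x := fun μ => by
    exact (hg1.uncurry_left μ).const_mul _
  have hu : ∀ μ, conj (D.a l) * D.a μ + conj (D.b l) * D.b μ
      = 1 - (μ - l) * ∫ x in Ioc (-N) N, g1 μ x := by
    intro μ
    have hd : ∀ x, HasDerivAt (fun x => conj (D.al l x) * D.al μ x + conj (D.be l x) * D.be μ x)
        ((μ - l) * g1 μ x) x := by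
      intro x
      convert! (h.jost l).hasDerivAt_cross_left (h.jost μ) x using 1
      rw [kap_sub_kap, off_sub_off]
      simp only [g1, map_mul, map_sub, conj_ofReal]
      push_cast
      ring
    have := eq_sub_integral_of_support (N := N) hd
      (hgc μ)
      ((h.jost l).tendsto_cross_left (h.jost μ)) (fun x hx => by
        simp [g1, hs.c_eq_zero x hx, qoff, hs.s_eq_zero x hx, amp, hs.q_eq_zero x hx]) (-N)
    rw [hs.al_neg h, hs.be_neg h, hs.al_neg h, hs.be_neg h, integral_const_mul] at this
    exact this
  have hgc : ∀ μ : ℝ, Continuous fun x => ((μ : ℂ) - l) * g2 μ x := fun μ => by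
    exact (hg2.uncurry_left μ).const_mul _
  have hw : ∀ μ, D.a l * D.b μ - D.b l * D.a μ = 0 - (μ - l) * ∫ x in Ioc (-N) N, g2 μ x := by
    intro μ
    have hd : ∀ x, HasDerivAt (fun x => D.al l x * D.be μ x - D.be l x * D.al μ x)
        ((μ - l) * g2 μ x) x := by
      intro x
      convert! (h.jost l).hasDerivAt_cross_right (h.jost μ) x using 1
      rw [kap_sub_kap, off_sub_off]
      simp only [g2, map_mul, map_sub, conj_ofReal]
      push_cast
      ring
    have := eq_sub_integral_of_support (N := N) hd
      (hgc μ)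
      ((h.jost l).tendsto_cross_right (h.jost μ)) (fun x hx => by
        simp [g2, hs.c_eq_zero x hx, qoff, hs.s_eq_zero x hx, amp, hs.q_eq_zero x hx]) (-N)
    rw [hs.al_neg h, hs.be_neg h, hs.al_neg h, hs.be_neg h, integral_const_mul] at this
    exact this
  have hQ1 : Continuous fun μ => ∫ x in Ioc (-N) N, g1 μ x := by
    simp_rw [← intervalIntegral.integral_of_le (by linarith : -N ≤ N)]
    exact intervalIntegral.continuous_parametric_intervalIntegral_of_continuous' hg1 _ _
  have hQ2 : Continuous fun μ => ∫ x in Ioc (-N) N, g2 μ x := by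
    simp_rw [← intervalIntegral.integral_of_le (by linarith : -N ≤ N)]
    exact intervalIntegral.continuous_parametric_intervalIntegral_of_continuous' hg2 _ _
  have e1 : ∫ x in Ioc (-N) N, g1 l x = D.d11 N l := by
    simp only [g1, d11, dkap, qoff_self, dslope_same, (hasDerivAt_eps l).deriv]
  have e2 : ∫ x in Ioc (-N) N, g2 l x = D.d21 N l := by
    simp only [g2, d21, dkap, qoff_self, dslope_same, (hasDerivAt_eps l).deriv]
  have hone := (h.hasScattering l).conj_mul_add
  constructor
  · have := hasDerivAt_of_eq_add_mul (f := D.a) (g := fun μ => -(D.a l * (∫ x in Ioc (-N) N, g1 μ x)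
        - conj (D.b l) * ∫ x in Ioc (-N) N, g2 μ x)) (l := l)
      (((continuous_const.mul hQ1).sub (continuous_const.mul hQ2)).neg).continuousAt (fun μ => by
        linear_combination D.a l * hu μ - conj (D.b l) * hw μ - D.a μ * hone)
    simpa only [e1, e2] using this
  · have := hasDerivAt_of_eq_add_mul (f := D.b) (g := fun μ => -(D.b l * (∫ x in Ioc (-N) N, g1 μ x)
        + conj (D.a l) * ∫ x in Ioc (-N) N, g2 μ x)) (l := l)
      (((continuous_const.mul hQ1).add (continuous_const.mul hQ2)).neg).continuousAt (fun μ => by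
        linear_combination D.b l * hu μ + conj (D.a l) * hw μ - D.b μ * hone)
    simpa only [e1, e2] using this

end

end Potential

/-! ### Uniform estimates for compactly supported potentials -/

/-- `k` is a primitive of `k'` and vanishes outside `(-N, N)`. The supremum of `|k|`, the `L¹` norms
of `k` and `k'`, and the squares of the `L²` norms of `k`, `k'`, `x k` and `x k'` are at most `M`,
a bound that does not involve `N`. -/
structure TameFun (N : ℝ) (M : ℝ≥0) (k k' : ℝ → ℝ) : Prop where
  cont : Continuous k
  meas : Measurable k'
  ftc : ∀ x y, k y - k x = ∫ t in x..y, k' t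
  supp : ∀ x, N ≤ |x| → k x = 0
  sup : ∀ x, |k x| ≤ M
  l1 : ∫⁻ x, ‖k x‖ₑ ≤ M
  l1' : ∫⁻ x, ‖k' x‖ₑ ≤ M
  l2 : ∫⁻ x, ‖k x‖ₑ ^ 2 ≤ M
  l2' : ∫⁻ x, ‖k' x‖ₑ ^ 2 ≤ M
  xl2 : ∫⁻ x, ‖x * k x‖ₑ ^ 2 ≤ M
  xl2' : ∫⁻ x, ‖x * k' x‖ₑ ^ 2 ≤ M

/-- `k` is a function on `(-N, N]`, the primitive of `k'`, that vanishes at both ends, and the squares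
of the `L²` norms of `k` and `k'` are at most `K`. The primitive is written as an integral over the
whole interval, the form in which it appears after integration by parts. -/
structure H1Fun (N : ℝ) (K : ℝ≥0) (k k' : ℝ → ℂ) : Prop where
  cont : Continuous k
  meas : Measurable k'
  int : IntegrableOn k' (Ioc (-N) N)
  prim : ∀ t ∈ Ioc (-N) N, (∫ y in Ioc (-N) N, if y ≤ t then k' y else 0) = k t
  zero : ∫ y in Ioc (-N) N, k' y = 0
  l2 : ∫⁻ x, ‖k x‖ₑ ^ 2 ≤ K
  l2' : ∫⁻ x, ‖k' x‖ₑ ^ 2 ≤ K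

theorem enorm_add_sq_le (u v : ℂ) : ‖u + v‖ₑ ^ 2 ≤ 2 * (‖u‖ₑ ^ 2 + ‖v‖ₑ ^ 2) := by
  have h1 : ‖u + v‖₊ ^ 2 ≤ 2 * (‖u‖₊ ^ 2 + ‖v‖₊ ^ 2) := by
    rw [← NNReal.coe_le_coe]
    push_cast
    have := norm_add_le u v
    nlinarith [norm_nonneg (u + v), sq_nonneg (‖u‖ - ‖v‖)]
  simp only [enorm_eq_nnnorm]
  exact_mod_cast h1

theorem enorm_mul_le_sq_add_sq (u v : ℂ) : ‖u * v‖ₑ ≤ ‖u‖ₑ ^ 2 + ‖v‖ₑ ^ 2 := by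
  have h1 : ‖u * v‖₊ ≤ ‖u‖₊ ^ 2 + ‖v‖₊ ^ 2 := by
    rw [← NNReal.coe_le_coe]
    push_cast
    rw [norm_mul]
    nlinarith [norm_nonneg u, norm_nonneg v, sq_nonneg (‖u‖ - ‖v‖)]
  simp only [enorm_eq_nnnorm]
  exact_mod_cast h1

theorem setIntegral_ite_le {N t : ℝ} (ht : t ∈ Ioc (-N) N) (g : ℝ → ℂ) :
    (∫ y in Ioc (-N) N, if y ≤ t then g y else 0) = ∫ y in Ioc (-N) t, g y := by
  have : (∫ y in Ioc (-N) N, if y ≤ t then g y else 0) = ∫ y in Ioc (-N) N, (Iic t).indicator g y := by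
    congr 1
  rw [this, setIntegral_indicator measurableSet_Iic]
  congr 2
  ext y
  simp only [mem_inter_iff, mem_Ioc, mem_Iic]
  exact ⟨fun h => ⟨h.1.1, h.2⟩, fun h => ⟨⟨h.1, h.2.trans ht.2⟩, h.2⟩⟩

namespace TameFun

variable {N : ℝ} {M : ℝ≥0} {k k' : ℝ → ℝ}

theorem integrable' (h : TameFun N M k k') : Integrable k' :=
  ⟨h.meas.aestronglyMeasurable, h.l1'.trans_lt ENNReal.coe_lt_top⟩

theorem integral_eq (h : TameFun N M k k') {t : ℝ} (ht : -N ≤ t) :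
    ∫ y in Ioc (-N) t, (k' y : ℂ) = k t := by
  rw [integral_complex_ofReal, ← intervalIntegral.integral_of_le ht, ← h.ftc,
    h.supp (-N) (by rw [abs_neg]; exact le_abs_self N)]
  simp

theorem h1Fun (h : TameFun N M k k') (hN : 0 ≤ N) :
    H1Fun N M (fun x => (k x : ℂ)) (fun x => (k' x : ℂ)) where
  cont := continuous_ofReal.comp h.cont
  meas := measurable_ofReal.comp h.meas
  int := h.integrable'.ofReal.integrableOn
  prim t ht := by rw [setIntegral_ite_le ht, h.integral_eq ht.1.le]
  zero := by rw [h.integral_eq (by linarith), h.supp N (le_abs_self N), ofReal_zero]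
  l2 := by simpa [enorm_eq_nnnorm] using h.l2
  l2' := by simpa [enorm_eq_nnnorm] using h.l2'

theorem integral_id_mul (h : TameFun N M k k') {t : ℝ} (ht : -N ≤ t) :
    ∫ y in Ioc (-N) t, ((k y : ℂ) + y * k' y) = t * k t := by
  have hi : IntegrableOn (fun y => (k' y : ℂ)) (Ioc (-N) t) := h.integrable'.ofReal.integrableOn
  have h1 := integral_mul_eq_sub_integral_primitive_mul hi
    (fun x => (hasDerivAt_id x).ofReal_comp) (v := fun x : ℝ => (x : ℂ))
    (by exact continuous_const)
  have h2 : ∫ s in Ioc (-N) t, (∫ y in Ioc (-N) t, if y ≤ s then (k' y : ℂ) else 0) * ((1 : ℝ) : ℂ)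
      = ∫ s in Ioc (-N) t, (k s : ℂ) := by
    refine setIntegral_congr_fun measurableSet_Ioc fun s hs => ?_
    have : (∫ y in Ioc (-N) t, if y ≤ s then (k' y : ℂ) else 0)
        = ∫ y in Ioc (-N) s, (k' y : ℂ) := by
      have : (∫ y in Ioc (-N) t, if y ≤ s then (k' y : ℂ) else 0)
          = ∫ y in Ioc (-N) t, (Iic s).indicator (fun y => (k' y : ℂ)) y := by
        congr 1
      rw [this, setIntegral_indicator measurableSet_Iic]
      congr 2
      ext y
      simp only [mem_inter_iff, mem_Ioc, mem_Iic]
      exact ⟨fun h => ⟨h.1.1, h.2⟩, fun h => ⟨⟨h.1, h.2.trans hs.2⟩, h.2⟩⟩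
    simp only [this, ofReal_one, mul_one]
    exact h.integral_eq hs.1.le
  rw [h2, h.integral_eq ht] at h1
  have hk : IntegrableOn (fun y => (k y : ℂ)) (Ioc (-N) t) :=
    (continuous_ofReal.comp h.cont).integrableOn_Ioc
  have hyk : IntegrableOn (fun y : ℝ => (y : ℂ) * k' y) (Ioc (-N) t) := by
    have : IntegrableOn (fun y : ℝ => (y : ℂ) * k' y) (Icc (-N) t) :=
      h.integrable'.ofReal.integrableOn.continuousOn_mul continuous_ofReal.continuousOn isCompact_Icc
    exact this.mono_set Ioc_subset_Icc_self
  rw [integral_add hk hyk]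
  simp_rw [mul_comm _ (k' _ : ℂ)]
  rw [h1]
  ring

/-- The function `x k(x)`, which arises from differentiating `e^{-iλx} k(x)` in `λ`. -/
theorem h1Fun_id_mul (h : TameFun N M k k') (hN : 0 ≤ N) :
    H1Fun N (4 * M) (fun x => (x : ℂ) * k x) (fun x => (k x : ℂ) + x * k' x) where
  cont := continuous_ofReal.mul (continuous_ofReal.comp h.cont)
  meas := (measurable_ofReal.comp h.cont.measurable).add
    (measurable_ofReal.mul (measurable_ofReal.comp h.meas))
  int := by
    have hk : IntegrableOn (fun y => (k y : ℂ)) (Ioc (-N) N) :=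
      (continuous_ofReal.comp h.cont).integrableOn_Ioc
    have : IntegrableOn (fun y : ℝ => (y : ℂ) * k' y) (Icc (-N) N) :=
      h.integrable'.ofReal.integrableOn.continuousOn_mul continuous_ofReal.continuousOn isCompact_Icc
    exact hk.add (this.mono_set Ioc_subset_Icc_self)
  prim t ht := by rw [setIntegral_ite_le ht, h.integral_id_mul ht.1.le]
  zero := by
    rw [h.integral_id_mul (by linarith), h.supp N (le_abs_self N), ofReal_zero, mul_zero]
  l2 := by
    have := h.xl2
    simp only [enorm_eq_nnnorm, nnnorm_mul, nnnorm_real] at this ⊢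
    refine this.trans ?_
    exact_mod_cast le_mul_of_one_le_left zero_le (by norm_num)
  l2' := by
    calc ∫⁻ x : ℝ, ‖(k x : ℂ) + x * k' x‖ₑ ^ 2
        ≤ ∫⁻ x, 2 * (‖k x‖ₑ ^ 2 + ‖x * k' x‖ₑ ^ 2) := by
          refine lintegral_mono fun x => (enorm_add_sq_le _ _).trans_eq ?_
          simp only [enorm_eq_nnnorm, nnnorm_mul, nnnorm_real]
      _ = 2 * ((∫⁻ x, ‖k x‖ₑ ^ 2) + ∫⁻ x, ‖x * k' x‖ₑ ^ 2) := by
          rw [lintegral_const_mul' _ _ (by simp), lintegral_add_left]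
          exact h.cont.measurable.enorm.pow_const 2
      _ ≤ 2 * (M + M) := by
          gcongr
          · exact h.l2
          · exact h.xl2'
      _ = _ := by push_cast; ring

end TameFun

/-- The three coefficients of `D`, with derivatives the coefficients of `D'`, are tame. -/
structure Tame (N : ℝ) (M : ℝ≥0) (D D' : Potential) : Prop where
  nonneg : 0 ≤ N
  c : TameFun N M D.c D'.c
  s : TameFun N M D.s D'.s
  q : TameFun N M D.q D'.q

namespace Tame

variable {N : ℝ} {M : ℝ≥0} {D D' : Potential}

theorem regular (h : Tame N M D D') : D.Regular :=
  ⟨h.c.cont, h.s.cont, h.q.cont, Potential.integrable_of_support h.c.cont h.c.supp,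
    Potential.integrable_of_support h.s.cont h.s.supp,
    Potential.integrable_of_support h.q.cont h.q.supp⟩

theorem supportedIn (h : Tame N M D D') : D.SupportedIn N := ⟨h.c.supp, h.s.supp, h.q.supp⟩

end Tame

/-- Pointwise bound, up to a constant and for `λ > 0`, of the coefficient matrix. -/
def Potential.mass (D : Potential) (x : ℝ) : ℝ := |D.c x| + |D.s x| + |D.q x|

theorem Potential.abs_kap_add_norm_off_le (D : Potential) {l : ℝ} (hl : 0 ≤ l) (x : ℝ) :
    |D.kap l x| + ‖D.off l x‖ ≤ D.mass x := by
  have h1 := eps_le_one hl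
  have h2 := (eps_pos l).le
  have h3 : ‖D.off l x‖ ≤ (|D.s x| + |D.q x|) / 4 := by
    rw [off, norm_mul, norm_exp_I, one_mul, amp, norm_div]
    have : ‖I * (eps l : ℂ) * D.s x + D.q x‖ ≤ |D.s x| + |D.q x| := by
      refine (norm_add_le _ _).trans ?_
      simp only [norm_mul, norm_I, norm_real, Real.norm_eq_abs, one_mul, abs_of_nonneg h2]
      nlinarith [abs_nonneg (D.s x)]
    have h4 : ‖(4 : ℂ)‖ = 4 := by norm_num
    rw [h4]
    gcongr
  have h4 : |D.kap l x| ≤ |D.c x| / 4 := by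
    rw [kap, abs_div, abs_mul, abs_of_nonneg h2, abs_of_pos (by norm_num : (0 : ℝ) < 4)]
    gcongr
    nlinarith [abs_nonneg (D.c x)]
  unfold mass
  linarith [abs_nonneg (D.c x), abs_nonneg (D.s x), abs_nonneg (D.q x)]

theorem Tame.lintegral_mass_le {N : ℝ} {M : ℝ≥0} {D D' : Potential} (h : Tame N M D D') :
    ∫⁻ x, ‖D.mass x‖ₑ ≤ 3 * M := by
  calc ∫⁻ x, ‖D.mass x‖ₑ ≤ ∫⁻ x, (‖D.c x‖ₑ + ‖D.s x‖ₑ + ‖D.q x‖ₑ) := by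
        refine lintegral_mono fun x => ?_
        have h1 : ‖D.mass x‖₊ ≤ ‖D.c x‖₊ + ‖D.s x‖₊ + ‖D.q x‖₊ := by
          rw [← NNReal.coe_le_coe]
          push_cast
          unfold Potential.mass
          rw [Real.norm_of_nonneg (by positivity)]
          rfl
        simp only [enorm_eq_nnnorm]
        exact_mod_cast h1
    _ = (∫⁻ x, ‖D.c x‖ₑ) + (∫⁻ x, ‖D.s x‖ₑ) + ∫⁻ x, ‖D.q x‖ₑ := by
        rw [lintegral_add_right _ h.q.cont.measurable.enorm,
          lintegral_add_right _ h.s.cont.measurable.enorm]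
    _ ≤ M + M + M := by
        gcongr
        · exact h.c.l1
        · exact h.s.l1
        · exact h.q.l1
    _ = _ := by ring

section

variable {ι : Type*}

/-- A family of amplitudes: `G` is bounded by `1`, and for `λ > 0` its `x`-derivative `G'` is bounded
by a multiple of the mass of the potential, an integrable function of `x` independent of `λ`. -/
structure Amplitude (D : ι → Potential) (C : ℝ≥0) (G G' : ι → ℝ → ℝ → ℂ) : Prop where
  deriv : ∀ i l x, HasDerivAt (G i l) (G' i l x) x
  cont : ∀ i, Continuous (Function.uncurry (G i))
  cont' : ∀ i l, Continuous (G' i l)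
  bound : ∀ i l x, ‖G i l x‖ ≤ 1
  bound' : ∀ i l x, 0 < l → ‖G' i l x‖ ≤ C * (D i).mass x

theorem Amplitude.mul {D : ι → Potential} {C₁ C₂ : ℝ≥0} {G₁ G₁' G₂ G₂' : ι → ℝ → ℝ → ℂ}
    (h₁ : Amplitude D C₁ G₁ G₁') (h₂ : Amplitude D C₂ G₂ G₂') :
    Amplitude D (C₁ + C₂) (fun i l x => G₁ i l x * G₂ i l x)
      (fun i l x => G₁' i l x * G₂ i l x + G₁ i l x * G₂' i l x) where
  deriv i l x := (h₁.deriv i l x).mul (h₂.deriv i l x)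
  cont i := (h₁.cont i).mul (h₂.cont i)
  cont' i l := ((h₁.cont' i l).mul ((h₂.cont i).uncurry_left l)).add
    (((h₁.cont i).uncurry_left l).mul (h₂.cont' i l))
  bound i l x := by
    rw [norm_mul]
    exact mul_le_one₀ (h₁.bound i l x) (norm_nonneg _) (h₂.bound i l x)
  bound' i l x hl := by
    refine (norm_add_le _ _).trans ?_
    rw [norm_mul, norm_mul]
    push_cast
    nlinarith [h₁.bound i l x, h₂.bound i l x, h₁.bound' i l x hl, h₂.bound' i l x hl,
      norm_nonneg (G₁ i l x), norm_nonneg (G₂ i l x), norm_nonneg (G₁' i l x),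
      norm_nonneg (G₂' i l x)]

theorem Amplitude.conj {D : ι → Potential} {C : ℝ≥0} {G G' : ι → ℝ → ℝ → ℂ}
    (h : Amplitude D C G G') :
    Amplitude D C (fun i l x => conj (G i l x)) (fun i l x => conj (G' i l x)) where
  deriv i l x := hasDerivAt_conj (h.deriv i l x)
  cont i := continuous_conj.comp (h.cont i)
  cont' i l := continuous_conj.comp (h.cont' i l)
  bound i l x := by simpa using h.bound i l x
  bound' i l x hl := by simpa using h.bound' i l x hl

variable {N : ι → ℝ} {M : ℝ≥0} {D D' : ι → Potential}

theorem amplitude_al (hD : ∀ i, Tame (N i) M (D i) (D' i)) :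
    Amplitude D 1 (fun i => (D i).al)
      (fun i l x => I * (D i).kap l x * (D i).al l x - conj ((D i).off l x) * (D i).be l x) where
  deriv i l x := ((hD i).regular.jost l).deriv_left x
  cont i := (hD i).supportedIn.continuous_al (hD i).regular (hD i).nonneg
  cont' i l := by
    have h1 := ((hD i).regular.jost l).continuous_left
    have h2 := ((hD i).regular.jost l).continuous_right
    have h3 := ((hD i).regular.admissible l).cont_left
    have h4 := continuous_conj.comp ((hD i).regular.admissible l).cont_right
    exact ((continuous_const.mul (continuous_ofReal.comp h3)).mul h1).sub (h4.mul h2)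
  bound i l x := ((hD i).regular.jost l).norm_left_le x
  bound' i l x hl := by
    rw [NNReal.coe_one, one_mul]
    exact (((hD i).regular.jost l).norm_deriv_left_le x).trans
      ((D i).abs_kap_add_norm_off_le hl.le x)

theorem amplitude_be (hD : ∀ i, Tame (N i) M (D i) (D' i)) :
    Amplitude D 1 (fun i => (D i).be)
      (fun i l x => (D i).off l x * (D i).al l x - I * (D i).kap l x * (D i).be l x) where
  deriv i l x := ((hD i).regular.jost l).deriv_right x
  cont i := (hD i).supportedIn.continuous_be (hD i).regular (hD i).nonneg
  cont' i l := by
    have h1 := ((hD i).regular.jost l).continuous_left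
    have h2 := ((hD i).regular.jost l).continuous_right
    have h3 := ((hD i).regular.admissible l).cont_left
    have h4 := ((hD i).regular.admissible l).cont_right
    exact (h4.mul h1).sub ((continuous_const.mul (continuous_ofReal.comp h3)).mul h2)
  bound i l x := ((hD i).regular.jost l).norm_right_le x
  bound' i l x hl := by
    rw [NNReal.coe_one, one_mul]
    exact (((hD i).regular.jost l).norm_deriv_right_le x).trans
      ((D i).abs_kap_add_norm_off_le hl.le x)

/-- An oscillatory integral of an `L²` function against an amplitude is in `L²` in `λ`. -/
theorem Amplitude.oscillatory (hD : ∀ i, Tame (N i) M (D i) (D' i)) {C : ℝ≥0}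
    {G G' : ι → ℝ → ℝ → ℂ} (h : Amplitude D C G G') {k : ι → ℝ → ℂ} (hk : ∀ i, Measurable (k i))
    {K : ℝ≥0} (hK : ∀ i, ∫⁻ x, ‖k i x‖ₑ ^ 2 ≤ K) (a b : ι → ℝ) :
    UL2 fun i l => ∫ x in Ioc (a i) (b i), k i x * exp (-(I * l * x)) * G i l x := by
  refine UL2.oscillatory hk hK h.deriv (fun i => (h.cont i).measurable) h.cont'
    (c := 1) (fun i l x _ => h.bound i l x) (m := fun i x => C * (D i).mass x)
    (M := C * (3 * M)) (fun i => ?_) (fun i => ?_) h.bound'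
  · have h1 := (hD i).c.cont
    have h2 := (hD i).s.cont
    have h3 := (hD i).q.cont
    have : Continuous fun x => C * (D i).mass x := by unfold Potential.mass; fun_prop
    exact this.measurable
  · simp_rw [enorm_mul]
    rw [lintegral_const_mul' _ _ (by simp)]
    push_cast
    gcongr
    · simp [enorm_eq_nnnorm]
    · exact (hD i).lintegral_mass_le

/-- An average, with weights bounded in `L¹`, of bounded functions of `λ`. -/
theorem UBdd.average {a b : ι → ℝ} {w : ι → ℝ → ℂ} (hw : ∀ i, Measurable (w i))
    {K : ℝ≥0} (hK : ∀ i, ∫⁻ x, ‖w i x‖ₑ ≤ K) {T : ι → ℝ → ℝ → ℂ}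
    (hT : ∀ i, Measurable (Function.uncurry (T i))) {c : ℝ≥0}
    (hc : ∀ i l x, ‖T i l x‖ ≤ c) :
    UBdd fun i l => ∫ x in Ioc (a i) (b i), w i x * T i l x := by
  refine ⟨fun i => ?_, c * K, fun i l _ => ?_⟩
  · have : StronglyMeasurable (Function.uncurry fun l x => w i x * T i l x) :=
      (((hw i).comp measurable_snd).mul (hT i)).stronglyMeasurable
    exact this.integral_prod_right.measurable
  · suffices hs : ‖∫ x in Ioc (a i) (b i), w i x * T i l x‖ₑ ≤ ((c * K : ℝ≥0) : ℝ≥0∞) from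
      enorm_le_coe.1 hs
    calc ‖∫ x in Ioc (a i) (b i), w i x * T i l x‖ₑ ≤ ∫⁻ x, c * ‖w i x‖ₑ := by
          refine (enorm_integral_le_lintegral_enorm _).trans
            ((setLIntegral_le_lintegral _ _).trans (lintegral_mono fun x => ?_))
          rw [enorm_mul, mul_comm]
          gcongr
          exact enorm_le_coe.2 (hc i l x)
      _ = c * ∫⁻ x, ‖w i x‖ₑ := lintegral_const_mul' _ _ (by simp)
      _ ≤ _ := by
          push_cast
          gcongr
          exact hK i

end

/-! ### Oscillatory integrals against the solution -/

section

variable {ι : Type*}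

theorem ubdd_of_le {f : ℝ → ℝ} (hf : Continuous f) (c : ℝ≥0) (h : ∀ l, 0 < l → |f l| ≤ c) :
    UBdd fun (_ : ι) l => (f l : ℂ) :=
  ⟨fun _ => (continuous_ofReal.comp hf).measurable, c, fun _ l hl => by simpa using h l hl⟩

theorem ubdd_const (c : ℂ) : UBdd fun (_ : ι) (_ : ℝ) => c :=
  ⟨fun _ => measurable_const, ‖c‖₊, fun _ _ _ => by simp⟩

theorem ul2_eps : UL2 fun (_ : ι) l => (eps l : ℂ) := by
  refine ⟨fun _ => (continuous_ofReal.comp continuous_eps).measurable,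
    (∫⁻ l : ℝ, ‖(1 + l ^ 2)⁻¹‖ₑ).toNNReal, fun i => ?_⟩
  rw [ENNReal.coe_toNNReal integrable_inv_one_add_sq.2.ne]
  refine (setLIntegral_mono' measurableSet_Ioi fun l hl => ?_).trans (setLIntegral_le_lintegral _ _)
  have hl' : 0 < l := hl
  have h1 := eps_mul_one_add_le hl'.le
  have h2 := eps_pos l
  have h3 : ‖(eps l : ℂ)‖₊ ^ 2 ≤ ‖(1 + l ^ 2)⁻¹‖₊ := by
    rw [← NNReal.coe_le_coe]
    push_cast
    rw [norm_real, Real.norm_of_nonneg h2.le, Real.norm_of_nonneg (by positivity),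
      ← one_div, le_div_iff₀ (by positivity)]
    nlinarith [mul_nonneg h2.le hl'.le, mul_self_nonneg (eps l)]
  simp only [enorm_eq_nnnorm]
  exact_mod_cast h3

theorem ul2_of_le_eps {f : ℝ → ℝ} (hf : Continuous f) (h : ∀ l, 0 < l → |f l| ≤ 2 * eps l) :
    UL2 fun (_ : ι) l => (f l : ℂ) :=
  (ul2_eps (ι := ι)).mono (fun _ => (continuous_ofReal.comp hf).measurable) 2 fun i l hl => by
    simpa [abs_of_pos (eps_pos l)] using h l hl

theorem abs_mul_eps_le {l : ℝ} (hl : 0 < l) : |l * eps l| ≤ 1 := by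
  rw [abs_of_pos (mul_pos hl (eps_pos l))]
  nlinarith [eps_mul_one_add_le hl.le, eps_pos l]

theorem abs_mul_deps_le {l : ℝ} (hl : 0 < l) : |l * deps l| ≤ 2 * eps l := by
  rw [abs_mul, abs_of_pos hl]
  nlinarith [abs_deps_mul_le hl.le, abs_nonneg (deps l)]

theorem ubdd_eps : UBdd fun (_ : ι) l => (eps l : ℂ) :=
  ubdd_of_le continuous_eps 1 fun l hl => by
    rw [abs_of_pos (eps_pos l)]; exact eps_le_one hl.le

theorem ubdd_mul_eps : UBdd fun (_ : ι) l => ((l * eps l : ℝ) : ℂ) :=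
  ubdd_of_le (continuous_id.mul continuous_eps) 1 fun _ hl => abs_mul_eps_le hl

theorem ubdd_deps : UBdd fun (_ : ι) l => (deps l : ℂ) :=
  ubdd_of_le continuous_deps 2 fun l hl => (abs_deps_le hl.le).trans (by
    have := eps_le_one hl.le
    push_cast; linarith)

theorem ubdd_mul_deps : UBdd fun (_ : ι) l => ((l * deps l : ℝ) : ℂ) :=
  ubdd_of_le (continuous_id.mul continuous_deps) 2 fun l hl => (abs_mul_deps_le hl).trans (by
    have := eps_le_one hl.le
    push_cast; linarith)

theorem ul2_deps : UL2 fun (_ : ι) l => (deps l : ℂ) :=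
  ul2_of_le_eps continuous_deps fun _ hl => abs_deps_le hl.le

theorem ul2_mul_deps : UL2 fun (_ : ι) l => ((l * deps l : ℝ) : ℂ) :=
  ul2_of_le_eps (continuous_id.mul continuous_deps) fun _ hl => abs_mul_deps_le hl

end

theorem integral_linear_combination {a b : ℝ} {f₁ f₂ f₃ : ℝ → ℂ} (h₁ : Continuous f₁)
    (h₂ : Continuous f₂) (h₃ : Continuous f₃) (c₁ c₂ c₃ : ℂ) :
    ∫ x in Ioc a b, (c₁ * f₁ x + c₂ * f₂ x + c₃ * f₃ x)
      = c₁ * (∫ x in Ioc a b, f₁ x) + c₂ * (∫ x in Ioc a b, f₂ x) + c₃ * ∫ x in Ioc a b, f₃ x := by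
  have i₁ : IntegrableOn (fun x => c₁ * f₁ x) (Ioc a b) := (h₁.const_mul _).integrableOn_Ioc
  have i₂ : IntegrableOn (fun x => c₂ * f₂ x) (Ioc a b) := (h₂.const_mul _).integrableOn_Ioc
  have i₃ : IntegrableOn (fun x => c₃ * f₃ x) (Ioc a b) := (h₃.const_mul _).integrableOn_Ioc
  have i₁₂ : IntegrableOn (fun x => c₁ * f₁ x + c₂ * f₂ x) (Ioc a b) := i₁.add i₂
  rw [integral_add i₁₂ i₃, integral_add i₁ i₂, integral_const_mul, integral_const_mul,
    integral_const_mul]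

/-- The integral equation for the second component of the solution. -/
theorem Tame.be_eq {N : ℝ} {M : ℝ≥0} {D D' : Potential} (h : Tame N M D D') (l x : ℝ) :
    D.be l x = -(I * eps l / 4 * (∫ y in Ioc x N, D.s y * exp (-(I * l * y)) * D.al l y)
      + 1 / 4 * (∫ y in Ioc x N, D.q y * exp (-(I * l * y)) * D.al l y)
      + -(I * eps l / 4) * ∫ y in Ioc x N, D.c y * D.be l y) := by
  have hj := h.regular.jost l
  have ha := hj.continuous_left
  have hb := hj.continuous_right
  have hc := h.c.cont
  have hs := h.s.cont
  have hq := h.q.cont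
  have hoff := (h.regular.admissible l).cont_right
  have hkap := (h.regular.admissible l).cont_left
  have := Potential.eq_sub_integral_of_support (N := N) hj.deriv_right (by fun_prop) hj.lim_right
    (fun x hx => by simp [h.supportedIn.kap_eq_zero _ hx, h.supportedIn.off_eq_zero _ hx]) x
  rw [this, zero_sub, ← integral_linear_combination (by fun_prop) (by fun_prop) (by fun_prop)]
  congr 2
  ext y
  simp only [Potential.off, Potential.amp, Potential.kap]
  push_cast
  ring

/-- Integration by parts in an oscillatory integral. -/
theorem H1Fun.mul_integral_eq {N : ℝ} {K : ℝ≥0} {k k' G G' : ℝ → ℂ} (hk : H1Fun N K k k')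
    (hG : ∀ x, HasDerivAt G (G' x) x) (hG' : Continuous G') (l : ℝ) :
    l * ∫ x in Ioc (-N) N, k x * exp (-(I * l * x)) * G x
      = -I * ((∫ x in Ioc (-N) N, k' x * exp (-(I * l * x)) * G x)
        + ∫ x in Ioc (-N) N, k x * exp (-(I * l * x)) * G' x) := by
  have hGc : Continuous G := continuous_iff_continuousAt.2 fun x => (hG x).continuousAt
  have hkc := hk.cont
  have he : ∀ x : ℝ, HasDerivAt (fun x : ℝ => exp (-(I * l * x))) (exp (-(I * l * x)) * -(I * l)) x := by
    intro x
    have : HasDerivAt (fun x : ℝ => -(I * l * (x : ℂ))) (-(I * l)) x := by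
      convert! ((hasDerivAt_id (x : ℝ)).ofReal_comp.const_mul (I * (l : ℂ))).neg using 1
      simp
    exact this.cexp
  have h1 := integral_mul_eq_sub_integral_primitive_mul hk.int (fun x => (he x).mul (hG x))
    (by fun_prop)
  have h2 : ∫ t in Ioc (-N) N, (∫ y in Ioc (-N) N, if y ≤ t then k' y else 0) *
      (exp (-(I * l * t)) * -(I * l) * G t + exp (-(I * l * t)) * G' t)
      = ∫ t in Ioc (-N) N, (-(I * l) * (k t * exp (-(I * l * t)) * G t)
        + 1 * (k t * exp (-(I * l * t)) * G' t) + 0 * 0) := by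
    refine setIntegral_congr_fun measurableSet_Ioc fun t ht => ?_
    simp only [hk.prim t ht]
    ring
  rw [h2, hk.zero, integral_linear_combination (by fun_prop) (by fun_prop) continuous_const] at h1
  have h3 : ∫ x in Ioc (-N) N, k' x * exp (-(I * l * x)) * G x
      = ∫ y in Ioc (-N) N, k' y * (exp (-(I * l * y)) * G y) := by
    simp only [mul_assoc]
  simp only [Pi.mul_apply] at h1
  rw [h3, h1]
  linear_combination ((l : ℂ) * ∫ x in Ioc (-N) N, k x * exp (-(I * l * x)) * G x) * I_mul_I

section

variable {ι : Type*} {N : ι → ℝ} {M : ℝ≥0} {D D' : ι → Potential}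

/-- The solution decays at `+∞` in `λ`, in the mean square sense and uniformly in `x`. -/
theorem ul2_be (hD : ∀ i, Tame (N i) M (D i) (D' i)) :
    UL2 fun (p : ι × ℝ) l => (D p.1).be l p.2 := by
  have hD' : ∀ p : ι × ℝ, Tame (N p.1) M (D p.1) (D' p.1) := fun p => hD p.1
  have h1 := (amplitude_al hD').oscillatory hD' (k := fun p x => ((D p.1).s x : ℂ))
    (fun p => (hD p.1).s.cont.measurable.complex_ofReal) (K := M)
    (fun p => ((hD p.1).s.h1Fun (hD p.1).nonneg).l2) (fun p => p.2) (fun p => N p.1)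
  have h2 := (amplitude_al hD').oscillatory hD' (k := fun p x => ((D p.1).q x : ℂ))
    (fun p => (hD p.1).q.cont.measurable.complex_ofReal) (K := M)
    (fun p => ((hD p.1).q.h1Fun (hD p.1).nonneg).l2) (fun p => p.2) (fun p => N p.1)
  have h3 := UBdd.average (a := fun p : ι × ℝ => p.2) (b := fun p => N p.1)
    (w := fun p x => ((D p.1).c x : ℂ))
    (fun p => (hD p.1).c.cont.measurable.complex_ofReal) (K := M)
    (fun p => by simpa [enorm_eq_nnnorm] using (hD p.1).c.l1)
    (fun p => ((amplitude_be hD').cont p).measurable) (c := 1) (fun p => (amplitude_be hD').bound p)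
  have h4 := ((((ubdd_const (I / 4)).mul ubdd_eps).mul_UL2 h1).add (h2.const_mul (1 / 4))).add
    (((ubdd_const (-(I / 4))).mul h3).mul_UL2 ul2_eps)
  refine h4.neg.mono (fun p => ?_) 1 fun p l hl => le_of_eq ?_
  · exact ((amplitude_be hD').cont p |>.uncurry_right p.2).measurable
  · rw [NNReal.coe_one, one_mul, (hD p.1).be_eq l p.2]
    congr 1
    ring

/-- The structure of the `x`-derivative of an amplitude, up to terms that do not oscillate:
`G' = i c κ G + P̄ T`. -/
theorem mul_oscillatory_eq (hD : ∀ i, Tame (N i) M (D i) (D' i)) {C : ℝ≥0}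
    {G G' : ι → ℝ → ℝ → ℂ} (h : Amplitude D C G G') {c₀ : ℂ} {T : ι → ℝ → ℝ → ℂ}
    (hT : ∀ i, Continuous (Function.uncurry (T i)))
    (hGT : ∀ i l x, G' i l x = I * c₀ * (D i).kap l x * G i l x + conj ((D i).off l x) * T i l x)
    {K : ℝ≥0} {k k' : ι → ℝ → ℂ} (hk : ∀ i, H1Fun (N i) K (k i) (k' i)) (i : ι) (l : ℝ) :
    l * ∫ x in Ioc (-N i) (N i), k i x * exp (-(I * l * x)) * G i l x
      = -I * ((∫ x in Ioc (-N i) (N i), k' i x * exp (-(I * l * x)) * G i l x)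
        + (I * c₀ / 4 * eps l * (∫ x in Ioc (-N i) (N i),
            (k i x * (D i).c x) * exp (-(I * l * x)) * G i l x)
          + -(I / 4) * eps l * (∫ x in Ioc (-N i) (N i), (k i x * (D i).s x) * T i l x)
          + 1 / 4 * ∫ x in Ioc (-N i) (N i), (k i x * (D i).q x) * T i l x)) := by
  rw [(hk i).mul_integral_eq (h.deriv i l) (h.cont' i l)]
  have hkc := (hk i).cont
  have hc := (hD i).c.cont
  have hs := (hD i).s.cont
  have hq := (hD i).q.cont
  have hGc := (h.cont i).uncurry_left l
  have hTc := (hT i).uncurry_left l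
  rw [← integral_linear_combination (by fun_prop) (by fun_prop) (by fun_prop)]
  congr 3
  ext x
  rw [hGT]
  have e : exp (-(I * l * x)) * conj ((D i).off l x)
      = (-(I * eps l * (D i).s x) + (D i).q x) / 4 := by
    have e1 : conj ((D i).off l x) = exp (I * l * x) * ((-(I * eps l * (D i).s x) + (D i).q x) / 4) := by
      simp only [Potential.off, Potential.amp, map_mul, map_div₀, map_add, conj_I, conj_ofReal,
        ← exp_conj, map_neg, map_ofNat]
      congr 2 <;> ring
    rw [e1, ← mul_assoc, ← Complex.exp_add, neg_add_cancel, Complex.exp_zero, one_mul]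
  simp only [Potential.kap]
  push_cast
  linear_combination (k i x * T i l x) * e

/-- Multiplication by `λ` costs a derivative of `k`. -/
theorem Amplitude.ul2_mul_oscillatory (hD : ∀ i, Tame (N i) M (D i) (D' i)) {C : ℝ≥0}
    {G G' : ι → ℝ → ℝ → ℂ} (h : Amplitude D C G G') {c₀ : ℂ} {T : ι → ℝ → ℝ → ℂ}
    (hT : ∀ i, Continuous (Function.uncurry (T i)))
    (hGT : ∀ i l x, G' i l x = I * c₀ * (D i).kap l x * G i l x + conj ((D i).off l x) * T i l x)
    (hT2 : UL2 fun (p : ι × ℝ) l => T p.1 l p.2)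
    {K : ℝ≥0} {k k' : ι → ℝ → ℂ} (hk : ∀ i, H1Fun (N i) K (k i) (k' i)) :
    UL2 fun i l => l * ∫ x in Ioc (-N i) (N i), k i x * exp (-(I * l * x)) * G i l x := by
  simp_rw [mul_oscillatory_eq hD h hT hGT hk]
  obtain ⟨L, hL⟩ := hT2.2
  have h1 := h.oscillatory hD (fun i => (hk i).meas) (fun i => (hk i).l2') (fun i => -N i) N
  have h2 := h.oscillatory hD (k := fun i x => k i x * (D i).c x)
    (fun i => (hk i).cont.measurable.mul (hD i).c.cont.measurable.complex_ofReal)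
    (K := M ^ 2 * K) (fun i => by
      calc ∫⁻ x, ‖k i x * (D i).c x‖ₑ ^ 2 ≤ ∫⁻ x, (M : ℝ≥0∞) ^ 2 * ‖k i x‖ₑ ^ 2 := by
            refine lintegral_mono fun x => ?_
            rw [enorm_mul, mul_pow, mul_comm]
            gcongr
            exact enorm_le_coe.2 (NNReal.coe_le_coe.1 (by simpa using (hD i).c.sup x))
        _ = (M : ℝ≥0∞) ^ 2 * ∫⁻ x, ‖k i x‖ₑ ^ 2 := lintegral_const_mul' _ _ (by simp)
        _ ≤ _ := by
            push_cast
            gcongr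
            exact (hk i).l2) (fun i => -N i) N
  have hprod : ∀ (i) (g : ℝ → ℝ), (Continuous g) → (∫⁻ x, ‖g x‖ₑ ^ 2 ≤ M) →
      ∫⁻ x, ‖k i x * g x‖ₑ ≤ ((K + M : ℝ≥0) : ℝ≥0∞) := by
    intro i g hg hg2
    calc ∫⁻ x, ‖k i x * g x‖ₑ ≤ ∫⁻ x, (‖k i x‖ₑ ^ 2 + ‖g x‖ₑ ^ 2) := by
          refine lintegral_mono fun x => (enorm_mul_le_sq_add_sq _ _).trans_eq ?_
          simp [enorm_eq_nnnorm]
      _ = (∫⁻ x, ‖k i x‖ₑ ^ 2) + ∫⁻ x, ‖g x‖ₑ ^ 2 :=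
          lintegral_add_right _ (hg.measurable.enorm.pow_const 2)
      _ ≤ _ := by
          push_cast
          gcongr
          exact (hk i).l2
  have h3 := UL2.average (a := fun i => -N i) (b := N) (w := fun i x => k i x * (D i).s x)
    (fun i => (hk i).cont.measurable.mul (hD i).s.cont.measurable.complex_ofReal)
    (fun i => hprod i _ (hD i).s.cont (hD i).s.l2)
    (fun i => (hT i).measurable) (K := L) (fun i x => hL (i, x))
  have h4 := UL2.average (a := fun i => -N i) (b := N) (w := fun i x => k i x * (D i).q x)
    (fun i => (hk i).cont.measurable.mul (hD i).q.cont.measurable.complex_ofReal)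
    (fun i => hprod i _ (hD i).q.cont (hD i).q.l2)
    (fun i => (hT i).measurable) (K := L) (fun i x => hL (i, x))
  exact (h1.add (((((ubdd_const (I * c₀ / 4)).mul ubdd_eps).mul_UL2 h2).add
    (((ubdd_const (-(I / 4))).mul ubdd_eps).mul_UL2 h3)).add (h4.const_mul (1 / 4)))).const_mul (-I)

/-- The pointwise version of `Amplitude.ul2_mul_oscillatory`, for tame coefficients. -/
theorem Amplitude.ubdd_mul_oscillatory (hD : ∀ i, Tame (N i) M (D i) (D' i)) {C : ℝ≥0}
    {G G' : ι → ℝ → ℝ → ℂ} (h : Amplitude D C G G') {c₀ : ℂ} {T : ι → ℝ → ℝ → ℂ}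
    (hT : ∀ i, Continuous (Function.uncurry (T i)))
    (hGT : ∀ i l x, G' i l x = I * c₀ * (D i).kap l x * G i l x + conj ((D i).off l x) * T i l x)
    (hT1 : ∀ i l x, ‖T i l x‖ ≤ 1)
    {k k' : ι → ℝ → ℝ} (hk : ∀ i, TameFun (N i) M (k i) (k' i)) :
    UBdd fun i l => l * ∫ x in Ioc (-N i) (N i), k i x * exp (-(I * l * x)) * G i l x := by
  have hk1 := fun i => (hk i).h1Fun (hD i).nonneg
  simp_rw [mul_oscillatory_eq hD h hT hGT hk1]
  have he : Continuous fun p : ℝ × ℝ => exp (-(I * p.1 * p.2)) := by fun_prop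
  have heG : ∀ i, Measurable (Function.uncurry fun (l x : ℝ) => exp (-(I * l * x)) * G i l x) :=
    fun i => (he.mul (h.cont i)).measurable
  have heb : ∀ (i) (l x : ℝ), ‖exp (-(I * l * x)) * G i l x‖ ≤ ((1 : ℝ≥0) : ℝ) := fun i l x => by
    rw [norm_mul, Potential.norm_exp_I, one_mul]
    exact h.bound i l x
  have hprod : ∀ (i) (g : ℝ → ℝ), (Continuous g) → (∀ x, |g x| ≤ M) →
      ∫⁻ x, ‖(k i x : ℂ) * g x‖ₑ ≤ ((M * M : ℝ≥0) : ℝ≥0∞) := by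
    intro i g hg hg2
    calc ∫⁻ x, ‖(k i x : ℂ) * g x‖ₑ ≤ ∫⁻ x, (M : ℝ≥0∞) * ‖k i x‖ₑ := by
          refine lintegral_mono fun x => ?_
          rw [enorm_mul, mul_comm]
          gcongr
          · exact enorm_le_coe.2 (NNReal.coe_le_coe.1 (by simpa using hg2 x))
          · simp [enorm_eq_nnnorm]
      _ = (M : ℝ≥0∞) * ∫⁻ x, ‖k i x‖ₑ := lintegral_const_mul' _ _ (by simp)
      _ ≤ _ := by
          push_cast
          gcongr
          exact (hk i).l1
  have h1 := UBdd.average (a := fun i => -N i) (b := N) (w := fun i x => (k' i x : ℂ))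
    (fun i => (hk i).meas.complex_ofReal)
    (fun i => by simpa [enorm_eq_nnnorm] using (hk i).l1') heG heb
  have h2 := UBdd.average (a := fun i => -N i) (b := N) (w := fun i x => (k i x : ℂ) * (D i).c x)
    (fun i => (hk1 i).cont.measurable.mul (hD i).c.cont.measurable.complex_ofReal)
    (fun i => hprod i _ (hD i).c.cont (hD i).c.sup) heG heb
  have h3 := UBdd.average (a := fun i => -N i) (b := N) (w := fun i x => (k i x : ℂ) * (D i).s x)
    (fun i => (hk1 i).cont.measurable.mul (hD i).s.cont.measurable.complex_ofReal)
    (fun i => hprod i _ (hD i).s.cont (hD i).s.sup) (fun i => (hT i).measurable) (c := 1) hT1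
  have h4 := UBdd.average (a := fun i => -N i) (b := N) (w := fun i x => (k i x : ℂ) * (D i).q x)
    (fun i => (hk1 i).cont.measurable.mul (hD i).q.cont.measurable.complex_ofReal)
    (fun i => hprod i _ (hD i).q.cont (hD i).q.sup) (fun i => (hT i).measurable) (c := 1) hT1
  simp_rw [← mul_assoc] at h1 h2
  exact (ubdd_const (-I)).mul (h1.add (((((ubdd_const (I * c₀ / 4)).mul ubdd_eps).mul h2).add
    (((ubdd_const (-(I / 4))).mul ubdd_eps).mul h3)).add ((ubdd_const (1 / 4)).mul h4)))

end

/-! ### Uniform bounds for the scattering data and the reflection coefficient -/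

section

variable {ι : Type*} {N : ι → ℝ} {M : ℝ≥0} {D D' : ι → Potential}

/-- The amplitude `α` has the structure required by `mul_oscillatory_eq`, with `T = -β`. -/
theorem amplitude_al_deriv_eq (i : ι) (l x : ℝ) :
    I * (D i).kap l x * (D i).al l x - conj ((D i).off l x) * (D i).be l x
      = I * 1 * (D i).kap l x * (D i).al l x + conj ((D i).off l x) * -(D i).be l x := by ring

theorem UL2.of_norm_le {κ : Type*} {F G : κ → ℝ → ℂ} (hF : UL2 F) (hG : ∀ i, Measurable (G i))
    (h : ∀ i l, ‖G i l‖ ≤ ‖F i l‖) : UL2 G :=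
  hF.mono hG 1 fun i l _ => by simpa using h i l

/-- The integral equation for `b`, multiplied by `λ`. -/
theorem mul_b_eq (hD : ∀ i, Tame (N i) M (D i) (D' i)) (i : ι) (l : ℝ) :
    l * (D i).b l = -(I / 4 * eps l *
        (l * ∫ y in Ioc (-N i) (N i), (D i).s y * exp (-(I * l * y)) * (D i).al l y)
      + 1 / 4 * (l * ∫ y in Ioc (-N i) (N i), (D i).q y * exp (-(I * l * y)) * (D i).al l y)
      + -(I / 4) * ((l * eps l : ℝ) : ℂ) * ∫ y in Ioc (-N i) (N i), (D i).c y * (D i).be l y) := by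
  rw [← (hD i).supportedIn.be_neg (hD i).regular, (hD i).be_eq]
  push_cast
  ring

theorem ul2_b (hD : ∀ i, Tame (N i) M (D i) (D' i)) : UL2 fun i l => (D i).b l := by
  have := (ul2_be hD).comp fun i => (i, -N i)
  simpa only [fun i l => (hD i).supportedIn.be_neg (hD i).regular l] using this

theorem ul2_mul_b (hD : ∀ i, Tame (N i) M (D i) (D' i)) : UL2 fun i (l : ℝ) => l * (D i).b l := by
  simp_rw [mul_b_eq hD]
  have hbe := ul2_be hD
  have hbeK := hbe.2
  obtain ⟨K, hK⟩ := hbeK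
  have hT : ∀ i, Continuous (Function.uncurry fun l x => -(D i).be l x) :=
    fun i => ((amplitude_be hD).cont i).neg
  have h1 := (amplitude_al hD).ul2_mul_oscillatory hD hT amplitude_al_deriv_eq hbe.neg
    (fun i => (hD i).s.h1Fun (hD i).nonneg)
  have h2 := (amplitude_al hD).ul2_mul_oscillatory hD hT amplitude_al_deriv_eq hbe.neg
    (fun i => (hD i).q.h1Fun (hD i).nonneg)
  have h3 := UL2.average (a := fun i => -N i) (b := N) (w := fun i x => ((D i).c x : ℂ))
    (fun i => (hD i).c.cont.measurable.complex_ofReal) (M := M)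
    (fun i => by simpa [enorm_eq_nnnorm] using (hD i).c.l1)
    (fun i => ((amplitude_be hD).cont i).measurable) (K := K) (fun i x => hK (i, x))
  exact (((((ubdd_const (I / 4)).mul ubdd_eps).mul_UL2 h1).add (h2.const_mul (1 / 4))).add
    (((ubdd_const (-(I / 4))).mul ubdd_mul_eps).mul_UL2 h3)).neg

theorem ubdd_mul_b (hD : ∀ i, Tame (N i) M (D i) (D' i)) : UBdd fun i (l : ℝ) => l * (D i).b l := by
  simp_rw [mul_b_eq hD]
  have hT : ∀ i, Continuous (Function.uncurry fun l x => -(D i).be l x) :=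
    fun i => ((amplitude_be hD).cont i).neg
  have hT1 : ∀ i l x, ‖-(D i).be l x‖ ≤ 1 := fun i l x => by
    rw [norm_neg]; exact (amplitude_be hD).bound i l x
  have h1 := (amplitude_al hD).ubdd_mul_oscillatory hD hT amplitude_al_deriv_eq hT1
    (fun i => (hD i).s)
  have h2 := (amplitude_al hD).ubdd_mul_oscillatory hD hT amplitude_al_deriv_eq hT1
    (fun i => (hD i).q)
  have h3 := UBdd.average (a := fun i => -N i) (b := N) (w := fun i x => ((D i).c x : ℂ))
    (fun i => (hD i).c.cont.measurable.complex_ofReal) (K := M)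
    (fun i => by simpa [enorm_eq_nnnorm] using (hD i).c.l1)
    (fun i => ((amplitude_be hD).cont i).measurable) (c := 1) (amplitude_be hD).bound
  exact (((((ubdd_const (I / 4)).mul ubdd_eps).mul h1).add ((ubdd_const (1 / 4)).mul h2)).add
    (((ubdd_const (-(I / 4))).mul ubdd_mul_eps).mul h3)).neg

/-- An integral against `D.doff` splits into oscillatory integrals with profiles `x s`, `x q`, `s`. -/
theorem integral_doff_eq (hD : ∀ i, Tame (N i) M (D i) (D' i)) {G : ι → ℝ → ℝ → ℂ}
    (hG : ∀ i, Continuous (Function.uncurry (G i))) (i : ι) (l : ℝ) :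
    ∫ x in Ioc (-N i) (N i), (D i).doff l x * G i l x
      = 1 / 4 * eps l * (∫ x in Ioc (-N i) (N i), (x * (D i).s x) * exp (-(I * l * x)) * G i l x)
      + -(I / 4) * (∫ x in Ioc (-N i) (N i), (x * (D i).q x) * exp (-(I * l * x)) * G i l x)
      + I / 4 * deps l * ∫ x in Ioc (-N i) (N i), (D i).s x * exp (-(I * l * x)) * G i l x := by
  have hs := (hD i).s.cont
  have hq := (hD i).q.cont
  have hGc := (hG i).uncurry_left l
  rw [← integral_linear_combination (by fun_prop) (by fun_prop) (by fun_prop)]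
  congr 1
  ext x
  simp only [Potential.doff, Potential.amp]
  linear_combination
    (-(x : ℂ) * exp (-(I * l * x)) * eps l * (D i).s x * G i l x / 4) * I_mul_I

theorem Amplitude.ul2_integral_doff (hD : ∀ i, Tame (N i) M (D i) (D' i)) {C : ℝ≥0}
    {G G' : ι → ℝ → ℝ → ℂ} (h : Amplitude D C G G') :
    UL2 fun i l => ∫ x in Ioc (-N i) (N i), (D i).doff l x * G i l x := by
  simp_rw [integral_doff_eq hD h.cont]
  have h1 := h.oscillatory hD
    (fun i => ((hD i).s.h1Fun_id_mul (hD i).nonneg).cont.measurable)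
    (fun i => ((hD i).s.h1Fun_id_mul (hD i).nonneg).l2) (fun i => -N i) N
  have h2 := h.oscillatory hD
    (fun i => ((hD i).q.h1Fun_id_mul (hD i).nonneg).cont.measurable)
    (fun i => ((hD i).q.h1Fun_id_mul (hD i).nonneg).l2) (fun i => -N i) N
  have h3 := h.oscillatory hD
    (fun i => ((hD i).s.h1Fun (hD i).nonneg).cont.measurable)
    (fun i => ((hD i).s.h1Fun (hD i).nonneg).l2) (fun i => -N i) N
  exact ((((ubdd_const (1 / 4)).mul ubdd_eps).mul_UL2 h1).add (h2.const_mul _)).add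
    (((ubdd_const (I / 4)).mul ubdd_deps).mul_UL2 h3)

theorem Amplitude.ul2_mul_integral_doff (hD : ∀ i, Tame (N i) M (D i) (D' i)) {C : ℝ≥0}
    {G G' : ι → ℝ → ℝ → ℂ} (h : Amplitude D C G G') {c₀ : ℂ} {T : ι → ℝ → ℝ → ℂ}
    (hT : ∀ i, Continuous (Function.uncurry (T i)))
    (hGT : ∀ i l x, G' i l x = I * c₀ * (D i).kap l x * G i l x + conj ((D i).off l x) * T i l x)
    (hT2 : UL2 fun (p : ι × ℝ) l => T p.1 l p.2) :
    UL2 fun i (l : ℝ) => l * ∫ x in Ioc (-N i) (N i), (D i).doff l x * G i l x := by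
  have h1 := h.ul2_mul_oscillatory hD hT hGT hT2 (fun i => (hD i).s.h1Fun_id_mul (hD i).nonneg)
  have h2 := h.ul2_mul_oscillatory hD hT hGT hT2 (fun i => (hD i).q.h1Fun_id_mul (hD i).nonneg)
  have h3 := h.oscillatory hD
    (fun i => ((hD i).s.h1Fun (hD i).nonneg).cont.measurable)
    (fun i => ((hD i).s.h1Fun (hD i).nonneg).l2) (fun i => -N i) N
  have := ((((ubdd_const (1 / 4)).mul ubdd_eps).mul_UL2 h1).add (h2.const_mul (-(I / 4)))).add
    (((ubdd_const (I / 4)).mul ubdd_mul_deps).mul_UL2 h3)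
  convert! this using 3 with i l
  rw [integral_doff_eq hD h.cont]
  push_cast
  ring

theorem ubdd_integral_c_mul (hD : ∀ i, Tame (N i) M (D i) (D' i)) {C : ℝ≥0}
    {G G' : ι → ℝ → ℝ → ℂ} (h : Amplitude D C G G') :
    UBdd fun i l => ∫ x in Ioc (-N i) (N i), (D i).c x * G i l x :=
  UBdd.average (a := fun i => -N i) (b := N) (w := fun i x => ((D i).c x : ℂ))
    (fun i => (hD i).c.cont.measurable.complex_ofReal) (K := M)
    (fun i => by simpa [enorm_eq_nnnorm] using (hD i).c.l1)
    (fun i => (h.cont i).measurable) (c := 1) h.bound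

theorem continuous_doff (hD : ∀ i, Tame (N i) M (D i) (D' i)) (i : ι) (l : ℝ) :
    Continuous ((D i).doff l) := by
  have hs := (hD i).s.cont
  have hq := (hD i).q.cont
  unfold Potential.doff Potential.amp
  fun_prop

theorem d11_eq (hD : ∀ i, Tame (N i) M (D i) (D' i)) (i : ι) (l : ℝ) :
    (D i).d11 (N i) l = I / 4 * deps l *
        ((∫ x in Ioc (-N i) (N i), (D i).c x * (conj ((D i).al l x) * (D i).al l x))
        - ∫ x in Ioc (-N i) (N i), (D i).c x * (conj ((D i).be l x) * (D i).be l x))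
      + (∫ x in Ioc (-N i) (N i), (D i).doff l x * (conj ((D i).be l x) * (D i).al l x))
      - conj (∫ x in Ioc (-N i) (N i), (D i).doff l x * (conj ((D i).be l x) * (D i).al l x)) := by
  have hc := (hD i).c.cont
  have ha := ((hD i).regular.jost l).continuous_left
  have hb := ((hD i).regular.jost l).continuous_right
  have hca := continuous_conj.comp ha
  have hcb := continuous_conj.comp hb
  have hd := continuous_doff hD i l
  have hcd := continuous_conj.comp hd
  simp only [Function.comp_def] at hca hcb hcd
  have e1 := integral_linear_combination (a := -N i) (b := N i)
    (f₁ := fun x => ((D i).c x : ℂ) * (conj ((D i).al l x) * (D i).al l x)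
      - (D i).c x * (conj ((D i).be l x) * (D i).be l x))
    (f₂ := fun x => (D i).doff l x * (conj ((D i).be l x) * (D i).al l x))
    (f₃ := fun x => conj ((D i).doff l x * (conj ((D i).be l x) * (D i).al l x)))
    (by fun_prop) (by fun_prop) (by simp only [map_mul, conj_conj]; fun_prop)
    (I / 4 * deps l) 1 (-1)
  rw [integral_sub (Continuous.integrableOn_Ioc (by fun_prop))
    (Continuous.integrableOn_Ioc (by fun_prop)), integral_conj] at e1
  rw [Potential.d11]
  calc _ = _ := ?_
    _ = _ := e1
    _ = _ := by ring
  congr 1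
  ext x
  simp only [Potential.dkap, map_mul, conj_conj]
  push_cast
  ring

theorem d21_eq (hD : ∀ i, Tame (N i) M (D i) (D' i)) (i : ι) (l : ℝ) :
    (D i).d21 (N i) l = -(I / 2) * deps l *
        (∫ x in Ioc (-N i) (N i), (D i).c x * ((D i).al l x * (D i).be l x))
      + (∫ x in Ioc (-N i) (N i), (D i).doff l x * ((D i).al l x * (D i).al l x))
      + conj (∫ x in Ioc (-N i) (N i),
          (D i).doff l x * (conj ((D i).be l x) * conj ((D i).be l x))) := by
  have hc := (hD i).c.cont
  have ha := ((hD i).regular.jost l).continuous_left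
  have hb := ((hD i).regular.jost l).continuous_right
  have hd := continuous_doff hD i l
  have hcd := continuous_conj.comp hd
  simp only [Function.comp_def] at hcd
  have e1 := integral_linear_combination (a := -N i) (b := N i)
    (f₁ := fun x => ((D i).c x : ℂ) * ((D i).al l x * (D i).be l x))
    (f₂ := fun x => (D i).doff l x * ((D i).al l x * (D i).al l x))
    (f₃ := fun x => conj ((D i).doff l x * (conj ((D i).be l x) * conj ((D i).be l x))))
    (by fun_prop) (by fun_prop) (by simp only [map_mul, conj_conj]; fun_prop)
    (-(I / 2) * deps l) 1 1
  rw [integral_conj, one_mul, one_mul] at e1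
  rw [Potential.d21, ← e1]
  congr 1
  ext x
  simp only [Potential.dkap, map_mul, conj_conj]
  push_cast
  ring

theorem ul2_d11 (hD : ∀ i, Tame (N i) M (D i) (D' i)) : UL2 fun i l => (D i).d11 (N i) l := by
  simp_rw [d11_eq hD]
  have ha := amplitude_al hD
  have hb := amplitude_be hD
  have h1 := ubdd_integral_c_mul hD (ha.conj.mul ha)
  have h2 := ubdd_integral_c_mul hD (hb.conj.mul hb)
  have h3 := (hb.conj.mul ha).ul2_integral_doff hD
  have h4 := ((ubdd_const (I / 4)).mul (h1.add h2.neg)).mul_UL2 (ul2_deps (ι := ι))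
  refine ((h4.add h3).sub h3.conj).of_norm_le (fun i => ?_) fun i l => le_of_eq ?_
  · have := ((h4.add h3).sub h3.conj).1 i
    convert! this using 1
    ext l; ring
  · congr 1; ring

theorem ul2_d21 (hD : ∀ i, Tame (N i) M (D i) (D' i)) : UL2 fun i l => (D i).d21 (N i) l := by
  have ha := amplitude_al hD
  have hb := amplitude_be hD
  have h1 := ubdd_integral_c_mul hD (ha.mul hb)
  have h2 := (ha.mul ha).ul2_integral_doff hD
  have h3 := (hb.conj.mul hb.conj).ul2_integral_doff hD
  have h4 := ((ubdd_const (-(I / 2))).mul h1).mul_UL2 (ul2_deps (ι := ι))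
  convert! (h4.add h2).add h3.conj using 3 with i l
  rw [d21_eq hD]
  ring

/-- No such bound is needed for `d11`, which occurs in `D.drho` only multiplied by `b`, and `λ b` is
bounded. -/
theorem ul2_mul_d21 (hD : ∀ i, Tame (N i) M (D i) (D' i)) :
    UL2 fun i (l : ℝ) => l * (D i).d21 (N i) l := by
  have ha := amplitude_al hD
  have hb := amplitude_be hD
  have hbe := ul2_be hD
  have h1 := ubdd_integral_c_mul hD (ha.mul hb)
  have ua : UBdd fun (p : ι × ℝ) l => (D p.1).al l p.2 :=
    ⟨fun p => ((ha.cont p.1).uncurry_right p.2).measurable, 1, fun p l _ => ha.bound p.1 l p.2⟩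
  have ub : UBdd fun (p : ι × ℝ) l => (D p.1).be l p.2 :=
    ⟨fun p => ((hb.cont p.1).uncurry_right p.2).measurable, 1, fun p l _ => hb.bound p.1 l p.2⟩
  have h2 := (ha.mul ha).ul2_mul_integral_doff hD (c₀ := 2)
    (T := fun i l x => -2 * (D i).al l x * (D i).be l x)
    (fun i => ((ha.cont i).const_mul (-2)).mul (hb.cont i)) (fun i l x => by ring)
    (((ubdd_const (-2)).mul ua).mul_UL2 hbe)
  have h3 := (hb.conj.mul hb.conj).ul2_mul_integral_doff hD (c₀ := 2)
    (T := fun i l x => 2 * conj ((D i).al l x) * conj ((D i).be l x))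
    (fun i => ((ha.conj.cont i).const_mul 2).mul (hb.conj.cont i)) (fun i l x => by
      simp only [map_sub, map_mul, conj_I, conj_ofReal]; ring)
    (((ubdd_const 2).mul ua.conj).mul_UL2 hbe.conj)
  have h4 := ((ubdd_const (-(I / 2))).mul h1).mul_UL2 (ul2_mul_deps (ι := ι))
  convert! (h4.add h2).add h3.conj using 3 with i l
  rw [d21_eq hD]
  simp only [map_mul, conj_ofReal]
  push_cast
  ring

theorem ubdd_a (hD : ∀ i, Tame (N i) M (D i) (D' i)) : UBdd fun i l => (D i).a l := by
  have ha := amplitude_al hD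
  refine ⟨fun i => ?_, 1, fun i l _ => ?_⟩
  · have := ((ha.cont i).uncurry_right (-N i)).measurable
    convert! this using 1
    ext l
    exact ((hD i).supportedIn.al_neg (hD i).regular l).symm
  · simp only [← (hD i).supportedIn.al_neg (hD i).regular]
    exact ha.bound i l _

theorem ubdd_b (hD : ∀ i, Tame (N i) M (D i) (D' i)) : UBdd fun i l => (D i).b l := by
  have hb := amplitude_be hD
  refine ⟨fun i => ?_, 1, fun i l _ => ?_⟩
  · have := ((hb.cont i).uncurry_right (-N i)).measurable
    convert! this using 1
    ext l
    exact ((hD i).supportedIn.be_neg (hD i).regular l).symm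
  · simp only [← (hD i).supportedIn.be_neg (hD i).regular]
    exact hb.bound i l _

/-- The reflection coefficient of a potential. -/
def Potential.rho (D : Potential) (l : ℝ) : ℂ := -D.b l / conj (D.a l)

/-- The derivative of the reflection coefficient of a potential supported in `(-N, N)`. -/
def Potential.drho (D : Potential) (N l : ℝ) : ℂ :=
  -(-(D.b l * D.d11 N l + conj (D.a l) * D.d21 N l)) / conj (D.a l)
    + D.b l * conj (-(D.a l * D.d11 N l - conj (D.b l) * D.d21 N l)) / conj (D.a l) ^ 2

theorem Tame.hasDerivAt_rho {N : ℝ} {M : ℝ≥0} {D D' : Potential} (h : Tame N M D D') {l : ℝ}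
    (hl : D.a l ≠ 0) : HasDerivAt D.rho (D.drho N l) l := by
  obtain ⟨h1, h2⟩ := h.supportedIn.hasDerivAt_a_b h.regular h.nonneg l
  have hne : conj (D.a l) ≠ 0 := by simpa using hl
  have := (h2.neg).div (hasDerivAt_conj h1) hne
  convert! this using 1
  simp only [Potential.drho, Pi.neg_apply]
  field_simp
  ring

/-- Uniform weighted `L²` bounds for the reflection coefficients and their derivatives, for a family
of potentials for which `a` is bounded away from zero. -/
theorem ul2_rho (hD : ∀ i, Tame (N i) M (D i) (D' i)) {δ : ℝ} (hδ : 0 < δ)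
    (ha : ∀ i l, 0 < l → δ ≤ ‖(D i).a l‖) :
    (UL2 fun i l => (D i).rho l) ∧ (UL2 fun i (l : ℝ) => l * (D i).rho l) ∧
    (UL2 fun i l => (D i).drho (N i) l) ∧ UL2 fun i (l : ℝ) => l * (D i).drho (N i) l := by
  have ua := ubdd_a hD
  have ub := ubdd_b hD
  have umb := ubdd_mul_b hD
  have hinv : UBdd fun i l => (conj ((D i).a l))⁻¹ := by
    refine ⟨fun i => (ua.conj.1 i).inv, ⟨δ⁻¹, by positivity⟩, fun i l hl => ?_⟩
    rw [norm_inv, RCLike.norm_conj]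
    exact inv_anti₀ hδ (ha i l hl)
  have h11 := ul2_d11 hD
  have h21 := ul2_d21 hD
  have hm21 := ul2_mul_d21 hD
  have da : UL2 fun i l => conj (-((D i).a l * (D i).d11 (N i) l - conj ((D i).b l) * (D i).d21 (N i) l)) :=
    ((ua.mul_UL2 h11).sub (ub.conj.mul_UL2 h21)).neg.conj
  have db := (ub.mul_UL2 h11).add (ua.conj.mul_UL2 h21)
  have dmb := (umb.mul_UL2 h11).add (ua.conj.mul_UL2 hm21)
  refine ⟨?_, ?_, ?_, ?_⟩
  · convert! (hinv.mul_UL2 (ul2_b hD)).neg using 3 with i l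
    rw [Potential.rho]; ring
  · convert! (hinv.mul_UL2 (ul2_mul_b hD)).neg using 3 with i l
    rw [Potential.rho]; ring
  · convert! (hinv.mul_UL2 db).add (((ub.mul hinv).mul hinv).mul_UL2 da) using 3 with i l
    rw [Potential.drho]; ring
  · convert! (hinv.mul_UL2 dmb).add (((umb.mul hinv).mul hinv).mul_UL2 da) using 3 with i l
    rw [Potential.drho]; ring

end

/-! ### Truncation of the potential -/

/-- Product rule for an absolutely continuous and a continuously differentiable function. -/
theorem mul_sub_mul_eq_integral {k k' v v' : ℝ → ℂ} (hk' : ∀ a b, IntervalIntegrable k' volume a b)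
    (hk : ∀ x y, k y - k x = ∫ t in x..y, k' t) (hv : ∀ x, HasDerivAt v (v' x) x)
    (hv' : Continuous v') (x y : ℝ) :
    k y * v y - k x * v x = ∫ t in x..y, (k' t * v t + k t * v' t) := by
  have hvc : Continuous v := continuous_iff_continuousAt.2 fun x => (hv x).continuousAt
  have hkc : Continuous k := by
    have : k = fun y => k 0 + ∫ t in (0 : ℝ)..y, k' t := by
      ext y; rw [← hk]; ring
    rw [this]
    exact continuous_const.add (intervalIntegral.continuous_primitive hk' 0)
  have key : ∀ x y, x ≤ y → k y * v y - k x * v x = ∫ t in x..y, (k' t * v t + k t * v' t) := by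
    intro x y hxy
    have h1 := integral_mul_eq_sub_integral_primitive_mul ((hk' x y).1) hv hv'
    have h2 : ∫ t in Ioc x y, (∫ s in Ioc x y, if s ≤ t then k' s else 0) * v' t
        = ∫ t in x..y, (k t * v' t - k x * v' t) := by
      rw [intervalIntegral.integral_of_le hxy]
      refine setIntegral_congr_fun measurableSet_Ioc fun t ht => ?_
      have e1 : (∫ s in Ioc x y, if s ≤ t then k' s else 0)
          = ∫ s in Ioc x y, (Iic t).indicator k' s := by congr 1
      have e2 : Ioc x y ∩ Iic t = Ioc x t := by
        ext s
        simp only [mem_inter_iff, mem_Ioc, mem_Iic]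
        exact ⟨fun h => ⟨h.1.1, h.2⟩, fun h => ⟨⟨h.1, h.2.trans ht.2⟩, h.2⟩⟩
      simp only [e1, setIntegral_indicator measurableSet_Iic, e2]
      rw [← intervalIntegral.integral_of_le ht.1.le, ← hk]
      ring
    rw [h2, ← intervalIntegral.integral_of_le hxy, ← intervalIntegral.integral_of_le hxy, ← hk,
      intervalIntegral.integral_sub (Continuous.intervalIntegrable (by fun_prop) _ _)
        (Continuous.intervalIntegrable (by fun_prop) _ _), intervalIntegral.integral_const_mul,
      intervalIntegral.integral_eq_sub_of_hasDerivAt (fun t _ => hv t)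
        (hv'.intervalIntegrable _ _)] at h1
    rw [intervalIntegral.integral_add ((hk' x y).mul_continuousOn hvc.continuousOn)
      (Continuous.intervalIntegrable (by fun_prop) _ _), h1]
    ring
  rcases le_total x y with h | h
  · exact key x y h
  · rw [intervalIntegral.integral_symm, ← key y x h]
    ring

/-- The weight `⟨x⟩`. -/
def wt (x : ℝ) : ℝ := √(x ^ 2 + 1)

theorem wt_sq (x : ℝ) : wt x ^ 2 = x ^ 2 + 1 := Real.sq_sqrt (by positivity)

theorem one_le_wt (x : ℝ) : 1 ≤ wt x := by
  rw [wt, Real.one_le_sqrt]; nlinarith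

theorem abs_le_wt (x : ℝ) : |x| ≤ wt x := by
  rw [wt, ← Real.sqrt_sq_eq_abs]; exact Real.sqrt_le_sqrt (by linarith)

theorem continuous_wt : Continuous wt := by unfold wt; fun_prop

/-- `k` is an absolutely continuous function in `H^{1,1}` with derivative `k'`. -/
structure SobFun (k k' : ℝ → ℝ) : Prop where
  cont : Continuous k
  meas : Measurable k'
  ftc : ∀ x y, k y - k x = ∫ t in x..y, k' t
  l2 : ∫⁻ x, ‖wt x * k x‖ₑ ^ 2 < ⊤
  l2' : ∫⁻ x, ‖wt x * k' x‖ₑ ^ 2 < ⊤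

theorem enorm_le_inv_add (x u : ℝ) : ‖u‖ₑ ≤ ‖(1 + x ^ 2)⁻¹‖ₑ + ‖wt x * u‖ₑ ^ 2 := by
  have h1 : ‖u‖₊ ≤ ‖(1 + x ^ 2)⁻¹‖₊ + ‖wt x * u‖₊ ^ 2 := by
    rw [← NNReal.coe_le_coe]
    push_cast
    have hp : 0 < 1 + x ^ 2 := by positivity
    rw [norm_mul, mul_pow, Real.norm_eq_abs (wt x), sq_abs, wt_sq, norm_inv,
      Real.norm_of_nonneg hp.le, add_comm (x ^ 2)]
    have h2 : (1 + x ^ 2)⁻¹ * (1 + x ^ 2) = 1 := inv_mul_cancel₀ hp.ne'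
    have h3 : 0 < (1 + x ^ 2)⁻¹ := by positivity
    nlinarith [norm_nonneg u, sq_nonneg (1 - (1 + x ^ 2) * ‖u‖), sq_nonneg (1 + (1 + x ^ 2) * ‖u‖)]
  simp only [enorm_eq_nnnorm]
  exact_mod_cast h1

theorem lintegral_enorm_le (u : ℝ → ℝ) :
    ∫⁻ x, ‖u x‖ₑ ≤ (∫⁻ x : ℝ, ‖(1 + x ^ 2)⁻¹‖ₑ) + ∫⁻ x, ‖wt x * u x‖ₑ ^ 2 := by
  refine (lintegral_mono fun x => enorm_le_inv_add x (u x)).trans_eq ?_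
  exact lintegral_add_left (by fun_prop) _

theorem lintegral_inv_lt_top : ∫⁻ x : ℝ, ‖(1 + x ^ 2)⁻¹‖ₑ < ⊤ := integrable_inv_one_add_sq.2

theorem integrable_of_weighted {k : ℝ → ℝ} (hk : Measurable k) (h : ∫⁻ x, ‖wt x * k x‖ₑ ^ 2 < ⊤) :
    Integrable k :=
  ⟨hk.aestronglyMeasurable,
    (lintegral_enorm_le k).trans_lt (ENNReal.add_lt_top.2 ⟨lintegral_inv_lt_top, h⟩)⟩

theorem enorm_sq_le_of_abs_le {u v : ℝ} (h : |u| ≤ |v|) : ‖u‖ₑ ^ 2 ≤ ‖v‖ₑ ^ 2 := by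
  gcongr
  exact enorm_le_iff_norm_le.2 h

/-- A compactly supported function is tame as soon as its `H^{1,1}` norm is controlled. -/
theorem TameFun.of_weighted {N : ℝ} {Q : ℝ≥0} {k k' : ℝ → ℝ} (hc : Continuous k)
    (hm : Measurable k') (hf : ∀ x y, k y - k x = ∫ t in x..y, k' t)
    (hs : ∀ x, N ≤ |x| → k x = 0) (h : ∫⁻ x, ‖wt x * k x‖ₑ ^ 2 ≤ Q)
    (h' : ∫⁻ x, ‖wt x * k' x‖ₑ ^ 2 ≤ Q) :
    TameFun N ((∫⁻ x : ℝ, ‖(1 + x ^ 2)⁻¹‖ₑ).toNNReal + Q) k k' := by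
  have hQ : (Q : ℝ≥0∞) ≤ (((∫⁻ x : ℝ, ‖(1 + x ^ 2)⁻¹‖ₑ).toNNReal + Q : ℝ≥0) : ℝ≥0∞) := by
    exact_mod_cast le_add_self
  have h1 : ∀ u : ℝ → ℝ, ∫⁻ x, ‖wt x * u x‖ₑ ^ 2 ≤ Q →
      ∫⁻ x, ‖u x‖ₑ ≤ (((∫⁻ x : ℝ, ‖(1 + x ^ 2)⁻¹‖ₑ).toNNReal + Q : ℝ≥0) : ℝ≥0∞) := by
    intro u hu
    push_cast
    rw [ENNReal.coe_toNNReal lintegral_inv_lt_top.ne]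
    exact (lintegral_enorm_le u).trans (by gcongr)
  have h2 : ∀ u : ℝ → ℝ, ∫⁻ x, ‖wt x * u x‖ₑ ^ 2 ≤ Q → ∫⁻ x, ‖u x‖ₑ ^ 2 ≤ Q := by
    refine fun u hu => (lintegral_mono fun x => enorm_sq_le_of_abs_le ?_).trans hu
    rw [abs_mul]
    nlinarith [abs_nonneg (u x), one_le_wt x, le_abs_self (wt x)]
  have h3 : ∀ u : ℝ → ℝ, ∫⁻ x, ‖wt x * u x‖ₑ ^ 2 ≤ Q → ∫⁻ x, ‖x * u x‖ₑ ^ 2 ≤ Q := by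
    refine fun u hu => (lintegral_mono fun x => enorm_sq_le_of_abs_le ?_).trans hu
    rw [abs_mul, abs_mul]
    exact mul_le_mul_of_nonneg_right ((abs_le_wt x).trans (le_abs_self _)) (abs_nonneg _)
  refine ⟨hc, hm, hf, hs, fun x => ?_, h1 k h, h1 k' h', (h2 k h).trans hQ, (h2 k' h').trans hQ,
    (h3 k h).trans hQ, (h3 k' h').trans hQ⟩
  have e : k x = ∫ t in (-|N| - |x|)..x, k' t := by
    rw [← hf, hs (-|N| - |x|), sub_zero]
    rw [abs_of_nonpos (by linarith [abs_nonneg N, abs_nonneg x])]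
    linarith [le_abs_self N, abs_nonneg x]
  have : ‖k x‖ₑ ≤ (((∫⁻ x : ℝ, ‖(1 + x ^ 2)⁻¹‖ₑ).toNNReal + Q : ℝ≥0) : ℝ≥0∞) := by
    rw [e, intervalIntegral.integral_of_le (by linarith [neg_abs_le x, abs_nonneg N])]
    exact (enorm_integral_le_lintegral_enorm _).trans
      ((setLIntegral_le_lintegral _ _).trans (h1 k' h'))
  exact NNReal.coe_le_coe.2 (enorm_le_coe.1 this)

theorem TameFun.mono {N : ℝ} {M M' : ℝ≥0} {k k' : ℝ → ℝ} (h : TameFun N M k k') (hM : M ≤ M') :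
    TameFun N M' k k' := by
  have h1 : (M : ℝ≥0∞) ≤ M' := by exact_mod_cast hM
  exact ⟨h.cont, h.meas, h.ftc, h.supp, fun x => (h.sup x).trans (by exact_mod_cast hM),
    h.l1.trans h1, h.l1'.trans h1, h.l2.trans h1, h.l2'.trans h1, h.xl2.trans h1, h.xl2'.trans h1⟩

/-- A fixed smooth bump function, equal to `1` on `[-1, 1]` and to `0` outside `(-2, 2)`. -/
def bump : ContDiffBump (0 : ℝ) := ⟨1, 2, one_pos, one_lt_two⟩

/-- The cutoff at scale `n + 1`. -/
def cutoff (n : ℕ) (x : ℝ) : ℝ := bump (x / (n + 1))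

theorem cutoff_nonneg (n : ℕ) (x : ℝ) : 0 ≤ cutoff n x := bump.nonneg

theorem cutoff_le_one (n : ℕ) (x : ℝ) : cutoff n x ≤ 1 := bump.le_one

theorem hasDerivAt_cutoff (n : ℕ) (x : ℝ) :
    HasDerivAt (cutoff n) (deriv bump (x / (n + 1)) / (n + 1)) x := by
  have h1 : HasDerivAt bump (deriv bump (x / (n + 1))) (x / (n + 1)) :=
    ((bump.contDiff (n := 1)).differentiable (by norm_num) _).hasDerivAt
  have h2 : HasDerivAt (fun x : ℝ => x / ((n : ℝ) + 1)) (1 / ((n : ℝ) + 1)) x :=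
    (hasDerivAt_id x).div_const _
  have := h1.comp x h2
  rw [mul_one_div] at this
  exact this

theorem continuous_deriv_bump : Continuous (deriv bump) :=
  (bump.contDiff (n := 1)).continuous_deriv (by norm_num)

theorem continuous_cutoff (n : ℕ) : Continuous (cutoff n) :=
  continuous_iff_continuousAt.2 fun x => (hasDerivAt_cutoff n x).continuousAt

theorem exists_deriv_cutoff_le : ∃ c : ℝ, ∀ (n : ℕ) x, |deriv bump (x / (n + 1)) / (n + 1)| ≤ c := by
  obtain ⟨c, hc⟩ := (bump.hasCompactSupport.deriv).exists_bound_of_continuous continuous_deriv_bump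
  refine ⟨c, fun n x => ?_⟩
  have h1 : (0 : ℝ) < n + 1 := by positivity
  rw [abs_div, abs_of_pos h1, div_le_iff₀ h1]
  have h2 := hc (x / (n + 1))
  rw [Real.norm_eq_abs] at h2
  have h3 : (0 : ℝ) ≤ n := by positivity
  nlinarith [abs_nonneg (deriv bump (x / (n + 1)))]

theorem cutoff_eq_zero {n : ℕ} {x : ℝ} (hx : 2 * ((n : ℝ) + 1) ≤ |x|) : cutoff n x = 0 := by
  refine bump.zero_of_le_dist ?_
  have h1 : (0 : ℝ) < n + 1 := by positivity
  rw [Real.dist_eq, sub_zero, abs_div, abs_of_pos h1, le_div_iff₀ h1]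
  exact hx

theorem cutoff_eq_one {n : ℕ} {x : ℝ} (hx : |x| ≤ n) : cutoff n x = 1 := by
  refine bump.one_of_mem_closedBall ?_
  have h1 : (0 : ℝ) < n + 1 := by positivity
  rw [Metric.mem_closedBall, Real.dist_eq, sub_zero, abs_div, abs_of_pos h1, div_le_iff₀ h1]
  simp only [bump]
  linarith

namespace SobFun

variable {k k' : ℝ → ℝ}

theorem integrable (h : SobFun k k') : Integrable k := integrable_of_weighted h.cont.measurable h.l2

theorem integrable' (h : SobFun k k') : Integrable k' := integrable_of_weighted h.meas h.l2'

/-- The truncations of an `H^{1,1}` function are uniformly tame. -/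
theorem exists_tameFun (h : SobFun k k') : ∃ M : ℝ≥0, ∀ n : ℕ,
    TameFun (2 * ((n : ℝ) + 1)) M (fun x => cutoff n x * k x)
      (fun x => k' x * cutoff n x + k x * (deriv bump (x / (n + 1)) / (n + 1))) := by
  obtain ⟨c, hc⟩ := exists_deriv_cutoff_le
  set W := ∫⁻ x, ‖wt x * k x‖ₑ ^ 2 with hW
  set W' := ∫⁻ x, ‖wt x * k' x‖ₑ ^ 2 with hW'
  set Q : ℝ≥0∞ := W + 2 * (W' + ‖c‖ₑ ^ 2 * W) with hQ
  have hQt : Q ≠ ⊤ := by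
    have h1 := h.l2.ne
    have h2 := h.l2'.ne
    simp only [hQ]
    finiteness
  refine ⟨(∫⁻ x : ℝ, ‖(1 + x ^ 2)⁻¹‖ₑ).toNNReal + Q.toNNReal, fun n => ?_⟩
  have hdc : Continuous fun x : ℝ => deriv bump (x / (n + 1)) / ((n : ℝ) + 1) := by
    have := continuous_deriv_bump
    have h1 : (n : ℝ) + 1 ≠ 0 := by positivity
    fun_prop
  refine TameFun.of_weighted ((continuous_cutoff n).mul h.cont) ?_ (fun x y => ?_) (fun x hx => ?_)
    ?_ ?_
  · exact (h.meas.mul (continuous_cutoff n).measurable).add (h.cont.measurable.mul hdc.measurable)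
  · have := mul_sub_mul_eq_integral (k := fun x => (k x : ℂ)) (k' := fun x => (k' x : ℂ))
      (fun a b => (h.integrable'.ofReal).intervalIntegrable)
      (fun x y => by rw [intervalIntegral.integral_ofReal, ← h.ftc]; push_cast; rfl)
      (fun x => (hasDerivAt_cutoff n x).ofReal_comp) (continuous_ofReal.comp hdc) x y
    have e : ∫ t in x..y, ((k' t : ℂ) * cutoff n t
        + k t * ((deriv bump (t / (n + 1)) / (n + 1) : ℝ) : ℂ))
        = ((∫ t in x..y, (k' t * cutoff n t + k t * (deriv bump (t / (n + 1)) / (n + 1))) : ℝ) : ℂ) := by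
      rw [← intervalIntegral.integral_ofReal]
      congr 1
      ext t
      push_cast
      ring
    rw [e] at this
    have h2 : (((cutoff n y * k y - cutoff n x * k x : ℝ)) : ℂ) = ((∫ t in x..y,
        (k' t * cutoff n t + k t * (deriv bump (t / (n + 1)) / (n + 1))) : ℝ) : ℂ) := by
      rw [← this]; push_cast; ring
    exact_mod_cast h2
  · rw [cutoff_eq_zero hx, zero_mul]
  · rw [ENNReal.coe_toNNReal hQt]
    refine (lintegral_mono fun x => enorm_sq_le_of_abs_le ?_).trans (le_self_add : W ≤ Q)
    rw [abs_mul, abs_mul, abs_mul, abs_of_nonneg (cutoff_nonneg n x)]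
    have := cutoff_le_one n x
    gcongr
    nlinarith [abs_nonneg (k x)]
  · rw [ENNReal.coe_toNNReal hQt]
    calc ∫⁻ x, ‖wt x * (k' x * cutoff n x + k x * (deriv bump (x / (n + 1)) / (n + 1)))‖ₑ ^ 2
        ≤ ∫⁻ x, 2 * (‖wt x * k' x‖ₑ ^ 2 + ‖c‖ₑ ^ 2 * ‖wt x * k x‖ₑ ^ 2) := by
          refine lintegral_mono fun x => ?_
          have e : ‖wt x * (k' x * cutoff n x + k x * (deriv bump (x / (n + 1)) / (n + 1)))‖ₑ ^ 2
              = ‖((wt x * k' x * cutoff n x : ℝ) : ℂ)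
                + ((deriv bump (x / (n + 1)) / (n + 1) * (wt x * k x) : ℝ) : ℂ)‖ₑ ^ 2 := by
            rw [← ofReal_add, enorm_eq_nnnorm, enorm_eq_nnnorm, nnnorm_real]
            congr 4
            ring
          rw [e]
          refine (enorm_add_sq_le _ _).trans ?_
          simp only [enorm_eq_nnnorm, nnnorm_real]
          simp only [← enorm_eq_nnnorm]
          refine mul_le_mul_right (add_le_add (enorm_sq_le_of_abs_le ?_) ?_) 2
          · rw [abs_mul, abs_of_nonneg (cutoff_nonneg n x)]
            exact mul_le_of_le_one_right (abs_nonneg _) (cutoff_le_one n x)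
          · rw [← mul_pow, ← enorm_mul]
            refine enorm_sq_le_of_abs_le ?_
            rw [abs_mul, abs_mul c]
            exact mul_le_mul_of_nonneg_right ((hc n x).trans (le_abs_self c)) (abs_nonneg _)
      _ = 2 * (W' + ‖c‖ₑ ^ 2 * W) := by
          have m1 : Measurable fun x => ‖wt x * k' x‖ₑ ^ 2 :=
            ((continuous_wt.measurable.mul h.meas).enorm.pow_const 2)
          rw [lintegral_const_mul' _ _ (by simp), lintegral_add_left m1,
            lintegral_const_mul' _ _ (by simp)]
      _ ≤ Q := le_add_self

theorem tendsto_integral_cutoff (h : SobFun k k') :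
    Tendsto (fun n : ℕ => ∫ x, |cutoff n x * k x - k x|) atTop (𝓝 0) := by
  have : Tendsto (fun n : ℕ => ∫ x, |cutoff n x * k x - k x|) atTop (𝓝 (∫ _ : ℝ, (0 : ℝ))) := by
    refine tendsto_integral_of_dominated_convergence (fun x => |k x|) (fun n => ?_)
      h.integrable.abs (fun n => Eventually.of_forall fun x => ?_) (Eventually.of_forall fun x => ?_)
    · exact (((continuous_cutoff n).mul h.cont).sub h.cont).abs.aestronglyMeasurable
    · have h1 := cutoff_le_one n x
      have h2 := cutoff_nonneg n x
      rw [Real.norm_eq_abs, abs_abs, ← sub_one_mul, abs_mul]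
      refine mul_le_of_le_one_left (abs_nonneg _) ?_
      rw [abs_le]; constructor <;> linarith
    · refine tendsto_const_nhds.congr' ?_
      obtain ⟨m, hm⟩ := exists_nat_ge |x|
      filter_upwards [eventually_ge_atTop m] with n hn
      have : |x| ≤ n := hm.trans (by exact_mod_cast hn)
      simp [cutoff_eq_one this]
  simpa using this

end SobFun

/-! ### Weak limits -/

/-- Bounded sequences in a Hilbert space have weak cluster points. -/
theorem exists_weak_limit {H : Type*} [NormedAddCommGroup H] [InnerProductSpace ℂ H]
    [CompleteSpace H] (W : ℕ → H) (K : ℝ) (hW : ∀ n, ‖W n‖ ≤ K) :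
    ∃ V : H, ∀ (g : H) (c : ℂ), Tendsto (fun n => inner ℂ (W n) g) atTop (𝓝 c) →
      inner ℂ V g = c := by
  let φ : ℕ → WeakDual ℂ H := fun n =>
    StrongDual.toWeakDual (InnerProductSpace.toDual ℂ H (W n))
  have hφ : ∀ n, φ n ∈ WeakDual.toStrongDual ⁻¹' Metric.closedBall (0 : StrongDual ℂ H) K := by
    intro n
    rw [mem_preimage, mem_closedBall_zero_iff]
    exact (LinearIsometryEquiv.norm_map (InnerProductSpace.toDual ℂ H) (W n)).trans_le (hW n)
  obtain ⟨ψ, -, hψ⟩ := (WeakDual.isCompact_closedBall (0 : StrongDual ℂ H) K).ultrafilter_le_nhds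
    ((hyperfilter ℕ).map φ) (by
      rw [le_principal_iff]
      exact Filter.mem_map.2 (Filter.univ_mem' hφ))
  refine ⟨(InnerProductSpace.toDual ℂ H).symm (WeakDual.toStrongDual ψ), fun g c hc => ?_⟩
  rw [InnerProductSpace.toDual_symm_apply]
  have h1 : Tendsto (fun n => φ n g) (hyperfilter ℕ : Filter ℕ) (𝓝 (ψ g)) :=
    ((WeakDual.eval_continuous g).tendsto ψ).comp hψ
  have h2 : (hyperfilter ℕ : Filter ℕ) ≤ atTop := by
    rw [← Nat.cofinite_eq_atTop]; exact hyperfilter_le_cofinite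
  exact tendsto_nhds_unique h1 (hc.mono_left h2)

theorem enorm_wt_mul_sq (x : ℝ) (u : ℂ) : ‖(wt x : ℂ) * u‖ₑ ^ 2 = ‖u‖ₑ ^ 2 + ‖(x : ℂ) * u‖ₑ ^ 2 := by
  have h1 : ‖(wt x : ℂ) * u‖₊ ^ 2 = ‖u‖₊ ^ 2 + ‖(x : ℂ) * u‖₊ ^ 2 := by
    rw [← NNReal.coe_inj]
    push_cast
    rw [norm_mul, norm_mul, mul_pow, mul_pow, norm_real, norm_real, Real.norm_eq_abs,
      Real.norm_eq_abs, sq_abs, sq_abs, wt_sq]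
    ring
  simp only [enorm_eq_nnnorm]
  exact_mod_cast h1

theorem UL2.wt_mul {ι : Type*} {F : ι → ℝ → ℂ} (h : UL2 F) (h' : UL2 fun i (l : ℝ) => l * F i l) :
    UL2 fun i l => wt l * F i l := by
  obtain ⟨m, K, hK⟩ := h
  obtain ⟨m', L, hL⟩ := h'
  refine ⟨fun i => (measurable_ofReal.comp continuous_wt.measurable).mul (m i), K + L, fun i => ?_⟩
  simp only [enorm_wt_mul_sq]
  rw [lintegral_add_left ((m i).enorm.pow_const 2)]
  push_cast
  exact add_le_add (hK i) (hL i)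

theorem memLp_two_iff {μ : Measure ℝ} {u : ℝ → ℂ} (hu : AEStronglyMeasurable u μ) :
    MemLp u 2 μ ↔ ∫⁻ x, ‖u x‖ₑ ^ 2 ∂μ < ⊤ := by
  rw [MemLp, and_iff_right hu, eLpNorm_lt_top_iff_lintegral_rpow_enorm_lt_top (by simp) (by simp)]
  simp

theorem norm_toLp_le {μ : Measure ℝ} {u : ℝ → ℂ} (hu : MemLp u 2 μ) {K : ℝ≥0}
    (h : ∫⁻ x, ‖u x‖ₑ ^ 2 ∂μ ≤ K) : ‖hu.toLp u‖ ≤ √K := by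
  rw [Lp.norm_toLp, Real.sqrt_eq_rpow]
  refine ENNReal.toReal_le_of_le_ofReal (by positivity) ?_
  rw [eLpNorm_eq_lintegral_rpow_enorm_toReal (by simp) (by simp),
    ← ENNReal.ofReal_rpow_of_nonneg (p := 1 / 2) K.coe_nonneg (by norm_num),
    ENNReal.ofReal_coe_nnreal]
  simp only [ENNReal.toReal_ofNat, ENNReal.rpow_ofNat]
  gcongr

theorem wt_ne_zero (x : ℝ) : (wt x : ℂ) ≠ 0 := by
  have := one_le_wt x
  exact_mod_cast (by linarith : wt x ≠ 0)

/-- Weighted `L²` bounds for the derivatives survive a pointwise limit. -/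
theorem exists_derivative_of_tendsto {u w : ℕ → ℝ → ℂ} {v : ℝ → ℂ} (h : UL2 fun n l => wt l * w n l)
    (hftc : ∀ n x y, 0 ≤ x → x ≤ y → u n y - u n x = ∫ t in x..y, w n t)
    (hlim : ∀ x, 0 ≤ x → Tendsto (fun n => u n x) atTop (𝓝 (v x))) :
    ∃ w' : ℝ → ℂ, Measurable w' ∧ ∫⁻ l in Ioi (0 : ℝ), ‖wt l * w' l‖ₑ ^ 2 < ⊤ ∧
      ∀ x y, 0 ≤ x → x ≤ y → v y - v x = ∫ t in x..y, w' t := by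
  obtain ⟨m, K, hK⟩ := h
  set μ := volume.restrict (Ioi (0 : ℝ)) with hμ
  have hW : ∀ n, MemLp (fun l => wt l * w n l) 2 μ := fun n =>
    (memLp_two_iff (m n).aestronglyMeasurable).2 ((hK n).trans_lt (by simp))
  obtain ⟨V, hV⟩ := exists_weak_limit (fun n => (hW n).toLp _) (√K)
    (fun n => norm_toLp_le (hW n) (hK n))
  have hVm : Measurable (V : ℝ → ℂ) := (Lp.stronglyMeasurable V).measurable
  have hwt : Measurable fun l => (wt l : ℂ) := measurable_ofReal.comp continuous_wt.measurable
  have e : ∀ l, (wt l : ℂ) * (V l / wt l) = V l := fun l => mul_div_cancel₀ _ (wt_ne_zero l)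
  refine ⟨fun l => V l / wt l, hVm.div hwt, ?_, fun x y hx hxy => ?_⟩
  · simp only [e]
    exact (memLp_two_iff hVm.aestronglyMeasurable).1 (Lp.memLp V)
  · set g : ℝ → ℂ := (Ioc x y).indicator fun l => (wt l : ℂ)⁻¹ with hg
    have hsub : Ioc x y ⊆ Ioi 0 := fun t ht => hx.trans_lt ht.1
    have hgm : Measurable g := (hwt.inv).indicator measurableSet_Ioc
    have hgL : MemLp g 2 μ := by
      rw [memLp_two_iff hgm.aestronglyMeasurable]
      refine (lintegral_mono (g := (Ioc x y).indicator fun _ => (1 : ℝ≥0∞)) fun l => ?_).trans_lt ?_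
      · by_cases hl : l ∈ Ioc x y
        · simp only [hg, indicator_of_mem hl]
          refine pow_le_one₀ zero_le ?_
          rw [enorm_eq_nnnorm, ← ENNReal.coe_one, ENNReal.coe_le_coe, ← NNReal.coe_le_coe]
          push_cast
          rw [norm_inv, norm_real]
          exact inv_le_one_of_one_le₀ ((one_le_wt l).trans (le_abs_self _))
        · simp [hg, indicator_of_notMem hl]
      · rw [lintegral_indicator measurableSet_Ioc, setLIntegral_one]
        exact (Measure.restrict_apply_le _ _).trans_lt (by simp)
    have hin : ∀ f : Lp ℂ 2 μ, ∀ f₀ : ℝ → ℂ, f =ᵐ[μ] f₀ →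
        inner ℂ f (hgL.toLp g) = conj (∫ t in x..y, f₀ t / wt t) := by
      intro f f₀ hf
      rw [L2.inner_def, intervalIntegral.integral_of_le hxy, ← integral_conj]
      have h1 : ∫ t in Ioc x y, conj (f₀ t / wt t)
          = ∫ t, (Ioc x y).indicator (fun t => conj (f₀ t / wt t)) t ∂μ := by
        rw [integral_indicator measurableSet_Ioc, hμ, Measure.restrict_restrict measurableSet_Ioc,
          inter_eq_left.2 hsub]
      rw [h1]
      refine integral_congr_ae ?_
      filter_upwards [hf, hgL.coeFn_toLp] with t h1 h2
      rw [h1, h2, RCLike.inner_apply]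
      by_cases ht : t ∈ Ioc x y
      · simp only [hg, indicator_of_mem ht, map_div₀, conj_ofReal]
        rw [div_eq_mul_inv, mul_comm]
      · simp [hg, indicator_of_notMem ht]
    have key := hV (hgL.toLp g) (conj (v y - v x)) ?_
    · rw [hin V V (EventuallyEq.refl _ _)] at key
      exact ((starRingEnd ℂ).injective key).symm
    · have h2 : ∀ n, inner ℂ ((hW n).toLp _) (hgL.toLp g) = conj (u n y - u n x) := by
        intro n
        rw [hin _ _ (hW n).coeFn_toLp, hftc n x y hx hxy]
        congr 2
        ext t
        exact mul_div_cancel_left₀ _ (wt_ne_zero t)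
      simp only [h2]
      exact (continuous_conj.tendsto _).comp ((hlim y (hx.trans hxy)).sub (hlim x hx))

/-! ### The reflection coefficient on the half line -/

/-- `D.c, D.s, D.q` lie in `H^{1,1}`, with derivatives `D'.c, D'.s, D'.q`. -/
structure Weighted (D D' : Potential) : Prop where
  c : SobFun D.c D'.c
  s : SobFun D.s D'.s
  q : SobFun D.q D'.q

namespace Potential

/-- The difference of two potentials. -/
def sub (D₂ D₁ : Potential) : Potential where
  c x := D₂.c x - D₁.c x
  s x := D₂.s x - D₁.s x
  q x := D₂.q x - D₁.q x

/-- The potential cut off at scale `n + 1`. -/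
def trunc (D : Potential) (n : ℕ) : Potential where
  c x := cutoff n x * D.c x
  s x := cutoff n x * D.s x
  q x := cutoff n x * D.q x

/-- The derivative of `D.trunc n` if `D'` is the derivative of `D`. -/
def trunc' (D D' : Potential) (n : ℕ) : Potential where
  c x := D'.c x * cutoff n x + D.c x * (deriv bump (x / (n + 1)) / (n + 1))
  s x := D'.s x * cutoff n x + D.s x * (deriv bump (x / (n + 1)) / (n + 1))
  q x := D'.q x * cutoff n x + D.q x * (deriv bump (x / (n + 1)) / (n + 1))

theorem Regular.integrable_mass {D : Potential} (h : D.Regular) : Integrable D.mass :=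
  (h.int_c.abs.add h.int_s.abs).add h.int_q.abs

theorem Regular.sub {D₁ D₂ : Potential} (h₂ : D₂.Regular) (h₁ : D₁.Regular) : (D₂.sub D₁).Regular :=
  ⟨h₂.cont_c.sub h₁.cont_c, h₂.cont_s.sub h₁.cont_s, h₂.cont_q.sub h₁.cont_q,
    h₂.int_c.sub h₁.int_c, h₂.int_s.sub h₁.int_s, h₂.int_q.sub h₁.int_q⟩

/-- The scattering data depend on the potential in a Lipschitz way, uniformly in `λ ≥ 0`. -/
theorem Regular.norm_sub_le {D₁ D₂ : Potential} (h₁ : D₁.Regular) (h₂ : D₂.Regular) {l : ℝ}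
    (hl : 0 ≤ l) : ‖D₂.a l - D₁.a l‖ ≤ 4 * ∫ x, (D₂.sub D₁).mass x ∧
      ‖D₂.b l - D₁.b l‖ ≤ 4 * ∫ x, (D₂.sub D₁).mass x := by
  have h := (h₁.hasScattering l).norm_sub_le (h₁.admissible l) (h₂.admissible l)
    (h₂.hasScattering l)
  have hm : ∫ y, (|D₂.kap l y - D₁.kap l y| + ‖D₂.off l y - D₁.off l y‖)
      ≤ ∫ x, (D₂.sub D₁).mass x := by
    refine integral_mono_of_nonneg (Eventually.of_forall fun x => by positivity)
      (h₂.sub h₁).integrable_mass (Eventually.of_forall fun x => ?_)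
    have e1 : D₂.kap l x - D₁.kap l x = (D₂.sub D₁).kap l x := by
      simp only [kap, Potential.sub]; ring
    have e2 : D₂.off l x - D₁.off l x = (D₂.sub D₁).off l x := by
      simp only [off, amp, Potential.sub]; push_cast; ring
    simp only [e1, e2]
    exact (D₂.sub D₁).abs_kap_add_norm_off_le hl x
  exact ⟨h.1.trans (by linarith), h.2.trans (by linarith)⟩

end Potential

namespace Weighted

variable {D D' : Potential}

theorem regular (h : Weighted D D') : D.Regular :=
  ⟨h.c.cont, h.s.cont, h.q.cont, h.c.integrable, h.s.integrable, h.q.integrable⟩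

theorem exists_tame (h : Weighted D D') :
    ∃ M : ℝ≥0, ∀ n : ℕ, Tame (2 * ((n : ℝ) + 1)) M (D.trunc n) (D.trunc' D' n) := by
  obtain ⟨M₁, h₁⟩ := h.c.exists_tameFun
  obtain ⟨M₂, h₂⟩ := h.s.exists_tameFun
  obtain ⟨M₃, h₃⟩ := h.q.exists_tameFun
  refine ⟨M₁ + M₂ + M₃, fun n => ⟨by positivity, (h₁ n).mono ?_, (h₂ n).mono ?_, (h₃ n).mono ?_⟩⟩
  · rw [add_assoc]; exact le_self_add
  · rw [add_right_comm]; exact le_add_self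
  · exact le_add_self

theorem tendsto_mass (h : Weighted D D') :
    Tendsto (fun n => 4 * ∫ x, ((D.trunc n).sub D).mass x) atTop (𝓝 0) := by
  obtain ⟨M, hM⟩ := h.exists_tame
  have key := (((h.c.tendsto_integral_cutoff.add h.s.tendsto_integral_cutoff).add
    h.q.tendsto_integral_cutoff).const_mul 4)
  simp only [add_zero, mul_zero] at key
  refine key.congr fun n => ?_
  have hr := ((hM n).regular.sub h.regular)
  have e : ∫ x, ((D.trunc n).sub D).mass x = ((∫ x, |((D.trunc n).sub D).c x|)
      + ∫ x, |((D.trunc n).sub D).s x|) + ∫ x, |((D.trunc n).sub D).q x| := by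
    rw [← integral_add hr.int_c.abs hr.int_s.abs]
    exact integral_add (hr.int_c.abs.add hr.int_s.abs) hr.int_q.abs
  rw [e]
  rfl

theorem tendsto_a_b (h : Weighted D D') {l : ℝ} (hl : 0 ≤ l) :
    Tendsto (fun n => (D.trunc n).a l) atTop (𝓝 (D.a l)) ∧
      Tendsto (fun n => (D.trunc n).b l) atTop (𝓝 (D.b l)) := by
  obtain ⟨M, hM⟩ := h.exists_tame
  constructor
  · exact tendsto_iff_norm_sub_tendsto_zero.2 (squeeze_zero (fun n => norm_nonneg _)
      (fun n => (h.regular.norm_sub_le (hM n).regular hl).1) h.tendsto_mass)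
  · exact tendsto_iff_norm_sub_tendsto_zero.2 (squeeze_zero (fun n => norm_nonneg _)
      (fun n => (h.regular.norm_sub_le (hM n).regular hl).2) h.tendsto_mass)

theorem continuousOn_a (h : Weighted D D') : ContinuousOn D.a (Ici 0) := by
  obtain ⟨M, hM⟩ := h.exists_tame
  have : TendstoUniformlyOn (fun n => (D.trunc n).a) D.a atTop (Ici 0) := by
    rw [Metric.tendstoUniformlyOn_iff]
    intro ε hε
    filter_upwards [h.tendsto_mass.eventually (gt_mem_nhds hε)] with n hn l hl
    rw [dist_comm, dist_eq_norm]
    exact ((h.regular.norm_sub_le (hM n).regular hl).1).trans_lt hn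
  refine this.continuousOn (Frequently.of_forall fun n => ?_)
  exact (continuous_iff_continuousAt.2 fun l => (((hM n).supportedIn.hasDerivAt_a_b (hM n).regular
    (hM n).nonneg l).1.continuousAt)).continuousOn

/-- As `λ b` is bounded and `|a|² + |b|² = 1`, the coefficient `a` is bounded away from zero. -/
theorem exists_le_norm_a (h : Weighted D D') (ha : ∀ l, 0 ≤ l → D.a l ≠ 0) :
    ∃ δ : ℝ, 0 < δ ∧ ∀ l, 0 ≤ l → δ ≤ ‖D.a l‖ := by
  obtain ⟨M, hM⟩ := h.exists_tame
  obtain ⟨-, K, hK⟩ := ubdd_mul_b hM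
  have hb : ∀ l : ℝ, 0 < l → ‖l * D.b l‖ ≤ K := fun l hl =>
    le_of_tendsto ((h.tendsto_a_b hl.le).2.const_mul (l : ℂ)).norm
      (Eventually.of_forall fun n => hK n l hl)
  obtain ⟨l₀, hl₀, hmin⟩ := isCompact_Icc.exists_isMinOn
    (nonempty_Icc.2 (by positivity : (0 : ℝ) ≤ 2 * K + 1))
    ((h.continuousOn_a.mono fun l hl => hl.1).norm : ContinuousOn (fun l => ‖D.a l‖) (Icc 0 (2 * K + 1)))
  refine ⟨min ‖D.a l₀‖ (1 / 2), lt_min (norm_pos_iff.2 (ha l₀ hl₀.1)) (by norm_num), fun l hl => ?_⟩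
  rcases le_total l (2 * K + 1) with h1 | h1
  · exact (min_le_left _ _).trans (hmin (⟨hl, h1⟩ : l ∈ Icc 0 (2 * (K : ℝ) + 1)))
  · refine (min_le_right _ _).trans ?_
    have hK0 : (0 : ℝ) ≤ K := K.2
    have h2 := hb l (by linarith)
    rw [norm_mul, norm_real, Real.norm_of_nonneg hl] at h2
    have h3 : ‖D.b l‖ ≤ 1 / 2 := by
      by_contra! hc
      nlinarith
    have h4 := (h.regular.hasScattering l).normSq_add
    nlinarith [norm_nonneg (D.a l), norm_nonneg (D.b l)]

/-- On the half line `λ ≥ 0`, the reflection coefficient of an `H^{1,1}` potential without spectral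
singularities lies in `H^{1,1}`. -/
theorem rho_mem (h : Weighted D D') (ha : ∀ l, 0 ≤ l → D.a l ≠ 0) :
    ∃ w : ℝ → ℂ, Measurable w ∧ ∫⁻ l in Ioi (0 : ℝ), ‖wt l * D.rho l‖ₑ ^ 2 < ⊤ ∧
      ∫⁻ l in Ioi (0 : ℝ), ‖wt l * w l‖ₑ ^ 2 < ⊤ ∧
      ∀ x y, 0 ≤ x → x ≤ y → D.rho y - D.rho x = ∫ t in x..y, w t := by
  obtain ⟨M, hM⟩ := h.exists_tame
  obtain ⟨δ, hδ, hδa⟩ := h.exists_le_norm_a ha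
  obtain ⟨m, hm⟩ := eventually_atTop.1 (h.tendsto_mass.eventually (gt_mem_nhds (half_pos hδ)))
  have hlow : ∀ n l, 0 ≤ l → δ / 2 ≤ ‖(D.trunc (n + m)).a l‖ := by
    intro n l hl
    have h1 := (h.regular.norm_sub_le (hM (n + m)).regular hl).1.trans
      (hm (n + m) (Nat.le_add_left m n)).le
    have h2 := norm_sub_norm_le (D.a l) ((D.trunc (n + m)).a l)
    rw [norm_sub_rev] at h2
    linarith [hδa l hl]
  have hne : ∀ n l, 0 ≤ l → (D.trunc (n + m)).a l ≠ 0 := fun n l hl =>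
    norm_pos_iff.1 ((half_pos hδ).trans_le (hlow n l hl))
  obtain ⟨r1, r2, d1, d2⟩ := ul2_rho (fun n => hM (n + m)) (half_pos hδ)
    (fun n l hl => hlow n l hl.le)
  have hlim : ∀ l, 0 ≤ l → Tendsto (fun n => (D.trunc (n + m)).rho l) atTop (𝓝 (D.rho l)) := by
    intro l hl
    obtain ⟨h1, h2⟩ := h.tendsto_a_b hl
    have : Tendsto (fun n => (D.trunc n).rho l) atTop (𝓝 (D.rho l)) :=
      h2.neg.div ((continuous_conj.tendsto _).comp h1) (by simpa using ha l hl)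
    exact this.comp (tendsto_add_atTop_nat m)
  have hd := d1.wt_mul d2
  have hn : ∀ n x y, 0 ≤ x → x ≤ y → (D.trunc (n + m)).rho y - (D.trunc (n + m)).rho x
      = ∫ t in x..y, (D.trunc (n + m)).drho (2 * (((n + m : ℕ) : ℝ) + 1)) t := by
    intro n x y hx hxy
    refine (intervalIntegral.integral_eq_sub_of_hasDerivAt (fun t ht => ?_) ?_).symm
    · rw [uIcc_of_le hxy] at ht
      exact (hM (n + m)).hasDerivAt_rho (hne n t (hx.trans ht.1))
    · obtain ⟨md, K, hK⟩ := d1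
      rw [intervalIntegrable_iff_integrableOn_Ioc_of_le hxy]
      have hL : MemLp ((D.trunc (n + m)).drho (2 * (((n + m : ℕ) : ℝ) + 1))) 2
          (volume.restrict (Ioc x y)) := by
        rw [memLp_two_iff (md n).aestronglyMeasurable]
        exact ((lintegral_mono_set fun t ht => hx.trans_lt ht.1).trans (hK n)).trans_lt (by simp)
      exact hL.integrable (by norm_num)
  obtain ⟨w, hw, hw2, hftc⟩ := exists_derivative_of_tendsto hd hn hlim
  refine ⟨w, hw, ?_, hw2, hftc⟩
  obtain ⟨mr, K, hK⟩ := r1.wt_mul r2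
  calc ∫⁻ l in Ioi (0 : ℝ), ‖wt l * D.rho l‖ₑ ^ 2
      = ∫⁻ l in Ioi (0 : ℝ), liminf (fun n => ‖wt l * (D.trunc (n + m)).rho l‖ₑ ^ 2) atTop := by
        refine setLIntegral_congr_fun measurableSet_Ioi fun l hl => ?_
        refine (Tendsto.liminf_eq ?_).symm
        have h1 := (hlim l (le_of_lt hl)).const_mul (wt l : ℂ)
        exact ((ENNReal.continuous_pow 2).comp continuous_enorm).continuousAt.tendsto.comp h1
    _ ≤ liminf (fun n => ∫⁻ l in Ioi (0 : ℝ), ‖wt l * (D.trunc (n + m)).rho l‖ₑ ^ 2) atTop :=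
        lintegral_liminf_le fun n => (mr n).enorm.pow_const 2
    _ ≤ K := liminf_le_of_le (by isBoundedDefault) fun b hb => by
        obtain ⟨n, hn⟩ := hb.exists
        exact hn.trans (hK n)
    _ < ⊤ := by simp

end Weighted

/-! ### Weighted Sobolev functions on the half line and on the line -/

/-- On `[0, ∞)`, the function `u` is absolutely continuous with derivative `w`, and `u`, `w` lie in
the weighted space `L^{2,1}`. -/
structure HalfSob (u w : ℝ → ℂ) : Prop where
  meas : Measurable w
  l2 : ∫⁻ l in Ioi (0 : ℝ), ‖wt l * u l‖ₑ ^ 2 < ⊤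
  l2' : ∫⁻ l in Ioi (0 : ℝ), ‖wt l * w l‖ₑ ^ 2 < ⊤
  ftc : ∀ x y, 0 ≤ x → x ≤ y → u y - u x = ∫ t in x..y, w t

/-- The function `u` is absolutely continuous with derivative `w`, and `u`, `w` lie in the weighted
space `L^{2,1}`. -/
structure LineSob (u w : ℝ → ℂ) : Prop where
  meas : Measurable w
  l2 : ∫⁻ l, ‖wt l * u l‖ₑ ^ 2 < ⊤
  l2' : ∫⁻ l, ‖wt l * w l‖ₑ ^ 2 < ⊤
  ftc : ∀ x y, u y - u x = ∫ t in x..y, w t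

theorem integrableOn_of_weighted {w : ℝ → ℂ} (hw : Measurable w) {s : Set ℝ}
    (h : ∫⁻ l in s, ‖wt l * w l‖ₑ ^ 2 < ⊤) : IntegrableOn w s := by
  refine ⟨hw.aestronglyMeasurable, ?_⟩
  have h1 : ∀ l, ‖w l‖ₑ ≤ ‖(1 + l ^ 2)⁻¹‖ₑ + ‖(wt l : ℂ) * w l‖ₑ ^ 2 := by
    intro l
    have := enorm_le_inv_add l ‖w l‖
    rwa [enorm_norm, enorm_mul, enorm_norm, ← enorm_norm (wt l), ← norm_real, enorm_norm,
      ← enorm_mul] at this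
  refine (lintegral_mono h1).trans_lt ?_
  rw [lintegral_add_left (by fun_prop)]
  exact ENNReal.add_lt_top.2 ⟨(setLIntegral_le_lintegral _ _).trans_lt lintegral_inv_lt_top, h⟩

theorem wt_neg (l : ℝ) : wt (-l) = wt l := by rw [wt, wt, neg_sq]

theorem HalfSob.integrableOn {u w : ℝ → ℂ} (h : HalfSob u w) : IntegrableOn w (Ioi 0) :=
  integrableOn_of_weighted h.meas h.l2'

theorem lintegral_eq_add_neg (f : ℝ → ℝ≥0∞) :
    ∫⁻ x, f x = (∫⁻ x in Ioi (0 : ℝ), f x) + ∫⁻ x in Ioi (0 : ℝ), f (-x) := by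
  rw [← lintegral_add_compl f measurableSet_Ioi, compl_Ioi]
  congr 1
  rw [← setLIntegral_congr Iio_ae_eq_Iic, ← lintegral_indicator measurableSet_Iio,
    ← lintegral_indicator measurableSet_Ioi,
    ← lintegral_neg_eq_self ((Iio (0 : ℝ)).indicator f)]
  congr 1
  ext x
  by_cases hx : 0 < x
  · rw [indicator_of_mem (by simpa using hx), indicator_of_mem (by simpa using hx)]
  · rw [indicator_of_notMem (by simpa using hx), indicator_of_notMem (by simpa using hx)]

/-- Two half lines are glued to a line. -/
theorem HalfSob.exists_lineSob {u w u₁ w₁ : ℝ → ℂ} (h : HalfSob u w) (h₁ : HalfSob u₁ w₁)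
    (hu : ∀ l, 0 ≤ l → u (-l) = conj (u₁ l)) : ∃ W, LineSob u W := by
  set W : ℝ → ℂ := fun l => if 0 < l then w l else -conj (w₁ (-l)) with hW
  have hm : Measurable W := Measurable.ite measurableSet_Ioi h.meas
    ((continuous_conj.measurable.comp (h₁.meas.comp measurable_neg)).neg)
  have hWp : ∀ l, 0 < l → W l = w l := fun l hl => if_pos hl
  have hWn : ∀ l, 0 ≤ l → W (-l) = -conj (w₁ l) := fun l hl => by
    simp only [hW, neg_neg, if_neg (not_lt.2 (neg_nonpos.2 hl))]
  have hl2 : ∫⁻ l, ‖wt l * u l‖ₑ ^ 2 < ⊤ := by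
    rw [lintegral_eq_add_neg]
    refine ENNReal.add_lt_top.2 ⟨h.l2, ?_⟩
    rw [setLIntegral_congr_fun (g := fun l => ‖wt l * u₁ l‖ₑ ^ 2) measurableSet_Ioi fun l hl => ?_]
    · exact h₁.l2
    · simp only [wt_neg, hu l (le_of_lt hl), enorm_mul, RCLike.enorm_conj]
  have hl2' : ∫⁻ l, ‖wt l * W l‖ₑ ^ 2 < ⊤ := by
    rw [lintegral_eq_add_neg]
    refine ENNReal.add_lt_top.2 ⟨?_, ?_⟩
    · rw [setLIntegral_congr_fun (g := fun l => ‖wt l * w l‖ₑ ^ 2) measurableSet_Ioi fun l hl => ?_]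
      · exact h.l2'
      · simp only [hWp l hl]
    · rw [setLIntegral_congr_fun (g := fun l => ‖wt l * w₁ l‖ₑ ^ 2) measurableSet_Ioi
        fun l hl => ?_]
      · exact h₁.l2'
      · simp only [wt_neg, hWn l (le_of_lt hl), enorm_mul, enorm_neg, RCLike.enorm_conj]
  have hi : ∀ a b, IntervalIntegrable W volume a b := fun a b =>
    ((integrableOn_univ.1 (integrableOn_of_weighted hm (by rwa [Measure.restrict_univ])))
      ).intervalIntegrable
  have hp : ∀ y, 0 ≤ y → u y - u 0 = ∫ t in 0..y, W t := by
    intro y hy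
    rw [h.ftc 0 y le_rfl hy, intervalIntegral.integral_of_le hy, intervalIntegral.integral_of_le hy]
    exact setIntegral_congr_fun measurableSet_Ioc fun t ht => (hWp t ht.1).symm
  have hn : ∀ y, 0 ≤ y → u (-y) - u 0 = ∫ t in 0..(-y), W t := by
    intro y hy
    have h0 : u 0 = conj (u₁ 0) := by simpa using hu 0 le_rfl
    rw [hu y hy, h0, ← map_sub, h₁.ftc 0 y le_rfl hy,
      intervalIntegral.integral_symm (-y) 0]
    have e := intervalIntegral.integral_comp_neg (a := 0) (b := y) W
    rw [neg_zero] at e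
    rw [← e, intervalIntegral.integral_of_le hy, intervalIntegral.integral_of_le hy, ← integral_conj,
      ← integral_neg]
    exact setIntegral_congr_fun measurableSet_Ioc fun t ht => by
      simp only [hWn t ht.1.le, neg_neg]
  have h0 : ∀ y, u y - u 0 = ∫ t in 0..y, W t := by
    intro y
    rcases le_total 0 y with hy | hy
    · exact hp y hy
    · simpa using hn (-y) (neg_nonneg.2 hy)
  refine ⟨W, hm, hl2, hl2', fun x y => ?_⟩
  rw [← intervalIntegral.integral_interval_sub_left (hi 0 y) (hi 0 x), ← h0, ← h0]
  ring

namespace LineSob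

variable {u w : ℝ → ℂ}

theorem integrable (h : LineSob u w) : Integrable w :=
  integrableOn_univ.1 (integrableOn_of_weighted h.meas (by rw [Measure.restrict_univ]; exact h.l2'))

theorem continuous (h : LineSob u w) : Continuous u := by
  have : u = fun y => u 0 + ∫ t in (0 : ℝ)..y, w t := by
    ext y; rw [← h.ftc]; ring
  rw [this]
  exact continuous_const.add
    (intervalIntegral.continuous_primitive (fun _ _ => h.integrable.intervalIntegrable) 0)

/-- As `⟨x⟩ u` and `⟨x⟩ w` are square integrable, `⟨x⟩ u` tends to zero at infinity. -/
theorem tendsto_wt_mul (h : LineSob u w) :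
    Tendsto (fun l => (wt l : ℂ) * u l) atBot (𝓝 0) := by
  have hwt : Continuous fun l => (wt l : ℂ) := continuous_ofReal.comp continuous_wt
  have m1 : Continuous fun l => (wt l : ℂ) * u l := hwt.mul h.continuous
  have m2 : Measurable fun l => (wt l : ℂ) * w l := hwt.measurable.mul h.meas
  have L1 : MemLp (fun l => (wt l : ℂ) * u l) 2 volume :=
    (memLp_two_iff m1.aestronglyMeasurable).2 h.l2
  have L2 : MemLp (fun l => (wt l : ℂ) * w l) 2 volume :=
    (memLp_two_iff m2.aestronglyMeasurable).2 h.l2'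
  set g : ℝ → ℝ := fun l => ‖(wt l : ℂ) * u l‖ ^ 2 + ‖(wt l : ℂ) * w l‖ ^ 2 with hg
  have hgi : Integrable g := L1.norm.integrable_sq.add L2.norm.integrable_sq
  have hloc2 : ∀ a b, IntervalIntegrable (fun l => ‖(wt l : ℂ) * w l‖) volume a b := by
    intro a b
    exact (((L2.locallyIntegrable (by norm_num)).integrableOn_isCompact
      isCompact_uIcc).intervalIntegrable).norm
  have hI : Tendsto (fun l : ℝ => ∫ t in (l - 1)..l, g t) atBot (𝓝 0) := by
    have h1 := intervalIntegral_tendsto_integral_Iic (μ := volume) (f := g) 0 hgi.integrableOn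
      (tendsto_id (α := ℝ) (x := atBot))
    have h2 := intervalIntegral_tendsto_integral_Iic (μ := volume) (f := g) 0 hgi.integrableOn
      (tendsto_atBot_add_const_right atBot (-1 : ℝ) tendsto_id)
    have h3 := h2.sub h1
    rw [sub_self] at h3
    refine h3.congr fun l => ?_
    rw [intervalIntegral.integral_interval_sub_interval_comm' hgi.intervalIntegrable
      hgi.intervalIntegrable hgi.intervalIntegrable]
    rw [intervalIntegral.integral_same, zero_sub, intervalIntegral.integral_symm, neg_neg]
    rfl
  rw [Metric.tendsto_nhds]
  intro ε hε
  have hI' := hI.eventually (gt_mem_nhds (show (0 : ℝ) < (ε / 2) ^ 2 by positivity))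
  filter_upwards [hI', eventually_le_atBot (0 : ℝ)] with l hl hl0
  have hlow : ∀ s ∈ Icc (l - 1) l, ‖(wt l : ℂ) * u l‖
      ≤ ‖(wt s : ℂ) * u s‖ + ∫ t in (l - 1)..l, ‖(wt t : ℂ) * w t‖ := by
    intro s hs
    have hw1 : ∀ t, t ≤ l → wt l ≤ wt t := fun t ht => by
      refine Real.sqrt_le_sqrt ?_
      nlinarith
    have h1 : ‖u l‖ ≤ ‖u s‖ + ∫ t in s..l, ‖w t‖ := by
      have e : u l = u s + ∫ t in s..l, w t := by rw [← h.ftc]; ring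
      rw [e]
      exact (norm_add_le _ _).trans
        (add_le_add le_rfl (intervalIntegral.norm_integral_le_integral_norm hs.2))
    have hw0 : 0 < wt l := one_pos.trans_le (one_le_wt l)
    have h2 : wt l * ∫ t in s..l, ‖w t‖ ≤ ∫ t in (l - 1)..l, ‖(wt t : ℂ) * w t‖ := by
      rw [← intervalIntegral.integral_const_mul]
      refine (intervalIntegral.integral_mono_on hs.2
        (h.integrable.norm.const_mul _).intervalIntegrable (hloc2 s l) fun t ht => ?_).trans ?_
      · rw [norm_mul, norm_real, Real.norm_of_nonneg (one_pos.trans_le (one_le_wt t)).le]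
        exact mul_le_mul_of_nonneg_right (hw1 t ht.2) (norm_nonneg _)
      · exact intervalIntegral.integral_mono_interval hs.1 hs.2 le_rfl
          (Eventually.of_forall fun t => norm_nonneg _) (hloc2 _ _)
    rw [norm_mul, norm_mul, norm_real, norm_real, Real.norm_of_nonneg hw0.le,
      Real.norm_of_nonneg (one_pos.trans_le (one_le_wt s)).le]
    have h3 := mul_le_mul_of_nonneg_right (hw1 s hs.2) (norm_nonneg (u s))
    have h4 := mul_le_mul_of_nonneg_left h1 hw0.le
    rw [mul_add] at h4
    linarith
  have hle : l - 1 ≤ l := by linarith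
  have hc := m1.norm
  have h5 : ‖(wt l : ℂ) * u l‖ ≤ ∫ s in (l - 1)..l, (‖(wt s : ℂ) * u s‖ + ‖(wt s : ℂ) * w s‖) := by
    have := intervalIntegral.integral_mono_on hle
      (intervalIntegrable_const (c := ‖(wt l : ℂ) * u l‖))
      ((hc.intervalIntegrable (μ := volume) (l - 1) l).add intervalIntegrable_const) hlow
    rw [intervalIntegral.integral_const, intervalIntegral.integral_add
      (hc.intervalIntegrable _ _) intervalIntegrable_const, intervalIntegral.integral_const] at this
    rw [intervalIntegral.integral_add (hc.intervalIntegrable _ _) (hloc2 _ _)]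
    simpa using this
  -- the elementary inequality `A + B ≤ ε / 2 + (A² + B²) / ε` replaces the Cauchy–Schwarz inequality
  have h6 : ∫ s in (l - 1)..l, (‖(wt s : ℂ) * u s‖ + ‖(wt s : ℂ) * w s‖)
      ≤ ∫ s in (l - 1)..l, (ε / 2 + ε⁻¹ * g s) := by
    refine intervalIntegral.integral_mono_on hle ((hc.intervalIntegrable _ _).add (hloc2 _ _))
      (intervalIntegrable_const.add (hgi.const_mul _).intervalIntegrable) fun t _ => ?_
    simp only [hg]
    generalize ‖(wt t : ℂ) * u t‖ = A
    generalize ‖(wt t : ℂ) * w t‖ = B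
    rw [← sub_nonneg]
    have : ε / 2 + ε⁻¹ * (A ^ 2 + B ^ 2) - (A + B) = ε⁻¹ * ((A - ε / 2) ^ 2 + (B - ε / 2) ^ 2) := by
      field_simp; ring
    rw [this]
    positivity
  rw [intervalIntegral.integral_add intervalIntegrable_const
    (hgi.const_mul _).intervalIntegrable, intervalIntegral.integral_const,
    intervalIntegral.integral_const_mul] at h6
  rw [dist_zero_right]
  have h7 : ε⁻¹ * ∫ s in (l - 1)..l, g s < ε⁻¹ * (ε / 2) ^ 2 :=
    mul_lt_mul_of_pos_left hl (by positivity)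
  have h8 : ε⁻¹ * (ε / 2) ^ 2 = ε / 4 := by field_simp; norm_num
  have h9 : (l - (l - 1)) • (ε / 2) = ε / 2 := by simp
  linarith

end LineSob

/-! ### The gauge transformation exchanging `λ` and `-λ` -/

/-- Regular representatives of the initial data: `F` stands for `f₀`, with `F' = G`, and `h` for
`f₁`; `g`, `k` are the derivatives of `G`, `h`. -/
structure Profile (F G g h k : ℝ → ℝ) : Prop where
  deriv : ∀ x, HasDerivAt F (G x) x
  sobG : SobFun G g
  sobh : SobFun h k
  l2_cos : ∫⁻ x, ‖wt x * (Real.cos (F x) - 1)‖ₑ ^ 2 < ⊤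
  l2_sin : ∫⁻ x, ‖wt x * Real.sin (F x)‖ₑ ^ 2 < ⊤

/-- The coefficients of the system determined by `F`, its derivative `G`, and `h`. -/
def pot (F G h : ℝ → ℝ) : Potential where
  c x := Real.cos (F x) - 1
  s x := Real.sin (F x)
  q x := G x + h x

/-- The derivatives of the coefficients of the system. -/
def pot' (F G g k : ℝ → ℝ) : Potential where
  c x := -Real.sin (F x) * G x
  s x := Real.cos (F x) * G x
  q x := g x + k x

theorem SobFun.add {u u' v v' : ℝ → ℝ} (hu : SobFun u u') (hv : SobFun v v') :
    SobFun (fun x => u x + v x) fun x => u' x + v' x := by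
  have key : ∀ u v : ℝ → ℝ, Measurable u → ∫⁻ x, ‖wt x * u x‖ₑ ^ 2 < ⊤ → ∫⁻ x, ‖wt x * v x‖ₑ ^ 2 < ⊤ →
      ∫⁻ x, ‖wt x * (u x + v x)‖ₑ ^ 2 < ⊤ := by
    intro u v hm hu hv
    have h1 : ∀ x, ‖wt x * (u x + v x)‖ₑ ^ 2 ≤ 2 * (‖wt x * u x‖ₑ ^ 2 + ‖wt x * v x‖ₑ ^ 2) := by
      intro x
      have := enorm_add_sq_le ((wt x * u x : ℝ) : ℂ) ((wt x * v x : ℝ) : ℂ)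
      rw [← ofReal_add, ← mul_add] at this
      simpa only [enorm_eq_nnnorm, nnnorm_real] using this
    refine (lintegral_mono h1).trans_lt ?_
    rw [lintegral_const_mul' _ _ (by simp),
      lintegral_add_left (f := fun x => ‖wt x * u x‖ₑ ^ 2)
        ((continuous_wt.measurable.mul hm).enorm.pow_const 2)]
    exact ENNReal.mul_lt_top (by simp) (ENNReal.add_lt_top.2 ⟨hu, hv⟩)
  refine ⟨hu.cont.add hv.cont, hu.meas.add hv.meas, fun x y => ?_, ?_, ?_⟩
  · rw [intervalIntegral.integral_add hu.integrable'.intervalIntegrable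
      hv.integrable'.intervalIntegrable, ← hu.ftc, ← hv.ftc]
    ring
  · exact key u v hu.cont.measurable hu.l2 hv.l2
  · exact key u' v' hu.meas hu.l2' hv.l2'

theorem SobFun.neg {u u' : ℝ → ℝ} (hu : SobFun u u') : SobFun (fun x => -u x) fun x => -u' x := by
  refine ⟨hu.cont.neg, hu.meas.neg, fun x y => ?_, ?_, ?_⟩
  · rw [intervalIntegral.integral_neg, ← hu.ftc]; ring
  · simpa only [mul_neg, enorm_neg] using hu.l2
  · simpa only [mul_neg, enorm_neg] using hu.l2'

/-- A function in `H^{1,1}` vanishes at infinity. -/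
theorem SobFun.tendsto_zero {u u' : ℝ → ℝ} (hu : SobFun u u') :
    Tendsto u atTop (𝓝 0) ∧ Tendsto u atBot (𝓝 0) := by
  have hi := hu.integrable
  have hi' := hu.integrable'
  have e : ∀ y, u 0 + ∫ t in (0 : ℝ)..y, u' t = u y := fun y => by rw [← hu.ftc]; ring
  have h1 : Tendsto u atTop (𝓝 (u 0 + ∫ t in Ioi 0, u' t)) :=
    ((intervalIntegral_tendsto_integral_Ioi 0 hi'.integrableOn tendsto_id).const_add _).congr e
  have h2 : Tendsto u atBot (𝓝 (u 0 + -∫ t in Iic 0, u' t)) :=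
    ((intervalIntegral_tendsto_integral_Iic 0 hi'.integrableOn tendsto_id).neg.const_add _).congr
      fun y => by rw [← intervalIntegral.integral_symm]; exact e y
  have hz1 := (hi.integrableAtFilter atTop).eq_zero_of_tendsto (fun s hs => by
    obtain ⟨x, hx⟩ := mem_atTop_sets.1 hs
    exact measure_mono_top (fun y hy => hx y hy : Ici x ⊆ s) (by simp)) h1
  have hz2 := (hi.integrableAtFilter atBot).eq_zero_of_tendsto (fun s hs => by
    obtain ⟨x, hx⟩ := mem_atBot_sets.1 hs
    exact measure_mono_top (fun y hy => hx y hy : Iic x ⊆ s) (by simp)) h2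
  rw [hz1] at h1
  rw [hz2] at h2
  exact ⟨h1, h2⟩

namespace Profile

variable {F G g h k : ℝ → ℝ}

theorem cont (p : Profile F G g h k) : Continuous F :=
  continuous_iff_continuousAt.2 fun x => (p.deriv x).continuousAt

theorem neg (p : Profile F G g h k) :
    Profile (fun x => -F x) (fun x => -G x) (fun x => -g x) h k := by
  refine ⟨fun x => (p.deriv x).neg, p.sobG.neg, p.sobh, ?_, ?_⟩
  · simpa only [Real.cos_neg] using p.l2_cos
  · simpa only [Real.sin_neg, mul_neg, enorm_neg] using p.l2_sin

theorem l2_mul (p : Profile F G g h k) {v : ℝ → ℝ} (hv : ∀ x, |v x| ≤ 1) :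
    ∫⁻ x, ‖wt x * (v x * G x)‖ₑ ^ 2 < ⊤ := by
  refine (lintegral_mono fun x => enorm_sq_le_of_abs_le ?_).trans_lt p.sobG.l2
  rw [abs_mul, abs_mul, abs_mul]
  exact mul_le_mul_of_nonneg_left (mul_le_of_le_one_left (abs_nonneg _) (hv x)) (abs_nonneg _)

theorem weighted (p : Profile F G g h k) : Weighted (pot F G h) (pot' F G g k) := by
  have hF := p.cont
  have hG := p.sobG.cont
  have hc : Continuous fun x => -Real.sin (F x) * G x := by fun_prop
  have hs : Continuous fun x => Real.cos (F x) * G x := by fun_prop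
  refine ⟨⟨?_, hc.measurable, fun x y => ?_, p.l2_cos, ?_⟩,
    ⟨?_, hs.measurable, fun x y => ?_, p.l2_sin, ?_⟩, p.sobG.add p.sobh⟩
  · simp only [pot]; fun_prop
  · exact (intervalIntegral.integral_eq_sub_of_hasDerivAt (fun t _ => ((p.deriv t).cos).sub_const 1)
      (hc.intervalIntegrable _ _)).symm
  · exact p.l2_mul fun x => by rw [abs_neg]; exact Real.abs_sin_le_one _
  · simp only [pot]; fun_prop
  · exact (intervalIntegral.integral_eq_sub_of_hasDerivAt (fun t _ => (p.deriv t).sin)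
      (hs.intervalIntegrable _ _)).symm
  · exact p.l2_mul fun x => Real.abs_cos_le_one _

theorem exists_tendsto (p : Profile F G g h k) :
    (∃ L, Tendsto F atTop (𝓝 L)) ∧ ∃ L, Tendsto F atBot (𝓝 L) := by
  have hi := p.sobG.integrable
  have e : ∀ y, F 0 + ∫ t in (0 : ℝ)..y, G t = F y := fun y => by
    rw [intervalIntegral.integral_eq_sub_of_hasDerivAt (fun t _ => p.deriv t)
      (p.sobG.cont.intervalIntegrable _ _)]
    ring
  exact ⟨⟨_, ((intervalIntegral_tendsto_integral_Ioi 0 hi.integrableOn tendsto_id).const_add _).congr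
    e⟩, ⟨_, ((intervalIntegral_tendsto_integral_Iic 0 hi.integrableOn tendsto_id).neg.const_add
      _).congr fun y => by rw [← intervalIntegral.integral_symm]; exact e y⟩⟩

/-- At both ends `f₀` tends to a multiple of `2π`, so that `cos (f₀ / 2)` tends to a sign and
`sin (f₀ / 2)` to zero. -/
theorem exists_sign (p : Profile F G g h k) :
    (∃ σ : ℝ, σ ^ 2 = 1 ∧ Tendsto (fun x => Real.cos (F x / 2)) atTop (𝓝 σ) ∧
      Tendsto (fun x => Real.sin (F x / 2)) atTop (𝓝 0)) ∧
    ∃ σ : ℝ, σ ^ 2 = 1 ∧ Tendsto (fun x => Real.cos (F x / 2)) atBot (𝓝 σ) ∧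
      Tendsto (fun x => Real.sin (F x / 2)) atBot (𝓝 0) := by
  have key : ∀ (l : Filter ℝ) [l.NeBot] (L : ℝ), Tendsto F l (𝓝 L) →
      Tendsto (pot F G h).c l (𝓝 0) →
      ∃ σ : ℝ, σ ^ 2 = 1 ∧ Tendsto (fun x => Real.cos (F x / 2)) l (𝓝 σ) ∧
      Tendsto (fun x => Real.sin (F x / 2)) l (𝓝 0) := by
    intro l _ L hL hc
    have h1 : Real.cos L = 1 := by
      have := tendsto_nhds_unique (((Real.continuous_cos.tendsto L).comp hL).sub_const 1) hc
      linarith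
    have h2 : Real.cos L = 2 * Real.cos (L / 2) ^ 2 - 1 := by
      rw [← Real.cos_two_mul]; congr 1; ring
    have h3 := Real.sin_sq_add_cos_sq (L / 2)
    have h4 : Real.sin (L / 2) = 0 := by
      refine pow_eq_zero_iff (two_ne_zero) |>.1 ?_
      linarith
    refine ⟨Real.cos (L / 2), by linarith, (Real.continuous_cos.tendsto _).comp (hL.div_const 2), ?_⟩
    have := (Real.continuous_sin.tendsto _).comp (hL.div_const 2)
    rw [h4] at this
    exact this
  obtain ⟨⟨L, hL⟩, L', hL'⟩ := p.exists_tendsto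
  obtain ⟨h1, h2⟩ := p.weighted.c.tendsto_zero
  exact ⟨key _ L hL h1, key _ L' hL' h2⟩

/-- The rotation by the angle `f₀ / 2` turns the system for `f₀` at `λ` into the complex conjugate
of the system for `-f₀` at `-λ`. -/
theorem exists_scattering_neg (p : Profile F G g h k) (l : ℝ) :
    ∃ σ : ℝ, σ ^ 2 = 1 ∧
      (pot (fun x => -F x) (fun x => -G x) h).a (-l) = σ * conj ((pot F G h).a l) ∧
      (pot (fun x => -F x) (fun x => -G x) h).b (-l) = σ * conj ((pot F G h).b l) := by
  set D := pot F G h with hD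
  set D₁ := pot (fun x => -F x) (fun x => -G x) h with hD₁
  obtain ⟨⟨σ, hσ, hc, hs⟩, τ, hτ, hc', hs'⟩ := p.exists_sign
  have hr : D.Regular := p.weighted.regular
  have hr₁ : D₁.Regular := p.neg.weighted.regular
  have hj := hr.jost l
  obtain ⟨hla, hlb⟩ := hr.tendsto l
  set A : ℝ → ℂ := fun x => σ * (Real.cos (F x / 2) * conj (D.al l x)
    + Real.sin (F x / 2) * exp (-(I * l * x)) * conj (D.be l x)) with hA
  set B : ℝ → ℂ := fun x => σ * (-Real.sin (F x / 2) * exp (I * l * x) * conj (D.al l x)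
    + Real.cos (F x / 2) * conj (D.be l x)) with hB
  have hb : ∀ (L : Filter ℝ) (E : ℝ → ℂ) (u : ℝ → ℂ) (c : ℂ), (∀ x, ‖E x‖ = 1) →
      Tendsto (fun x => Real.sin (F x / 2)) L (𝓝 0) → Tendsto u L (𝓝 c) →
      Tendsto (fun x => (Real.sin (F x / 2) : ℂ) * E x * conj (u x)) L (𝓝 0) := by
    intro L E u c hE h1 h2
    have h3 : Tendsto (fun x => |Real.sin (F x / 2)| * ‖u x‖) L (𝓝 0) := by
      simpa using h1.abs.mul h2.norm
    refine squeeze_zero_norm (fun x => ?_) h3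
    rw [norm_mul, norm_mul, hE, norm_real, RCLike.norm_conj, mul_one, Real.norm_eq_abs]
  have hE1 : ∀ x : ℝ, ‖exp (-(I * l * x))‖ = 1 := Potential.norm_exp_I l
  have hE2 : ∀ x : ℝ, ‖exp (I * l * x)‖ = 1 := fun x => by
    have := Potential.norm_exp_I (-l) x
    rwa [ofReal_neg, mul_neg, neg_mul, neg_neg] at this
  have limA : ∀ (L : Filter ℝ) (t : ℝ) (a b : ℂ), Tendsto (fun x => Real.cos (F x / 2)) L (𝓝 t) →
      Tendsto (fun x => Real.sin (F x / 2)) L (𝓝 0) → Tendsto (D.al l) L (𝓝 a) →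
      Tendsto (D.be l) L (𝓝 b) → Tendsto A L (𝓝 (σ * t * conj a)) ∧
        Tendsto B L (𝓝 (σ * t * conj b)) := by
    intro L t a b h1 h2 h3 h4
    have h1' : Tendsto (fun x => (Real.cos (F x / 2) : ℂ)) L (𝓝 t) :=
      (continuous_ofReal.tendsto t).comp h1
    have h5 := ((h1'.mul ((continuous_conj.tendsto _).comp h3)).add
      (hb L _ _ _ hE1 h2 h4)).const_mul (σ : ℂ)
    have h6 := ((hb L _ _ _ hE2 h2 h3).neg.add
      (h1'.mul ((continuous_conj.tendsto _).comp h4))).const_mul (σ : ℂ)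
    constructor
    · convert! h5 using 2; ring
    · convert! h6 using 2
      · simp only [hB, Function.comp]; ring
      · ring
  have hσ' : (σ : ℂ) * σ = 1 := by rw [← sq]; exact_mod_cast hσ
  have heps : eps (-l) = eps l + 2 * l := by unfold eps; rw [neg_sq]; ring
  have hexp : ∀ x : ℝ, exp (-(I * l * x)) * exp (I * l * x) = 1 := fun x => by
    rw [← Complex.exp_add]; simp
  have hjost : JostPair (D₁.kap (-l)) (D₁.off (-l)) A B := by
    have hx2 : ∀ x : ℝ, Real.cos (F x) = 1 - 2 * Real.sin (F x / 2) ^ 2 ∧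
        Real.sin (F x) = 2 * Real.sin (F x / 2) * Real.cos (F x / 2) := fun x => by
      constructor
      · have := Real.cos_two_mul (F x / 2)
        have h2 := Real.sin_sq_add_cos_sq (F x / 2)
        rw [mul_div_cancel₀ _ two_ne_zero] at this
        linarith
      · have := Real.sin_two_mul (F x / 2)
        rwa [mul_div_cancel₀ _ two_ne_zero] at this
    have dF : ∀ x, HasDerivAt (fun x => F x / 2) (G x / 2) x := fun x => (p.deriv x).div_const 2
    have dC : ∀ x, HasDerivAt (fun x => (Real.cos (F x / 2) : ℂ))
        ((-Real.sin (F x / 2) * (G x / 2) : ℝ) : ℂ) x := fun x => ((dF x).cos).ofReal_comp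
    have dS : ∀ x, HasDerivAt (fun x => (Real.sin (F x / 2) : ℂ))
        ((Real.cos (F x / 2) * (G x / 2) : ℝ) : ℂ) x := fun x => ((dF x).sin).ofReal_comp
    have dE1 : ∀ x : ℝ, HasDerivAt (fun x : ℝ => exp (-(I * l * x)))
        (exp (-(I * l * x)) * (-(I * l * 1))) x := fun x =>
      (((hasDerivAt_id x).ofReal_comp.const_mul (I * (l : ℂ))).neg).cexp
    have dE2 : ∀ x : ℝ, HasDerivAt (fun x : ℝ => exp (I * l * x))
        (exp (I * l * x) * (I * l * 1)) x := fun x =>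
      ((hasDerivAt_id x).ofReal_comp.const_mul (I * (l : ℂ))).cexp
    have hce : ∀ x : ℝ, conj (exp (-(I * l * x))) = exp (I * l * x) := fun x => by
      rw [← exp_conj]; simp
    have hce' : ∀ x : ℝ, conj (exp (I * l * x)) = exp (-(I * l * x)) := fun x => by
      rw [← exp_conj]; simp
    refine ⟨fun x => ?_, fun x => ?_, ?_, ?_⟩
    · have d := ((((dC x).mul (hasDerivAt_conj (hj.deriv_left x))).add
        (((dS x).mul (dE1 x)).mul (hasDerivAt_conj (hj.deriv_right x)))).const_mul (σ : ℂ))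
      refine d.congr_deriv ?_
      have hCS : (Real.cos (F x / 2) : ℂ) ^ 2 + (Real.sin (F x / 2) : ℂ) ^ 2 = 1 := by
        exact_mod_cast Real.cos_sq_add_sin_sq (F x / 2)
      have hEE := hexp x
      have hn : exp (-(I * ((-l : ℝ) : ℂ) * x)) = exp (I * l * x) := by
        push_cast; congr 1; ring
      simp only [hA, hB, Pi.mul_apply]
      generalize D.al l x = al
      generalize D.be l x = be
      simp only [hD, hD₁, pot, Potential.kap, Potential.off, Potential.amp, hn, map_sub, map_add,
        map_mul, map_div₀, map_neg, conj_I, conj_ofReal, hce, hce', heps, Real.cos_neg,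
        Real.sin_neg, (hx2 x).1, (hx2 x).2, map_ofNat]
      generalize Real.cos (F x / 2) = c at *
      generalize Real.sin (F x / 2) = s at *
      push_cast
      generalize exp (-(I * l * x)) = E at *
      generalize exp (I * l * x) = E' at *
      linear_combination (σ * s * conj al * (-I * (2 * eps l + 2 * l) * (2 * s * c)
        + 2 * G x) / 4) * hEE + (σ * I * l * s * E * conj be) * hCS
    · have d := (((((dS x).neg).mul (dE2 x)).mul (hasDerivAt_conj (hj.deriv_left x))).add
        ((dC x).mul (hasDerivAt_conj (hj.deriv_right x)))).const_mul (σ : ℂ)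
      refine d.congr_deriv ?_
      have hCS : (Real.cos (F x / 2) : ℂ) ^ 2 + (Real.sin (F x / 2) : ℂ) ^ 2 = 1 := by
        exact_mod_cast Real.cos_sq_add_sin_sq (F x / 2)
      have hEE := hexp x
      have hn : exp (-(I * ((-l : ℝ) : ℂ) * x)) = exp (I * l * x) := by
        push_cast; congr 1; ring
      simp only [hA, hB, Pi.mul_apply, Pi.neg_apply]
      generalize D.al l x = al
      generalize D.be l x = be
      simp only [hD, hD₁, pot, Potential.kap, Potential.off, Potential.amp, hn, map_sub, map_add,
        map_mul, map_div₀, map_neg, conj_I, conj_ofReal, hce, hce', heps, Real.cos_neg,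
        Real.sin_neg, (hx2 x).1, (hx2 x).2, map_ofNat]
      generalize Real.cos (F x / 2) = c at *
      generalize Real.sin (F x / 2) = s at *
      push_cast
      generalize exp (-(I * l * x)) = E at *
      generalize exp (I * l * x) = E' at *
      linear_combination (σ * s * conj be * (I * (2 * eps l + 2 * l) * (2 * s * c)
        + 2 * G x) / 4) * hEE + (σ * I * l * s * E' * conj al) * hCS
    · have := (limA atTop σ 1 0 hc hs hj.lim_left hj.lim_right).1
      rwa [hσ', one_mul, map_one] at this
    · have := (limA atTop σ 1 0 hc hs hj.lim_left hj.lim_right).2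
      rwa [hσ', one_mul, map_zero] at this
  have hsc : HasScattering (D₁.kap (-l)) (D₁.off (-l)) (σ * τ * conj (D.a l)) (σ * τ * conj (D.b l)) :=
    ⟨A, B, hjost, limA atBot τ _ _ hc' hs' hla hlb⟩
  obtain ⟨h1, h2⟩ := (hr₁.hasScattering (-l)).unique (hr₁.admissible (-l)) hsc
  refine ⟨σ * τ, by rw [mul_pow, hσ, hτ, one_mul], ?_, ?_⟩
  · rw [h1]; push_cast; rfl
  · rw [h2]; push_cast; rfl

end Profile

/-! ### The reflection coefficient on the line -/

/-- Without spectral singularities, the reflection coefficient lies in `H^{1,1}` as a function of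
`λ`. -/
theorem Profile.exists_lineSob_rho {F G g h k : ℝ → ℝ} (p : Profile F G g h k)
    (ha : ∀ l, (pot F G h).a l ≠ 0) : ∃ W, LineSob (pot F G h).rho W := by
  have hne : ∀ σ : ℝ, σ ^ 2 = 1 → (σ : ℂ) ≠ 0 := fun σ hσ h0 => by
    rw [ofReal_eq_zero.1 h0] at hσ; norm_num at hσ
  obtain ⟨w, h1, h2, h3, h4⟩ := p.weighted.rho_mem fun l _ => ha l
  obtain ⟨w', h1', h2', h3', h4'⟩ := p.neg.weighted.rho_mem fun l _ => by
    obtain ⟨σ, hσ, e, -⟩ := p.exists_scattering_neg (-l)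
    rw [neg_neg] at e
    rw [e]
    exact mul_ne_zero (hne σ hσ) (by simpa using ha (-l))
  refine HalfSob.exists_lineSob ⟨h1, h2, h3, h4⟩ ⟨h1', h2', h3', h4'⟩ fun l _ => ?_
  obtain ⟨σ, hσ, e, e'⟩ := p.exists_scattering_neg (-l)
  rw [neg_neg] at e e'
  rw [Potential.rho, Potential.rho, e, e', map_div₀, map_neg, map_mul, map_mul, map_mul, conj_conj,
    conj_conj, conj_conj, conj_ofReal, neg_mul_eq_mul_neg, mul_div_mul_left _ _ (hne σ hσ)]

/-! ### From `λ` to `z` -/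

/-- `λ = (z - 1 / z) / 2`. -/
def lam (z : ℝ) : ℝ := (z - z⁻¹) / 2

theorem eps_lam {z : ℝ} (hz : 0 < z) : eps (lam z) = z⁻¹ := by
  have h1 : lam z ^ 2 + 1 = ((z + z⁻¹) / 2) ^ 2 := by
    unfold lam; field_simp; ring
  rw [eps, h1, Real.sqrt_sq (by positivity), lam]
  ring

theorem lam_eps (l : ℝ) : lam (eps (-l)) = l := by
  have h := eps_mul_eps_neg l
  rw [lam, inv_eq_of_mul_eq_one_left h]
  unfold eps; rw [neg_sq]; ring

theorem hasDerivAt_lam {z : ℝ} (hz : z ≠ 0) : HasDerivAt lam ((1 + (z ^ 2)⁻¹) / 2) z := by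
  have := ((hasDerivAt_id z).sub (hasDerivAt_inv hz)).div_const 2
  convert! this using 1
  ring

theorem lam_lt_lam {x y : ℝ} (hx : 0 < x) (hxy : x < y) : lam x < lam y := by
  have := inv_strictAnti₀ hx hxy
  unfold lam; linarith

theorem injOn_lam : InjOn lam (Ioi 0) := by
  have : StrictMonoOn lam (Ioi 0) := fun x hx y _ hxy => lam_lt_lam hx hxy
  exact this.injOn

theorem lam_image_Ioi : lam '' Ioi 0 = univ :=
  eq_univ_of_forall fun l => ⟨eps (-l), eps_pos _, lam_eps l⟩

theorem lam_image_Ioc {x y : ℝ} (hx : 0 < x) (hxy : x ≤ y) :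
    lam '' Ioc x y = Ioc (lam x) (lam y) := by
  have hle : ∀ {a b : ℝ}, 0 < a → a ≤ b → lam a ≤ lam b := fun ha hab => by
    rcases hab.eq_or_lt with rfl | h
    · exact le_rfl
    · exact (lam_lt_lam ha h).le
  ext l
  constructor
  · rintro ⟨z, hz, rfl⟩
    exact ⟨lam_lt_lam hx hz.1, hle (hx.trans hz.1) hz.2⟩
  · intro hl
    refine ⟨eps (-l), ⟨?_, ?_⟩, lam_eps l⟩
    · by_contra! hc
      have := hle (eps_pos _) hc
      rw [lam_eps] at this
      exact absurd hl.1 (not_lt.2 this)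
    · by_contra! hc
      have := lam_lt_lam (hx.trans_le hxy) hc
      rw [lam_eps] at this
      exact absurd hl.2 (not_le.2 this)

/-- The change of variables `λ = (z - 1 / z) / 2` on `z > 0`. -/
theorem lintegral_comp_lam (f : ℝ → ℝ≥0∞) :
    ∫⁻ z in Ioi (0 : ℝ), ENNReal.ofReal ((1 + (z ^ 2)⁻¹) / 2) * f (lam z) = ∫⁻ l, f l := by
  have h := lintegral_image_eq_lintegral_abs_deriv_mul measurableSet_Ioi
    (fun z hz => (hasDerivAt_lam (ne_of_gt hz)).hasDerivWithinAt) injOn_lam f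
  rw [lam_image_Ioi, Measure.restrict_univ] at h
  rw [h]
  refine setLIntegral_congr_fun measurableSet_Ioi fun z hz => ?_
  rw [abs_of_pos (by positivity)]

theorem wt_lam_sq {z : ℝ} (hz : 0 < z) : wt (lam z) ^ 2 = (z ^ 2 + 2 + (z ^ 2)⁻¹) / 4 := by
  rw [wt_sq, lam]; field_simp; ring

theorem measurable_lam : Measurable lam := by unfold lam; fun_prop

namespace LineSob

variable {u w R : ℝ → ℂ}

/-- As `z → 0⁺`, `1 / z` is comparable to `⟨λ⟩`, and `⟨λ⟩ u(λ)` tends to zero at `-∞`. -/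
theorem tendsto_comp_lam_div (h : LineSob u w) :
    Tendsto (fun z : ℝ => u (lam z) / z) (𝓝[>] 0) (𝓝 0) := by
  have h1 : Tendsto lam (𝓝[>] 0) atBot := by
    have h2 : Tendsto (fun z : ℝ => z) (𝓝[>] 0) (𝓝 0) := tendsto_id.mono_left nhdsWithin_le_nhds
    have h3 := (h2.add_atBot (tendsto_neg_atTop_atBot.comp tendsto_inv_nhdsGT_zero)).atBot_div_const
      (two_pos : (0 : ℝ) < 2)
    refine h3.congr fun z => ?_
    simp [lam, sub_eq_add_neg]
  have h2 := (h.tendsto_wt_mul.comp h1).norm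
  rw [norm_zero] at h2
  have h3 := h2.const_mul 2
  rw [mul_zero] at h3
  refine squeeze_zero_norm' ?_ h3
  filter_upwards [self_mem_nhdsWithin] with z hz
  have hz : 0 < z := hz
  have hw : z⁻¹ ≤ 2 * wt (lam z) := by
    have e := wt_lam_sq hz
    refine abs_le_of_sq_le_sq' ?_ (by linarith [one_le_wt (lam z)]) |>.2
    rw [mul_pow, e, inv_pow]
    nlinarith [sq_nonneg z]
  rw [norm_div, norm_real, Real.norm_of_nonneg hz.le, Function.comp, norm_mul, norm_real,
    Real.norm_of_nonneg (one_pos.trans_le (one_le_wt _)).le, div_eq_mul_inv, mul_comm, ← mul_assoc]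
  exact mul_le_mul_of_nonneg_right hw (norm_nonneg _)

/-- Change of variables on the half line `z > 0`. -/
theorem exists_halfSob_comp_lam (h : LineSob u w) (hR : ∀ z, 0 < z → R z = u (lam z))
    (hR0 : R 0 = 0) : ∃ v, HalfSob R v := by
  set v : ℝ → ℂ := fun z => ((1 + (z ^ 2)⁻¹) / 2 : ℝ) * w (lam z) with hv
  have hvm : Measurable v := by
    refine Measurable.mul (measurable_ofReal.comp ?_) (h.meas.comp measurable_lam)
    fun_prop
  have key : ∀ f : ℝ → ℂ, ∫⁻ l, ‖wt l * f l‖ₑ ^ 2 < ⊤ → ∀ φ : ℝ → ℂ,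
      (∀ z, 0 < z → ‖φ z‖ ^ 2 ≤ 8 * ((1 + (z ^ 2)⁻¹) / 2) * ‖(wt (lam z) : ℂ) * f (lam z)‖ ^ 2) →
      ∫⁻ z in Ioi (0 : ℝ), ‖φ z‖ₑ ^ 2 < ⊤ := by
    intro f hf φ hφ
    have h1 : ∀ z ∈ Ioi (0 : ℝ), ‖φ z‖ₑ ^ 2 ≤ 8 * (ENNReal.ofReal ((1 + (z ^ 2)⁻¹) / 2)
        * ‖(wt (lam z) : ℂ) * f (lam z)‖ₑ ^ 2) := by
      intro z hz
      have h2 := ENNReal.ofReal_le_ofReal (hφ z hz)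
      have hz' : (0 : ℝ) ≤ (1 + (z ^ 2)⁻¹) / 2 := by positivity
      rwa [ENNReal.ofReal_mul (by positivity), ENNReal.ofReal_mul (by norm_num),
        ENNReal.ofReal_pow (norm_nonneg _), ENNReal.ofReal_pow (norm_nonneg _), ofReal_norm,
        ofReal_norm, ENNReal.ofReal_ofNat, mul_assoc] at h2
    refine (setLIntegral_mono' measurableSet_Ioi h1).trans_lt ?_
    rw [lintegral_const_mul' _ _ (by simp),
      lintegral_comp_lam fun l => ‖(wt l : ℂ) * f l‖ₑ ^ 2]
    exact ENNReal.mul_lt_top (by simp) hf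
  have hl2' : ∫⁻ z in Ioi (0 : ℝ), ‖wt z * v z‖ₑ ^ 2 < ⊤ := by
    refine key w h.l2' _ fun z hz => ?_
    simp only [hv]
    rw [norm_mul, norm_mul, norm_mul, norm_real, norm_real, norm_real, mul_pow, mul_pow, mul_pow,
      Real.norm_eq_abs, Real.norm_eq_abs, Real.norm_eq_abs, sq_abs, sq_abs, sq_abs, wt_lam_sq hz,
      wt_sq, ← mul_assoc, ← mul_assoc]
    refine mul_le_mul_of_nonneg_right ?_ (by positivity)
    have e : (z ^ 2 + 1) * (1 + (z ^ 2)⁻¹) = z ^ 2 + 2 + (z ^ 2)⁻¹ := by field_simp; ring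
    have h0 : 0 < (1 + (z ^ 2)⁻¹) := by positivity
    have h1 : 0 ≤ (1 + (z ^ 2)⁻¹) * (z ^ 2 + 2 + (z ^ 2)⁻¹) := by positivity
    calc (z ^ 2 + 1) * ((1 + (z ^ 2)⁻¹) / 2) ^ 2
        = (1 + (z ^ 2)⁻¹) * ((z ^ 2 + 1) * (1 + (z ^ 2)⁻¹)) / 4 := by ring
      _ ≤ 8 * ((1 + (z ^ 2)⁻¹) / 2) * ((z ^ 2 + 2 + (z ^ 2)⁻¹) / 4) := by rw [e]; linarith
  have hl2 : ∫⁻ z in Ioi (0 : ℝ), ‖wt z * R z‖ₑ ^ 2 < ⊤ := by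
    refine key u h.l2 _ fun z hz => ?_
    rw [hR z hz, norm_mul, norm_mul, norm_real, norm_real, mul_pow, mul_pow,
      Real.norm_eq_abs, Real.norm_eq_abs, sq_abs, sq_abs, wt_lam_sq hz, wt_sq, ← mul_assoc]
    refine mul_le_mul_of_nonneg_right ?_ (by positivity)
    have h0 : 0 < (z ^ 2)⁻¹ := by positivity
    have h1 : 0 < z ^ 2 := by positivity
    nlinarith [mul_pos h0 h1]
  have hvi : IntegrableOn v (Ioi 0) := integrableOn_of_weighted hvm hl2'
  have hpos : ∀ x y, 0 < x → x ≤ y → R y - R x = ∫ t in x..y, v t := by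
    intro x y hx hxy
    have hle : lam x ≤ lam y := by
      rcases hxy.eq_or_lt with rfl | h
      · exact le_rfl
      · exact (lam_lt_lam hx h).le
    have hs : Ioc x y ⊆ Ioi 0 := fun t ht => hx.trans ht.1
    rw [hR x hx, hR y (hx.trans_le hxy), h.ftc, intervalIntegral.integral_of_le hle,
      intervalIntegral.integral_of_le hxy, ← lam_image_Ioc hx hxy,
      integral_image_eq_integral_abs_deriv_smul measurableSet_Ioc
        (fun z hz => (hasDerivAt_lam (ne_of_gt (hs hz))).hasDerivWithinAt) (injOn_lam.mono hs)]
    refine setIntegral_congr_fun measurableSet_Ioc fun z hz => ?_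
    have hz0 : 0 < (1 + (z ^ 2)⁻¹) / 2 := by positivity
    simp only [hv, abs_of_pos hz0, real_smul]
  refine ⟨v, hvm, hl2, hl2', fun x y hx hxy => ?_⟩
  rcases hx.eq_or_lt with rfl | hx
  · rcases hxy.eq_or_lt with rfl | hy
    · simp
    -- the identity on `[x, y]` passes to the limit `x → 0`, as `R` vanishes at zero
    have hR1 : Tendsto R (𝓝[>] 0) (𝓝 0) := by
      have h2 : Tendsto (fun z : ℝ => (z : ℂ)) (𝓝[>] 0) (𝓝 0) := by
        have := (continuous_ofReal.tendsto 0).mono_left (nhdsWithin_le_nhds (s := Ioi 0))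
        simpa using this
      have h3 := h.tendsto_comp_lam_div.mul h2
      rw [mul_zero] at h3
      refine h3.congr' ?_
      filter_upwards [self_mem_nhdsWithin] with z hz
      have : (z : ℂ) ≠ 0 := by exact_mod_cast (ne_of_gt hz : z ≠ 0)
      rw [hR z hz, div_mul_cancel₀ _ this]
    have hc : Tendsto (fun x => ∫ t in x..y, v t) (𝓝[>] 0) (𝓝 (∫ t in 0..y, v t)) := by
      have h1 := intervalIntegral.continuousOn_primitive_interval_left
        (μ := volume) (f := v) (a := 0) (b := y) (by
          rw [uIcc_of_le hxy, integrableOn_Icc_iff_integrableOn_Ioc]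
          exact hvi.mono_set fun t ht => ht.1)
      rw [uIcc_of_le hxy] at h1
      refine (h1 0 ⟨le_rfl, hxy⟩).mono_left ?_
      rw [← nhdsWithin_Ioc_eq_nhdsGT hy]
      exact nhdsWithin_mono _ Ioc_subset_Icc_self
    rw [hR0]
    refine tendsto_nhds_unique (hR1.const_sub (R y)) (hc.congr' ?_)
    filter_upwards [Ioo_mem_nhdsGT hy] with x hx
    exact (hpos x y hx.1 hx.2.le).symm
  · exact hpos x y hx hxy

/-- A function of `λ` in `H^{1,1}`, extended to `z < 0` by conjugation, lies in `H^{1,1}` as a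
function of `z`. -/
theorem exists_comp_lam (h : LineSob u w) (hp : ∀ z, 0 < z → R z = u (lam z))
    (hn : ∀ z, 0 < z → R (-z) = conj (u (lam z))) (h0 : R 0 = 0) :
    (∃ V, LineSob R V) ∧ Tendsto (fun z : ℝ => R z / z) (𝓝[≠] 0) (𝓝 0) := by
  obtain ⟨v, hv⟩ := h.exists_halfSob_comp_lam hp h0
  refine ⟨hv.exists_lineSob hv fun z hz => ?_, ?_⟩
  · rcases hz.eq_or_lt with rfl | hz
    · simp [h0]
    · rw [hn z hz, hp z hz]
  · have h1 := (h.tendsto_comp_lam_div.comp tendsto_abs_nhdsNE_zero).norm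
    rw [norm_zero] at h1
    rw [tendsto_zero_iff_norm_tendsto_zero]
    refine h1.congr' ?_
    filter_upwards [self_mem_nhdsWithin] with z hz
    rcases lt_or_gt_of_ne (hz : z ≠ 0) with h2 | h2
    · have h3 := hn (-z) (neg_pos.2 h2)
      rw [neg_neg] at h3
      rw [h3, Function.comp, abs_of_neg h2, norm_div, norm_div, RCLike.norm_conj, ofReal_neg,
        norm_neg]
    · rw [hp z h2, Function.comp, abs_of_pos h2]

end LineSob

/-! ### Weak derivatives on the line -/

/-- An absolutely continuous function is weakly differentiable. -/
theorem hasWeakDeriv_of_forall_sub_eq {u w : ℝ → ℂ} (hw : LocallyIntegrable w)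
    (hu : ∀ x y, u y - u x = ∫ t in x..y, w t) : HasWeakDeriv u w := by
  have hi : ∀ a b, IntervalIntegrable w volume a b := fun a b =>
    (hw.integrableOn_isCompact isCompact_uIcc).intervalIntegrable
  have huc : Continuous u := by
    have : u = fun y => u 0 + ∫ t in (0 : ℝ)..y, w t := by
      ext y; rw [← hu]; ring
    rw [this]
    exact continuous_const.add (intervalIntegral.continuous_primitive hi 0)
  refine ⟨huc.locallyIntegrable, hw, fun φ hφ hs => ?_⟩
  have hφ1 : ContDiff ℝ 1 φ := hφ.of_le (by exact_mod_cast le_top)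
  have hd : ∀ x, HasDerivAt (fun x => (φ x : ℂ)) ((deriv φ x : ℝ) : ℂ) x := fun x =>
    ((hφ1.differentiable (by norm_num) x).hasDerivAt).ofReal_comp
  obtain ⟨r, hr⟩ := hs.isCompact.isBounded.subset_closedBall 0
  rw [Real.closedBall_eq_Icc, zero_sub, zero_add] at hr
  set R := max r 0 + 1 with hR
  have hsub : tsupport φ ⊆ Ioo (-R) R := fun x hx => by
    have h1 := hr hx
    have h2 := le_max_left r 0
    exact ⟨by linarith [h1.1], by linarith [h1.2]⟩
  have hz : ∀ x, x ∉ Ioo (-R) R → φ x = 0 := fun x hx =>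
    image_eq_zero_of_notMem_tsupport fun h => hx (hsub h)
  have hz' : ∀ x, x ∉ Ioo (-R) R → deriv φ x = 0 := fun x hx =>
    Function.notMem_support.1 fun h => hx (hsub (support_deriv_subset h))
  have e1 : ∫ t in (-R)..R, deriv φ t • u t = ∫ t, deriv φ t • u t :=
    intervalIntegral.integral_eq_integral_of_support_subset fun x hx => by
      by_contra h
      exact hx (by simp only [hz' x fun h' => h ⟨h'.1, h'.2.le⟩, zero_smul])
  have e2 : ∫ t in (-R)..R, φ t • w t = ∫ t, φ t • w t :=
    intervalIntegral.integral_eq_integral_of_support_subset fun x hx => by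
      by_contra h
      exact hx (by simp only [hz x fun h' => h ⟨h'.1, h'.2.le⟩, zero_smul])
  have h := mul_sub_mul_eq_integral hi hu hd
    (continuous_ofReal.comp (hφ1.continuous_deriv le_rfl)) (-R) R
  have hc : Continuous fun t => deriv φ t • u t := (hφ1.continuous_deriv le_rfl).smul huc
  have hi2 : IntervalIntegrable (fun t => φ t • w t) volume (-R) R := by
    simpa only [real_smul, Function.comp_apply] using
      (hi _ _).continuousOn_mul (continuous_ofReal.comp hφ1.continuous).continuousOn
  rw [hz R (fun h => lt_irrefl _ h.2), hz (-R) (fun h => lt_irrefl _ h.1)] at h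
  rw [← e1, ← e2, eq_neg_iff_add_eq_zero,
    ← intervalIntegral.integral_add (hc.intervalIntegrable _ _) hi2]
  simp only [ofReal_zero, mul_zero, sub_zero] at h
  rw [h]
  refine intervalIntegral.integral_congr fun t _ => ?_
  simp only [real_smul]
  ring

theorem hasWeakDeriv_of_forall_sub_eq_real {u w : ℝ → ℝ} (hw : LocallyIntegrable w)
    (hu : ∀ x y, u y - u x = ∫ t in x..y, w t) : HasWeakDeriv u w := by
  have hwc : LocallyIntegrable fun x => (w x : ℂ) := fun x => by
    obtain ⟨s, hs, h⟩ := hw x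
    exact ⟨s, hs, Integrable.ofReal h⟩
  obtain ⟨h1, -, h3⟩ := hasWeakDeriv_of_forall_sub_eq (u := fun x => (u x : ℂ)) hwc fun x y => by
    rw [intervalIntegral.integral_ofReal, ← hu]; push_cast; rfl
  refine ⟨fun x => ?_, hw, fun φ hφ hs => ?_⟩
  · obtain ⟨s, hs, h⟩ := h1 x
    exact ⟨s, hs, Integrable.re h⟩
  · have := h3 φ hφ hs
    simp only [real_smul, ← ofReal_mul, integral_complex_ofReal] at this
    simp only [smul_eq_mul]
    exact_mod_cast this

theorem HasWeakDeriv.ae_unique {E : Type*} [NormedAddCommGroup E] [NormedSpace ℝ E]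
    [CompleteSpace E] {u v v' : ℝ → E} (h : HasWeakDeriv u v) (h' : HasWeakDeriv u v') :
    v =ᵐ[volume] v' :=
  ae_eq_of_integral_contDiff_smul_eq h.2.1 h'.2.1 fun φ hφ hs =>
    neg_injective ((h.2.2 φ hφ hs).symm.trans (h'.2.2 φ hφ hs))

theorem HasWeakDeriv.congr_ae {E : Type*} [NormedAddCommGroup E] [NormedSpace ℝ E]
    {u u' v v' : ℝ → E} (h : HasWeakDeriv u v) (hu : u =ᵐ[volume] u') (hv : v =ᵐ[volume] v') :
    HasWeakDeriv u' v' := by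
  refine ⟨h.1.congr hu, h.2.1.congr hv, fun φ hφ hs => ?_⟩
  rw [← integral_congr_ae (hu.mono fun x hx => by simp only [hx] : (fun x => deriv φ x • u x)
      =ᵐ[volume] fun x => deriv φ x • u' x),
    ← integral_congr_ae (hv.mono fun x hx => by simp only [hx] : (fun x => φ x • v x)
      =ᵐ[volume] fun x => φ x • v' x)]
  exact h.2.2 φ hφ hs

theorem WeaklyDifferentiable.hasWeakDeriv {E : Type*} [NormedAddCommGroup E] [NormedSpace ℝ E]
    {u : ℝ → E} (h : WeaklyDifferentiable u) : HasWeakDeriv u (weakDeriv u) := by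
  rw [weakDeriv, dif_pos h]
  exact h.choose_spec

/-- A test function with vanishing integral is the derivative of a test function. -/
theorem exists_deriv_eq_of_integral_eq_zero {ψ : ℝ → ℝ} (hψ : ContDiff ℝ ∞ ψ)
    (hs : HasCompactSupport ψ) (h0 : ∫ x, ψ x = 0) :
    ∃ φ : ℝ → ℝ, ContDiff ℝ ∞ φ ∧ HasCompactSupport φ ∧ deriv φ = ψ := by
  obtain ⟨r, hr⟩ := hs.isCompact.isBounded.subset_closedBall 0
  rw [Real.closedBall_eq_Icc, zero_sub, zero_add] at hr
  set R := max r 0 + 1 with hR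
  have hsub : tsupport ψ ⊆ Ioo (-R) R := fun x hx => by
    have h1 := hr hx
    have h2 := le_max_left r 0
    exact ⟨by linarith [h1.1], by linarith [h1.2]⟩
  have hz : ∀ x, x ∉ Ioo (-R) R → ψ x = 0 := fun x hx =>
    image_eq_zero_of_notMem_tsupport fun h => hx (hsub h)
  have hd : ∀ x, HasDerivAt (fun x => ∫ t in (-R)..x, ψ t) (ψ x) x := fun x =>
    (hψ.continuous.integral_hasStrictDerivAt (-R) x).hasDerivAt
  have hderiv : deriv (fun x => ∫ t in (-R)..x, ψ t) = ψ := funext fun x => (hd x).deriv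
  refine ⟨fun x => ∫ t in (-R)..x, ψ t, ?_, ?_, hderiv⟩
  · rw [contDiff_infty_iff_deriv, hderiv]
    exact ⟨fun x => (hd x).differentiableAt, hψ⟩
  · refine HasCompactSupport.intro (isCompact_Icc (a := -R) (b := R)) fun x hx => ?_
    rcases le_or_gt x (-R) with h | h
    · rw [intervalIntegral.integral_symm, neg_eq_zero]
      refine intervalIntegral.integral_zero_ae (Eventually.of_forall fun t ht => hz t fun h' => ?_)
      rw [uIoc_of_le h] at ht
      exact absurd h'.1 (not_lt.2 ht.2)
    · have hx' : R < x := by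
        by_contra! hc
        exact hx ⟨h.le, hc⟩
      rw [intervalIntegral.integral_eq_integral_of_support_subset, h0]
      intro t ht
      by_contra hc
      exact ht (hz t fun h' => hc ⟨h'.1, (h'.2.trans hx').le⟩)

/-- **Du Bois-Reymond lemma**: a function with vanishing weak derivative is constant. -/
theorem exists_ae_eq_const {w : ℝ → ℝ} (h : HasWeakDeriv w fun _ => 0) :
    ∃ c : ℝ, w =ᵐ[volume] fun _ => c := by
  obtain ⟨hw, -, hz⟩ := h
  set η : ℝ → ℝ := bump.normed volume with hη
  have hη1 : ContDiff ℝ ∞ η := bump.contDiff_normed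
  have hη2 : HasCompactSupport η := bump.hasCompactSupport_normed
  have hη3 : ∫ x, η x = 1 := bump.integral_normed
  have hwi : ∀ ψ : ℝ → ℝ, Continuous ψ → HasCompactSupport ψ → Integrable fun x => ψ x • w x :=
    fun ψ h1 h2 => hw.integrable_smul_left_of_hasCompactSupport h1 h2
  refine ⟨∫ x, η x • w x, ae_eq_of_integral_contDiff_smul_eq hw
    (locallyIntegrable_const _) fun ψ hψ hs => ?_⟩
  set m := ∫ x, ψ x with hm
  have hψi : Integrable ψ := hψ.continuous.integrable_of_hasCompactSupport hs
  have hηi : Integrable η := hη1.continuous.integrable_of_hasCompactSupport hη2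
  obtain ⟨φ, hφ, hφs, hφd⟩ := exists_deriv_eq_of_integral_eq_zero (ψ := fun x => ψ x - m * η x)
    (hψ.sub (contDiff_const.mul hη1)) (hs.sub (hη2.mul_left))
    (by rw [integral_sub hψi (hηi.const_mul m), integral_const_mul, hη3, mul_one, sub_self])
  have h1 := hz φ hφ hφs
  rw [hφd] at h1
  have hi2 : Integrable fun x => m • η x • w x := (hwi η hη1.continuous hη2).smul m
  simp only [smul_zero, integral_zero, neg_zero, sub_smul, mul_smul] at h1
  rw [integral_sub (hwi ψ hψ.continuous hs) hi2, integral_smul, sub_eq_zero] at h1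
  rw [h1]
  simp only [smul_eq_mul]
  rw [integral_mul_const]

/-- A weakly differentiable function is almost everywhere equal to an absolutely continuous one. -/
theorem HasWeakDeriv.exists_ae_eq {u v : ℝ → ℝ} (h : HasWeakDeriv u v) :
    ∃ c : ℝ, u =ᵐ[volume] fun x => c + ∫ t in (0 : ℝ)..x, v t := by
  have hi : ∀ a b, IntervalIntegrable v volume a b := fun a b =>
    (h.2.1.integrableOn_isCompact isCompact_uIcc).intervalIntegrable
  set p : ℝ → ℝ := fun x => ∫ t in (0 : ℝ)..x, v t with hp
  obtain ⟨h1, -, h3⟩ := hasWeakDeriv_of_forall_sub_eq_real (u := p) h.2.1 fun x y =>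
    intervalIntegral.integral_interval_sub_left (hi 0 y) (hi 0 x)
  have hd : HasWeakDeriv (fun x => u x - p x) fun _ => (0 : ℝ) := by
    refine ⟨h.1.sub h1, locallyIntegrable_const _, fun φ hφ hs => ?_⟩
    have hφ1 : ContDiff ℝ 1 φ := hφ.of_le (by exact_mod_cast le_top)
    have hc := hφ1.continuous_deriv le_rfl
    simp only [smul_sub, smul_zero, integral_zero, neg_zero]
    rw [integral_sub (h.1.integrable_smul_left_of_hasCompactSupport hc hs.deriv)
      (h1.integrable_smul_left_of_hasCompactSupport hc hs.deriv), h.2.2 φ hφ hs, h3 φ hφ hs,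
      sub_self]
  obtain ⟨c, hc⟩ := exists_ae_eq_const hd
  exact ⟨c, hc.mono fun x hx => by simp only at hx ⊢; linarith⟩

theorem MemL21.lintegral_lt_top {u v : ℝ → ℝ} (h : MemL21 u) (huv : u =ᵐ[volume] v) :
    ∫⁻ x, ‖wt x * v x‖ₑ ^ 2 < ⊤ := by
  have h1 := eLpNorm_lt_top_iff_lintegral_rpow_enorm_lt_top (by simp) (by simp) |>.1 h.2
  simp only [ENNReal.toReal_ofNat, ENNReal.rpow_ofNat, smul_eq_mul] at h1
  refine lt_of_eq_of_lt (lintegral_congr_ae ?_) h1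
  filter_upwards [huv] with x hx
  rw [hx]; rfl

/-- Initial data have regular representatives. -/
theorem exists_profile {f : (ℝ → ℝ) × (ℝ → ℝ)} (hf : f ∈ initialDataSpace) :
    ∃ F G g h k : ℝ → ℝ, Profile F G g h k ∧ f.1 =ᵐ[volume] F ∧ weakDeriv f.1 =ᵐ[volume] G ∧
      f.2 =ᵐ[volume] h := by
  obtain ⟨d1, d2, d3, l1, l2, l3, l4, l5, l6⟩ := hf
  have key : ∀ {u : ℝ → ℝ}, WeaklyDifferentiable u → ∃ U v : ℝ → ℝ, Continuous U ∧ Measurable v ∧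
      u =ᵐ[volume] U ∧ weakDeriv u =ᵐ[volume] v ∧ ∀ x y, U y - U x = ∫ t in x..y, v t := by
    intro u hu
    obtain ⟨c, hc⟩ := hu.hasWeakDeriv.exists_ae_eq
    have hm := hu.hasWeakDeriv.2.1.aestronglyMeasurable
    have hli : LocallyIntegrable (hm.mk _) := hu.hasWeakDeriv.2.1.congr hm.ae_eq_mk
    have hi : ∀ a b, IntervalIntegrable (hm.mk _) volume a b := fun a b =>
      (hli.integrableOn_isCompact isCompact_uIcc).intervalIntegrable
    refine ⟨fun x => c + ∫ t in (0 : ℝ)..x, hm.mk _ t, hm.mk _,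
      continuous_const.add (intervalIntegral.continuous_primitive hi 0),
      hm.stronglyMeasurable_mk.measurable, ?_, hm.ae_eq_mk, fun x y => ?_⟩
    · filter_upwards [hc] with x hx
      rw [hx]
      congr 1
      exact intervalIntegral.integral_congr_ae (hm.ae_eq_mk.mono fun t ht _ => ht)
    · rw [add_sub_add_left_eq_sub]
      exact intervalIntegral.integral_interval_sub_left (hi 0 y) (hi 0 x)
  obtain ⟨G, g, hG, hg, eG, eg, fG⟩ := key d2
  obtain ⟨h, k, hh, hk, eh, ek, fh⟩ := key d3
  obtain ⟨c, hc⟩ := d1.hasWeakDeriv.exists_ae_eq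
  set F : ℝ → ℝ := fun x => c + ∫ t in (0 : ℝ)..x, G t with hF
  have eF : f.1 =ᵐ[volume] F := by
    filter_upwards [hc] with x hx
    rw [hx]
    congr 1
    exact intervalIntegral.integral_congr_ae (eG.mono fun t ht _ => ht)
  refine ⟨F, G, g, h, k, ⟨fun x => ?_, ⟨hG, hg, fG, l3.lintegral_lt_top eG, l4.lintegral_lt_top eg⟩,
    ⟨hh, hk, fh, l5.lintegral_lt_top eh, l6.lintegral_lt_top ek⟩, ?_, ?_⟩, eF, eG, eh⟩
  · exact ((hG.integral_hasStrictDerivAt 0 x).hasDerivAt).const_add c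
  · have := l2.lintegral_lt_top (v := fun x => 1 - Real.cos (F x)) (eF.mono fun x hx => by simp only [hx])
    refine (lintegral_congr fun x => ?_).trans_lt this
    rw [← enorm_neg, ← mul_neg, neg_sub]
  · exact l1.lintegral_lt_top (v := fun x => Real.sin (F x)) (eF.mono fun x hx => by simp only [hx])

/-- The weak derivative of an absolutely continuous function in `H^{1,1}`. -/
theorem LineSob.memH11 {u w r : ℝ → ℂ} (h : LineSob u w) (hr : r =ᵐ[volume] u) : MemH11 r := by
  have hd : HasWeakDeriv r w :=
    (hasWeakDeriv_of_forall_sub_eq h.integrable.locallyIntegrable h.ftc).congr_ae hr.symm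
      EventuallyEq.rfl
  have hwd : WeaklyDifferentiable r := ⟨w, hd⟩
  have hw : weakDeriv r =ᵐ[volume] w := hwd.hasWeakDeriv.ae_unique hd
  have hwt : Continuous fun l => (wt l : ℂ) := continuous_ofReal.comp continuous_wt
  have m1 : MemLp (fun x => (wt x : ℂ) * u x) 2 volume :=
    (memLp_two_iff (hwt.mul h.continuous).aestronglyMeasurable).2 h.l2
  have m2 : MemLp (fun x => (wt x : ℂ) * w x) 2 volume :=
    (memLp_two_iff (hwt.measurable.mul h.meas).aestronglyMeasurable).2 h.l2'
  refine ⟨hwd, (memLp_congr_ae ?_).1 m1, (memLp_congr_ae ?_).1 m2⟩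
  · filter_upwards [hr] with x hx
    rw [hx, real_smul]; rfl
  · filter_upwards [hw] with x hx
    rw [hx, real_smul]; rfl

/-! ### Matrix solutions -/

open scoped Matrix

/-- `Ψ` is a classical solution of `Ψ' = V Ψ`. -/
def IsSol (V Ψ : ℝ → Matrix (Fin 2) (Fin 2) ℂ) : Prop :=
  ∀ x i j, HasDerivAt (fun x => Ψ x i j) ((V x * Ψ x) i j) x

section

variable {V Ψ Ψ₁ Ψ₂ : ℝ → Matrix (Fin 2) (Fin 2) ℂ}

theorem IsSol.mul_const (h : IsSol V Ψ) (S : Matrix (Fin 2) (Fin 2) ℂ) :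
    IsSol V fun x => Ψ x * S := by
  intro x i j
  have := HasDerivAt.fun_sum (u := Finset.univ) fun k _ => (h x i k).mul_const (S k j)
  rw [← Matrix.mul_assoc]
  exact this

/-- If `V` is anti-Hermitian then `Ψ₁* Ψ₂` is constant. -/
theorem IsSol.conjTranspose_mul_eq (hV : ∀ x, (V x)ᴴ = -V x) (h₁ : IsSol V Ψ₁) (h₂ : IsSol V Ψ₂)
    (x y : ℝ) : (Ψ₁ x)ᴴ * Ψ₂ x = (Ψ₁ y)ᴴ * Ψ₂ y := by
  ext i j
  have hd : ∀ x, HasDerivAt (fun x => ((Ψ₁ x)ᴴ * Ψ₂ x) i j) 0 x := by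
    intro x
    have := HasDerivAt.fun_sum (u := Finset.univ)
      fun k _ => (hasDerivAt_conj (h₁ x k i)).mul (h₂ x k j)
    refine this.congr_deriv ?_
    rw [Finset.sum_add_distrib]
    change ((V x * Ψ₁ x)ᴴ * Ψ₂ x) i j + ((Ψ₁ x)ᴴ * (V x * Ψ₂ x)) i j = 0
    rw [Matrix.conjTranspose_mul, hV, Matrix.mul_neg, Matrix.neg_mul, Matrix.mul_assoc,
      Matrix.neg_apply, neg_add_cancel]
  exact is_const_of_deriv_eq_zero (fun x => (hd x).differentiableAt) (fun x => (hd x).deriv) x y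

/-- Conjugation by unimodular diagonal matrices preserves convergence to the identity. -/
theorem tendsto_diagonal_conj {l : Filter ℝ} {X : ℝ → Matrix (Fin 2) (Fin 2) ℂ}
    {d : ℝ → Fin 2 → ℂ} (hd : ∀ x i, ‖d x i‖ = 1) (hX : Tendsto X l (𝓝 1)) :
    Tendsto (fun x => Matrix.diagonal (d x) * X x * (Matrix.diagonal (d x))ᴴ) l (𝓝 1) := by
  have hX' : ∀ i j, Tendsto (fun x => X x i j) l (𝓝 ((1 : Matrix (Fin 2) (Fin 2) ℂ) i j)) :=
    fun i j => ((continuous_id.matrix_elem i j).tendsto (1 : Matrix (Fin 2) (Fin 2) ℂ)).comp hX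
  refine tendsto_pi_nhds.2 fun i => tendsto_pi_nhds.2 fun j => ?_
  have e : ∀ x, (Matrix.diagonal (d x) * X x * (Matrix.diagonal (d x))ᴴ) i j
      = d x i * X x i j * conj (d x j) := fun x => by
    rw [Matrix.diagonal_conjTranspose, Matrix.mul_diagonal, Matrix.diagonal_mul]; rfl
  simp only [e]
  by_cases hij : i = j
  · subst hij
    refine (hX' i i).congr fun x => ?_
    rw [mul_right_comm, mul_conj', hd]; simp
  · have h0 := hX' i j
    rw [Matrix.one_apply_ne hij] at h0 ⊢
    refine squeeze_zero_norm (fun x => le_of_eq ?_) (by simpa using h0.norm)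
    rw [norm_mul, norm_mul, RCLike.norm_conj, hd, hd, one_mul, mul_one]

/-- The oscillating factor `exp (x J(z))`, in terms of `λ`. -/
def osc (l x : ℝ) : Fin 2 → ℂ := ![exp (I * l * x / 2), exp (-(I * l * x / 2))]

theorem norm_osc (l x : ℝ) (i : Fin 2) : ‖osc l x i‖ = 1 := by
  have h : ∀ t : ℝ, ‖exp (I * l * t / 2)‖ = 1 := fun t => by
    have : I * l * t / 2 = ((l * t / 2 : ℝ) : ℂ) * I := by push_cast; ring
    rw [this, norm_exp_ofReal_mul_I]
  fin_cases i
  · exact h x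
  · have := h (-x)
    change ‖exp (-(I * l * x / 2))‖ = 1
    rw [← this]; congr 2; push_cast; ring

theorem osc_unitary (l x : ℝ) :
    Matrix.diagonal (osc l x) * (Matrix.diagonal (osc l x))ᴴ = 1 := by
  rw [Matrix.diagonal_conjTranspose, Matrix.diagonal_mul_diagonal, ← Matrix.diagonal_one]
  congr 1
  ext i
  change osc l x i * conj (osc l x i) = 1
  rw [mul_conj', norm_osc]; simp

theorem exp_smul_J (z x : ℝ) :
    NormedSpace.exp ((x : ℂ) • J z) = Matrix.diagonal (osc (lam z) x) := by
  have : (x : ℂ) • J z = Matrix.diagonal ![I * lam z * x / 2, -(I * lam z * x / 2)] := by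
    ext i j
    fin_cases i <;> fin_cases j <;> simp [J, lam] <;> ring
  rw [this, Matrix.exp_diagonal]
  congr 1
  ext i
  rw [Pi.coe_exp]
  fin_cases i <;> simp [osc, Complex.exp_eq_exp_ℂ]

/-- `Ψ` is a solution of `Ψ' = V Ψ` normalized at the end `l` of the line. -/
def IsNormalized (V : ℝ → Matrix (Fin 2) (Fin 2) ℂ) (lm : ℝ) (l : Filter ℝ)
    (Ψ : ℝ → Matrix (Fin 2) (Fin 2) ℂ) : Prop :=
  IsSol V Ψ ∧ Tendsto (fun x => Ψ x * Matrix.diagonal (osc lm x)) l (𝓝 1)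

theorem IsNormalized.conjTranspose_mul (hV : ∀ x, (V x)ᴴ = -V x) {lm : ℝ} {l : Filter ℝ} [l.NeBot]
    (h₁ : IsNormalized V lm l Ψ₁) (h₂ : IsNormalized V lm l Ψ₂) (x : ℝ) :
    (Ψ₁ x)ᴴ * Ψ₂ x = 1 := by
  have h3 : Tendsto (fun y => (Ψ₁ y * Matrix.diagonal (osc lm y))ᴴ
      * (Ψ₂ y * Matrix.diagonal (osc lm y))) l (𝓝 1) := by
    have := (((continuous_id.matrix_conjTranspose).tendsto
      (1 : Matrix (Fin 2) (Fin 2) ℂ)).comp h₁.2).mul h₂.2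
    simpa using this
  have h4 := tendsto_diagonal_conj (norm_osc lm) h3
  refine tendsto_nhds_unique (tendsto_const_nhds.congr fun y => ?_) h4
  rw [h₁.1.conjTranspose_mul_eq hV h₂.1 x y, Matrix.conjTranspose_mul]
  have e := osc_unitary lm y
  generalize Matrix.diagonal (osc lm y) = D at e
  calc (Ψ₁ y)ᴴ * Ψ₂ y = (D * Dᴴ) * ((Ψ₁ y)ᴴ * Ψ₂ y) * (D * Dᴴ) := by rw [e]; simp
    _ = D * (Dᴴ * (Ψ₁ y)ᴴ * (Ψ₂ y * D)) * Dᴴ := by simp only [Matrix.mul_assoc]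

theorem IsNormalized.unique (hV : ∀ x, (V x)ᴴ = -V x) {lm : ℝ} {l : Filter ℝ} [l.NeBot]
    (h₁ : IsNormalized V lm l Ψ₁) (h₂ : IsNormalized V lm l Ψ₂) : Ψ₁ = Ψ₂ := by
  ext1 x
  have e1 := mul_eq_one_comm.1 (h₁.conjTranspose_mul hV h₁ x)
  calc Ψ₁ x = Ψ₁ x * ((Ψ₁ x)ᴴ * Ψ₂ x) := by rw [h₁.conjTranspose_mul hV h₂ x, Matrix.mul_one]
    _ = Ψ₂ x := by rw [← Matrix.mul_assoc, e1, Matrix.one_mul]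

end

/-- The coefficient matrix of the system. -/
def coeff (lm : ℝ) (κ : ℝ → ℝ) (p : ℝ → ℂ) (x : ℝ) : Matrix (Fin 2) (Fin 2) ℂ :=
  !![-(I * lm / 2) + I * κ x, -conj (p x); p x, I * lm / 2 - I * κ x]

theorem coeff_conjTranspose (lm : ℝ) (κ : ℝ → ℝ) (p : ℝ → ℂ) (x : ℝ) :
    (coeff lm κ p x)ᴴ = -coeff lm κ p x := by
  ext i j
  fin_cases i <;> fin_cases j <;> simp [coeff] <;> ring

/-- The `SU(2)` matrix with first column `(a, b)`. -/
def su (a b : ℂ) : Matrix (Fin 2) (Fin 2) ℂ := !![a, -conj b; b, conj a]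

theorem su_unitary {a b : ℂ} (h : conj a * a + conj b * b = 1) : (su a b)ᴴ * su a b = 1 := by
  ext i j
  fin_cases i <;> fin_cases j <;>
    simp [su, Matrix.mul_apply, Fin.sum_univ_two] <;>
    first | linear_combination h | ring

theorem tendsto_su {l : Filter ℝ} {α β : ℝ → ℂ} {a b : ℂ} (ha : Tendsto α l (𝓝 a))
    (hb : Tendsto β l (𝓝 b)) : Tendsto (fun x => su (α x) (β x)) l (𝓝 (su a b)) := by
  have hc := continuous_conj
  have ha' := (hc.tendsto a).comp ha
  have hb' := ((hc.tendsto b).comp hb).neg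
  refine tendsto_pi_nhds.2 fun i => tendsto_pi_nhds.2 fun j => ?_
  fin_cases i <;> fin_cases j
  exacts [ha, hb', hb, ha']

theorem su_one_zero : su 1 0 = 1 := by
  ext i j
  fin_cases i <;> fin_cases j <;> simp [su]

/-- The matrix solution built from a normalized solution in the interaction picture. -/
theorem JostPair.isSol {κ : ℝ → ℝ} {p α β : ℝ → ℂ} {lm : ℝ}
    (h : JostPair κ (fun x => exp (-(I * lm * x)) * p x) α β) :
    IsSol (coeff lm κ p) fun x => (Matrix.diagonal (osc lm x))ᴴ * su (α x) (β x) := by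
  have e1 : ∀ x : ℝ, conj (exp (I * lm * x / 2)) = exp (-(I * lm * x / 2)) := fun x => by
    rw [← exp_conj]
    simp only [map_mul, map_div₀, conj_I, conj_ofReal, map_ofNat]
    congr 1
    ring
  have e2 : ∀ x : ℝ, conj (exp (-(I * lm * x / 2))) = exp (I * lm * x / 2) := fun x => by
    rw [← e1, conj_conj]
  have e3 : ∀ x : ℝ, exp (I * lm * x / 2) * exp (-(I * lm * x / 2)) = 1 := fun x => by
    rw [← Complex.exp_add]; simp
  have e4 : ∀ x : ℝ, exp (-(I * lm * x)) = exp (-(I * lm * x / 2)) ^ 2 := fun x => by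
    rw [← Complex.exp_nat_mul]; congr 1; push_cast; ring
  have d1 : ∀ x : ℝ, HasDerivAt (fun x : ℝ => exp (I * lm * x / 2))
      (exp (I * lm * x / 2) * (I * lm * 1 / 2)) x := fun x =>
    (((hasDerivAt_id x).ofReal_comp.const_mul (I * (lm : ℂ))).div_const 2).cexp
  have d2 : ∀ x : ℝ, HasDerivAt (fun x : ℝ => exp (-(I * lm * x / 2)))
      (exp (-(I * lm * x / 2)) * (-(I * lm * 1 / 2))) x := fun x =>
    ((((hasDerivAt_id x).ofReal_comp.const_mul (I * (lm : ℂ))).div_const 2).neg).cexp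
  have hent : ∀ x i j, ((Matrix.diagonal (osc lm x))ᴴ * su (α x) (β x)) i j
      = conj (osc lm x i) * su (α x) (β x) i j := fun x i j => by
    rw [Matrix.diagonal_conjTranspose, Matrix.diagonal_mul]; rfl
  intro x i j
  rw [Matrix.mul_apply, Fin.sum_univ_two]
  simp only [hent]
  have hl := h.deriv_left x
  have hr := h.deriv_right x
  fin_cases i <;> fin_cases j <;>
    simp only [osc, su, coeff, Matrix.of_apply, Matrix.cons_val', Matrix.cons_val_zero,
      Matrix.cons_val_one, Matrix.cons_val_fin_one, Fin.zero_eta, Fin.mk_one, Fin.isValue, e1, e2]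
  · refine ((d2 x).mul hl).congr_deriv ?_
    simp only [map_mul, e4, map_pow, e2]
    linear_combination (-conj (p x) * exp (I * lm * x / 2) * β x) * e3 x
  · refine ((d2 x).mul (hasDerivAt_conj hr).neg).congr_deriv ?_
    simp only [map_mul, map_sub, conj_I, conj_ofReal, e4, map_pow, e2, Pi.neg_apply]
    linear_combination (-conj (p x) * exp (I * lm * x / 2) * conj (α x)) * e3 x
  · refine ((d1 x).mul hr).congr_deriv ?_
    simp only [e4]
    linear_combination (p x * exp (-(I * lm * x / 2)) * α x) * e3 x
  · refine ((d1 x).mul (hasDerivAt_conj hl)).congr_deriv ?_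
    simp only [map_mul, map_sub, conj_I, conj_ofReal, conj_conj, e4]
    linear_combination (-p x * exp (-(I * lm * x / 2)) * conj (β x)) * e3 x

/-- Existence and uniqueness of the normalized solutions, and the scattering matrix. -/
theorem HasScattering.isNormalized {κ : ℝ → ℝ} {p : ℝ → ℂ} {lm : ℝ} {a b : ℂ}
    (h : HasScattering κ (fun x => exp (-(I * lm * x)) * p x) a b) :
    ∃ Ψp Ψm : ℝ → Matrix (Fin 2) (Fin 2) ℂ, IsNormalized (coeff lm κ p) lm atTop Ψp ∧
      IsNormalized (coeff lm κ p) lm atBot Ψm ∧ ∀ x, Ψp x = Ψm x * su a b := by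
  have hS := su_unitary h.conj_mul_add
  obtain ⟨α, β, hj, ha, hb⟩ := h
  have hsol := hj.isSol
  have hconj : ∀ {l : Filter ℝ} {X : ℝ → Matrix (Fin 2) (Fin 2) ℂ}, Tendsto X l (𝓝 1) →
      Tendsto (fun x => (Matrix.diagonal (osc lm x))ᴴ * X x * Matrix.diagonal (osc lm x)) l
        (𝓝 1) := by
    intro l X hX
    have := tendsto_diagonal_conj (d := fun x => star (osc lm x))
      (fun x i => by rw [Pi.star_apply, norm_star, norm_osc]) hX
    simpa only [Matrix.diagonal_conjTranspose, star_star] using this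
  refine ⟨fun x => (Matrix.diagonal (osc lm x))ᴴ * su (α x) (β x),
    fun x => (Matrix.diagonal (osc lm x))ᴴ * su (α x) (β x) * (su a b)ᴴ, ⟨hsol, ?_⟩,
    ⟨hsol.mul_const _, ?_⟩, fun x => ?_⟩
  · have := tendsto_su hj.lim_left hj.lim_right
    rw [su_one_zero] at this
    exact hconj this
  · have := (tendsto_su ha hb).mul (tendsto_const_nhds (x := (su a b)ᴴ))
    rw [mul_eq_one_comm.1 hS] at this
    refine (hconj this).congr fun x => ?_
    simp only [Matrix.mul_assoc]
  · rw [Matrix.mul_assoc, hS, Matrix.mul_one]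

/-! ### The system of the initial data -/

/-- The diagonal coefficient at the spectral parameter `z`. -/
def Potential.kapz (D : Potential) (z x : ℝ) : ℝ := z⁻¹ * D.c x / 4

/-- The off-diagonal coefficient at the spectral parameter `z`. -/
def Potential.ampz (D : Potential) (z x : ℝ) : ℂ := (I * (z : ℂ)⁻¹ * D.s x + D.q x) / 4

theorem Potential.Regular.hasScattering_of_pos {D : Potential} (h : D.Regular) {z : ℝ}
    (hz : 0 < z) : HasScattering (D.kapz z) (fun x => exp (-(I * lam z * x)) * D.ampz z x)
      (D.a (lam z)) (D.b (lam z)) := by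
  have := h.hasScattering (lam z)
  convert! this using 1
  · ext x
    rw [Potential.kapz, Potential.kap, eps_lam hz]
  · ext x
    rw [Potential.ampz, Potential.off, Potential.amp, eps_lam hz, ofReal_inv]

/-- Complex conjugation of the system. -/
theorem HasScattering.conj {κ : ℝ → ℝ} {P : ℝ → ℂ} {a b : ℂ} (h : HasScattering κ P a b) :
    HasScattering (fun x => -κ x) (fun x => conj (P x)) (conj a) (conj b) := by
  obtain ⟨α, β, h, ha, hb⟩ := h
  have hc := continuous_conj
  refine ⟨fun x => conj (α x), fun x => conj (β x), ⟨fun x => ?_, fun x => ?_, ?_, ?_⟩,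
    (hc.tendsto a).comp ha, (hc.tendsto b).comp hb⟩
  · refine (hasDerivAt_conj (h.deriv_left x)).congr_deriv ?_
    simp only [map_sub, map_mul, conj_I, conj_ofReal, conj_conj, ofReal_neg]
    ring
  · refine (hasDerivAt_conj (h.deriv_right x)).congr_deriv ?_
    simp only [map_sub, map_mul, conj_I, conj_ofReal, ofReal_neg]
    ring
  · simpa [Function.comp_def] using (hc.tendsto _).comp h.lim_left
  · simpa [Function.comp_def] using (hc.tendsto _).comp h.lim_right

theorem lam_neg (z : ℝ) : lam (-z) = -lam z := by rw [lam, lam, inv_neg]; ring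

/-- At negative spectral parameters the coefficients are the complex conjugates of those at the
opposite positive ones. -/
theorem Potential.Regular.hasScattering_of_neg {D : Potential} (h : D.Regular) {z : ℝ}
    (hz : 0 < z) : HasScattering (D.kapz (-z))
      (fun x => exp (-(I * lam (-z) * x)) * D.ampz (-z) x)
      (conj (D.a (lam z))) (conj (D.b (lam z))) := by
  have := (h.hasScattering_of_pos hz).conj
  convert! this using 1
  · ext x
    simp only [Potential.kapz, inv_neg]; ring
  · ext x
    rw [map_mul, ← exp_conj, lam_neg]
    congr 1
    · congr 1
      simp
    · simp [Potential.ampz, map_ofNat]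

section

variable {f : (ℝ → ℝ) × (ℝ → ℝ)} {F G g h k : ℝ → ℝ}

/-- The data and their regular representatives give the same system almost everywhere. -/
theorem ae_eq_coeff (hF : f.1 =ᵐ[volume] F) (hG : weakDeriv f.1 =ᵐ[volume] G)
    (hh : f.2 =ᵐ[volume] h) (z : ℝ) : ∀ᵐ x, -J z + U f x z
      = coeff (lam z) ((pot F G h).kapz z) ((pot F G h).ampz z) x := by
  filter_upwards [hF, hG, hh] with x h1 h2 h3
  ext i j
  fin_cases i <;> fin_cases j <;>
    simp [J, U, coeff, lam, pot, Potential.kapz, Potential.ampz, h1, h2, h3, map_ofNat,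
      -ofReal_sin, -ofReal_cos] <;> ring

/-- Carathéodory solutions for the data are classical solutions for the regular representatives. -/
theorem isSolution_iff (p : Profile F G g h k) (hF : f.1 =ᵐ[volume] F)
    (hG : weakDeriv f.1 =ᵐ[volume] G) (hh : f.2 =ᵐ[volume] h) (z : ℝ)
    (Ψ : ℝ → Matrix (Fin 2) (Fin 2) ℂ) : IsSolution f z Ψ ↔
      IsSol (coeff (lam z) ((pot F G h).kapz z) ((pot F G h).ampz z)) Ψ := by
  set V := coeff (lam z) ((pot F G h).kapz z) ((pot F G h).ampz z) with hVdef
  have hr := p.weighted.regular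
  have hc := hr.cont_c
  have hs := hr.cont_s
  have hq := hr.cont_q
  have hκ : Continuous ((pot F G h).kapz z) := by unfold Potential.kapz; fun_prop
  have hp : Continuous ((pot F G h).ampz z) := by unfold Potential.ampz; fun_prop
  have hV : ∀ i j, Continuous fun x => V x i j := by
    intro i j
    have hp' := continuous_conj.comp hp
    fin_cases i <;> fin_cases j
    · change Continuous fun x => -(I * lam z / 2) + I * (pot F G h).kapz z x
      fun_prop
    · exact hp'.neg
    · exact hp
    · change Continuous fun x => I * lam z / 2 - I * (pot F G h).kapz z x
      fun_prop
  have hprod : (∀ i j, Continuous fun x => Ψ x i j) → ∀ i j, Continuous fun x => (V x * Ψ x) i j := by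
    intro hΨ i j
    simp only [Matrix.mul_apply]
    exact continuous_finsetSum _ fun m _ => (hV i m).mul (hΨ m j)
  have hint : ∀ x i j, ∫ y in (0 : ℝ)..x, ((-J z + U f y z) * Ψ y) i j
      = ∫ y in (0 : ℝ)..x, (V y * Ψ y) i j := fun x i j =>
    intervalIntegral.integral_congr_ae ((ae_eq_coeff hF hG hh z).mono fun y hy _ => by rw [hy])
  constructor
  · rintro ⟨h1, h2⟩ x i j
    have hΨ : ∀ i j, Continuous fun x => Ψ x i j := fun i j => h1.matrix_elem i j
    have e : (fun x => Ψ x i j) = fun x => Ψ 0 i j + ∫ y in (0 : ℝ)..x, (V y * Ψ y) i j := by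
      ext x; rw [h2 x i j, hint]
    rw [e]
    exact ((hprod hΨ i j).integral_hasStrictDerivAt 0 x).hasDerivAt.const_add _
  · intro h1
    have hΨ : ∀ i j, Continuous fun x => Ψ x i j := fun i j =>
      continuous_iff_continuousAt.2 fun x => (h1 x i j).continuousAt
    refine ⟨continuous_matrix hΨ, fun x i j => ?_⟩
    rw [hint, intervalIntegral.integral_eq_sub_of_hasDerivAt (fun t _ => h1 t i j)
      ((hprod hΨ i j).intervalIntegrable _ _)]
    ring

theorem isJost_iff (p : Profile F G g h k) (hF : f.1 =ᵐ[volume] F)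
    (hG : weakDeriv f.1 =ᵐ[volume] G) (hh : f.2 =ᵐ[volume] h) (z : ℝ) (l : Filter ℝ)
    (Ψ : ℝ → Matrix (Fin 2) (Fin 2) ℂ) : IsJost f z l Ψ ↔ IsNormalized
      (coeff (lam z) ((pot F G h).kapz z) ((pot F G h).ampz z)) (lam z) l Ψ := by
  rw [IsJost, IsNormalized, isSolution_iff p hF hG hh]
  simp only [exp_smul_J]

/-- Existence and uniqueness of the Jost solutions and of the scattering matrix, which is expressed
by the scattering data of the interaction picture. -/
theorem scattering_of_hasScattering (p : Profile F G g h k) (hF : f.1 =ᵐ[volume] F)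
    (hG : weakDeriv f.1 =ᵐ[volume] G) (hh : f.2 =ᵐ[volume] h) {z : ℝ} {a b : ℂ}
    (hs : HasScattering ((pot F G h).kapz z)
      (fun x => exp (-(I * lam z * x)) * (pot F G h).ampz z x) a b) :
    (∃! Ψ, IsJost f z atTop Ψ) ∧ (∃! Ψ, IsJost f z atBot Ψ) ∧ (∃! S, IsScatteringMatrix f z S) ∧
      scatteringMatrix f z = su a b := by
  have hV := coeff_conjTranspose (lam z) ((pot F G h).kapz z) ((pot F G h).ampz z)
  have hJ := isJost_iff p hF hG hh z
  obtain ⟨Ψp, Ψm, hp, hm, hS⟩ := hs.isNormalized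
  have hex : IsScatteringMatrix f z (su a b) := ⟨Ψp, Ψm, (hJ _ _).2 hp, (hJ _ _).2 hm, hS⟩
  have huniq : ∀ S, IsScatteringMatrix f z S → S = su a b := by
    rintro S ⟨Ψp', Ψm', hp', hm', hS'⟩
    have e1 := ((hJ _ _).1 hp').unique hV hp
    have e2 := ((hJ _ _).1 hm').unique hV hm
    subst e1 e2
    have e := hm.conjTranspose_mul hV hm 0
    calc S = (Ψm' 0)ᴴ * Ψm' 0 * S := by rw [e, Matrix.one_mul]
      _ = (Ψm' 0)ᴴ * Ψm' 0 * su a b := by rw [Matrix.mul_assoc, ← hS', hS, ← Matrix.mul_assoc]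
      _ = su a b := by rw [e, Matrix.one_mul]
  refine ⟨⟨Ψp, (hJ _ _).2 hp, fun Ψ h => ((hJ _ _).1 h).unique hV hp⟩,
    ⟨Ψm, (hJ _ _).2 hm, fun Ψ h => ((hJ _ _).1 h).unique hV hm⟩, ⟨_, hex, huniq⟩, ?_⟩
  have h1 : ∃ S, IsScatteringMatrix f z S := ⟨_, hex⟩
  rw [scatteringMatrix, dif_pos h1]
  exact huniq _ h1.choose_spec

theorem reflectionCoefficient_of_eq_su {z : ℝ} {a b : ℂ} (h : scatteringMatrix f z = su a b) :
    reflectionCoefficient f z = -b / conj a := by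
  rw [reflectionCoefficient, h]; rfl

end

end

end SineGordon

theorem mainTheorem5 (f : (ℝ → ℝ) × (ℝ → ℝ)) (hf : f ∈ SineGordon.initialDataSpace)
    (ha : ∀ z : ℝ, z ≠ 0 → SineGordon.scatteringMatrix f z 0 0 ≠ 0) :
    (∀ z : ℝ, z ≠ 0 →
      (∃! Ψ, SineGordon.IsJost f z atTop Ψ) ∧ (∃! Ψ, SineGordon.IsJost f z atBot Ψ) ∧
      ∃! S, SineGordon.IsScatteringMatrix f z S) ∧
    SineGordon.MemH11 (SineGordon.reflectionCoefficient f) ∧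
    Tendsto (fun z : ℝ => SineGordon.reflectionCoefficient f z / (z : ℂ)) (𝓝[≠] 0) (𝓝 0) := by
  obtain ⟨F, G, g, h, k, p, hF, hG, hh⟩ := SineGordon.exists_profile hf
  have hr := p.weighted.regular
  have hpos : ∀ z : ℝ, 0 < z → _ := fun z hz =>
    SineGordon.scattering_of_hasScattering p hF hG hh (hr.hasScattering_of_pos hz)
  have hneg : ∀ z : ℝ, 0 < z → _ := fun z hz =>
    SineGordon.scattering_of_hasScattering p hF hG hh (hr.hasScattering_of_neg hz)
  have hrp : ∀ z : ℝ, 0 < z → SineGordon.reflectionCoefficient f z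
      = (SineGordon.pot F G h).rho (SineGordon.lam z) := fun z hz =>
    SineGordon.reflectionCoefficient_of_eq_su (hpos z hz).2.2.2
  have hrn : ∀ z : ℝ, 0 < z → SineGordon.reflectionCoefficient f (-z)
      = starRingEnd ℂ ((SineGordon.pot F G h).rho (SineGordon.lam z)) := fun z hz => by
    rw [SineGordon.reflectionCoefficient_of_eq_su (hneg z hz).2.2.2, SineGordon.Potential.rho,
      map_div₀, map_neg]
  have hane : ∀ l, (SineGordon.pot F G h).a l ≠ 0 := fun l => by
    have hz := SineGordon.eps_pos (-l)
    have h1 := ha _ hz.ne'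
    rw [(hpos _ hz).2.2.2, SineGordon.lam_eps] at h1
    exact h1
  obtain ⟨W, hW⟩ := p.exists_lineSob_rho hane
  -- the value of the reflection coefficient at `z = 0` is irrelevant and set to zero
  set R : ℝ → ℂ := fun z => if z = 0 then 0 else SineGordon.reflectionCoefficient f z with hR
  have hRne : ∀ z, z ≠ 0 → R z = SineGordon.reflectionCoefficient f z := fun z hz => if_neg hz
  obtain ⟨⟨V, hV⟩, hlim⟩ := hW.exists_comp_lam (R := R)
    (fun z hz => (hRne z hz.ne').trans (hrp z hz))
    (fun z hz => (hRne (-z) (neg_ne_zero.2 hz.ne')).trans (hrn z hz)) (if_pos rfl)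
  refine ⟨fun z hz => ?_, hV.memH11 ?_, hlim.congr' ?_⟩
  · rcases lt_or_gt_of_ne hz with h1 | h1
    · obtain ⟨e1, e2, e3, -⟩ := hneg (-z) (neg_pos.2 h1)
      rw [neg_neg] at e1 e2 e3
      exact ⟨e1, e2, e3⟩
    · obtain ⟨e1, e2, e3, -⟩ := hpos z h1
      exact ⟨e1, e2, e3⟩
  · have : ∀ᵐ z : ℝ, z ≠ 0 := by simp [ae_iff]
    filter_upwards [this] with z hz
    exact (hRne z hz).symm
  · filter_upwards [self_mem_nhdsWithin] with z hz
    rw [hRne z hz]
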